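/- **Model.** A consumer lives for $T<\infty$ periods, $T\ge 1$. Her type $\theta_t\in\{l,h\}$ follows a Markov chain with initial distribution $\pi_l,\pi_h>0$ and time-invariant transition probabilities $\pi_{ij}=\mathbb P(\theta_{t+1}=j\mid\theta_t=i)$ that are persistent: $\pi_{ii}>\pi_{ji}$ for $i\ne j$. Income $y_t$ lies in a finite set $Y\subset\mathbb R_+$ and is drawn from $p_{\theta_t}\in\Delta Y$, with $p_h(y)>0$ for all $y$ (so that the likelihood ratios $p_l(y)/p_h(y)$ are defined) and $\sum_y p_l(y)y<\sum_y p_h(y)y$. The Bernoulli utility $u:\mathbb R_+\to\mathbb R$ is twice continuously differentiable, strictly concave and strictly increasing, and the discount factor of the consumer and of the firms is $\delta\in(0,1)$. For a flow contract $z\in\mathbb R_+^Y$ write $v(z,\theta)=\sum_y p_\theta(y)u(z(y))$. A realization-independent direct mechanism $M$ assigns to every period $t$ and every sequence of announcements $\theta^t\in\{l,h\}^t$ a flow contract $z_t(\theta^t)$. It is incentive compatible if truth-telling maximizes the ex ante expected discounted utility over all reporting strategies (each report may depend on past incomes, reports and types and on the current type). $V_t(\theta^t)$ is the continuation utility under truth-telling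 from period $t$ on, and $\Pi_i(M)$ is the expected discounted value of income minus consumption conditional on $\theta_1=i$; $\Pi(M)=\pi_l\Pi_l(M)+\pi_h\Pi_h(M)$. **Cost supermodularity.** Let $\chi(\nu,\Delta)$ be the infimum of $\sum_y p_h(y)z(y)$ over $z\in\mathbb R_+^Y$ with $v(z,h)=\nu$ and $v(z,l)=\nu-\Delta$. Assume that $\partial^2\chi/\partial\nu\,\partial\Delta\ge 0$ at every $(\nu,\Delta)$ with $\Delta\ge 0$ at which this problem has a strictly positive solution. **Competitive equilibrium contract.** Let $c^{FI}_l=\mathbb E[\sum_{t=1}^T\delta^{t-1}y_t\mid\theta_1=l]/\sum_{t=1}^T\delta^{t-1}$ and $V^{FI}_l=u(c^{FI}_l)\sum_{t=1}^T\delta^{t-1}$. A contract $M^{V^*}$ is a mechanism that maximizes $\Pi$ among the incentive compatible mechanisms with $V_1(i)=V^*_i$ for $i=l,h$, where $V^*_l=V^{FI}_l$ and where $\Pi_h(M^{V^*})=0$. It is interior if its consumption under truth-telling is strictly positive with probability one. **Pessimistic re-entry offer.** Let $c^o=\sum_y p_l(y)y$ and $V^o_t=u(c^o)\sum_{\tau=t}^T\delta^{\tau-t}$.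 **Lemma.** Assume in addition that the low type is absorbing, $\pi_{ll}=1$, and that $M^{V^*}$ is interior. Then $$V_t(\theta^t)\ \ge\ V^o_t$$ for all $t=1,\dots,T$ and every type history $\theta^t$ of positive probability. Hence the commitment outcome survives consumer re-entry, in the following sense: there is a mechanism $M'$ that gives the same consumption as $M^{V^*}$ with probability one under truth-telling, and such that for either initial type no combination of a reporting strategy with a plan of leaving, in some period $t\ge 2$ that may depend on the private history and the current type, for the offer of constant consumption $c^o$ in all remaining periods yields more than telling the truth and never leaving. -/

import Mathlib

open scoped NNReal

noncomputable section

/-- The two risk types of the consumer. -/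
inductive RiskType where
  | low : RiskType
  | high : RiskType
deriving DecidableEq

instance : Fintype RiskType :=
  ⟨{RiskType.low, RiskType.high}, fun x => by cases x <;> simp⟩

/-- Primitives of the dynamic insurance model with finite horizon `T`. -/
structure InsuranceModel where
  /-- number of periods -/
  T : ℕ
  T_pos : 1 ≤ T
  /-- finite set of income levels -/
  Y : Finset ℝ
  Y_nonneg : ∀ y ∈ Y, 0 ≤ y
  /-- `p θ` is the income distribution of a consumer whose current type is `θ` -/
  p : RiskType → Y → ℝ
  p_nonneg : ∀ θ y, 0 ≤ p θ y
  p_sum : ∀ θ, ∑ y, p θ y = 1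
  /-- so that the likelihood ratios `p low y / p high y` make sense -/
  p_high_pos : ∀ y, 0 < p RiskType.high y
  mean_lt : ∑ y : Y, p RiskType.low y * (y : ℝ) < ∑ y : Y, p RiskType.high y * (y : ℝ)
  /-- distribution of the initial type -/
  init : RiskType → ℝ
  init_pos : ∀ θ, 0 < init θ
  init_sum : ∑ θ, init θ = 1
  /-- `trans i j` is the probability of moving from type `i` to type `j` -/
  trans : RiskType → RiskType → ℝ
  trans_nonneg : ∀ i j, 0 ≤ trans i j
  trans_sum : ∀ i, ∑ j, trans i j = 1
  /-- types are persistent -/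
  persistent : ∀ i j, i ≠ j → trans j i < trans i i
  /-- discount factor -/
  δ : ℝ
  δ_pos : 0 < δ
  δ_lt_one : δ < 1
  /-- Bernoulli utility; only its values on `[0, ∞)` matter -/
  u : ℝ → ℝ
  u_contDiff : ContDiffOn ℝ 2 u (Set.Ici 0)
  u_strictConcave : StrictConcaveOn ℝ (Set.Ici 0) u
  u_strictMono : StrictMonoOn u (Set.Ici 0)

namespace InsuranceModel

variable (m : InsuranceModel)

/-- A flow contract: nonnegative consumption for each income realization. -/
abbrev FlowContract : Type := m.Y → ℝ≥0

/-- Expected flow utility of flow contract `z` for a consumer of current type `θ`. -/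
def v (z : m.FlowContract) (θ : RiskType) : ℝ := ∑ y, m.p θ y * m.u (z y)

/-- Expected flow profit from flow contract `z` with a consumer of current type `θ`. -/
def ξ (z : m.FlowContract) (θ : RiskType) : ℝ := ∑ y : m.Y, m.p θ y * ((y : ℝ) - z y)

/-- A realization-independent direct mechanism. The flow contract of period `t` depends on the
announcements made in periods `1, …, t` only. Histories are lists with the most recent entry
first: `M [θ_t, …, θ_1]` is the flow contract of period `t`. Only nonempty lists of length at most
`T` are ever used. -/
abbrev Mechanism : Type := List RiskType → m.FlowContract

/-- A private history (most recent period first): realized income, announced type and true type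
of each past period. -/
abbrev PrivateHistory : Type := List (m.Y × RiskType × RiskType)

/-- The announcements contained in a private history. -/
def reports (η : m.PrivateHistory) : List RiskType := η.map fun e => e.2.1

/-- A reporting strategy: an announcement for each private history and each current type. -/
abbrev ReportingStrategy : Type := m.PrivateHistory → RiskType → RiskType

/-- The truth-telling strategy. -/
def truthful : m.ReportingStrategy := fun _ θ => θ

/-- Expected discounted utility over the `n` remaining periods (the current one included) of a
consumer with private history `η` and current type `θ` who follows the reporting strategy `r`. -/
def strategyUtility (M : m.Mechanism) (r : m.ReportingStrategy) :
    ℕ → m.PrivateHistory → RiskType → ℝ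
  | 0, _, _ => 0
  | n + 1, η, θ =>
      m.v (M (r η θ :: m.reports η)) θ +
        m.δ * ∑ y, m.p θ y * ∑ θ', m.trans θ θ' *
          strategyUtility M r n ((y, r η θ, θ) :: η) θ'

/-- Ex ante expected discounted utility of the reporting strategy `r` in the mechanism `M`. -/
def exAnteUtility (M : m.Mechanism) (r : m.ReportingStrategy) : ℝ :=
  ∑ θ, m.init θ * m.strategyUtility M r m.T [] θ

/-- Incentive compatibility: no reporting strategy does better than truth-telling. -/
def IncentiveCompatible (M : m.Mechanism) : Prop :=
  ∀ r : m.ReportingStrategy, m.exAnteUtility M r ≤ m.exAnteUtility M m.truthful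

/-- Expected discounted utility under truth-telling over the `n` remaining periods (the current
one included), after the past types `past` and with current type `θ`. -/
def truthfulUtility (M : m.Mechanism) : ℕ → List RiskType → RiskType → ℝ
  | 0, _, _ => 0
  | n + 1, past, θ =>
      m.v (M (θ :: past)) θ +
        m.δ * ∑ θ', m.trans θ θ' * truthfulUtility M n (θ :: past) θ'

/-- Consistency of the two definitions of truth-telling utility. -/
theorem strategyUtility_truthful (M : m.Mechanism) (n : ℕ) (η : m.PrivateHistory)
    (θ : RiskType) :
    m.strategyUtility M m.truthful n η θ = m.truthfulUtility M n (m.reports η) θ := by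
  induction n generalizing η θ with
  | zero => rfl
  | succ n ih =>
    have hs : ∀ y : m.Y, m.reports ((y, m.truthful η θ, θ) :: η) = θ :: m.reports η :=
      fun _ => rfl
    simp only [strategyUtility, truthfulUtility, ih, hs]
    rw [← Finset.sum_mul, m.p_sum, one_mul]
    rfl

/-- The continuation utility `V_t (M ∣ θ^{t-1}, θ_t)` under truth-telling in period
`t = past.length + 1`, where `past = θ^{t-1}` (most recent first) and `θ = θ_t`. -/
def V (M : m.Mechanism) (past : List RiskType) (θ : RiskType) : ℝ :=
  m.truthfulUtility M (m.T - past.length) past θ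

/-- Expected discounted profit over the `n` remaining periods under truth-telling, after the past
types `past` and with current type `θ`. -/
def continuationProfit (M : m.Mechanism) : ℕ → List RiskType → RiskType → ℝ
  | 0, _, _ => 0
  | n + 1, past, θ =>
      m.ξ (M (θ :: past)) θ +
        m.δ * ∑ θ', m.trans θ θ' * continuationProfit M n (θ :: past) θ'

/-- Expected discounted profit conditional on the initial type `θ`. -/
def profitGiven (M : m.Mechanism) (θ : RiskType) : ℝ := m.continuationProfit M m.T [] θ

/-- Expected discounted profit. -/
def profit (M : m.Mechanism) : ℝ := ∑ θ, m.init θ * m.profitGiven M θ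

/-- `M` maximizes profits among the incentive compatible mechanisms that deliver the utility
`W θ` to the consumer of initial type `θ`, for both `θ`. -/
def IsProfitMaximizing (W : RiskType → ℝ) (M : m.Mechanism) : Prop :=
  m.IncentiveCompatible M ∧ (∀ θ, m.V M [] θ = W θ) ∧
    ∀ M' : m.Mechanism, m.IncentiveCompatible M' → (∀ θ, m.V M' [] θ = W θ) →
      m.profit M' ≤ m.profit M

/-- `∑_{s < n} δ^s`. -/
def annuity (n : ℕ) : ℝ := ∑ s ∈ Finset.range n, m.δ ^ s

/-- Expected income of a consumer of current type `θ`. -/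
def meanIncome (θ : RiskType) : ℝ := ∑ y : m.Y, m.p θ y * (y : ℝ)

/-- Expected discounted income over `n` periods, starting from current type `θ`. -/
def discountedIncome : ℕ → RiskType → ℝ
  | 0, _ => 0
  | n + 1, θ => m.meanIncome θ + m.δ * ∑ θ', m.trans θ θ' * discountedIncome n θ'

/-- The full information consumption: discounted average expected lifetime income. -/
def cFI (θ : RiskType) : ℝ := m.discountedIncome m.T θ / m.annuity m.T

/-- The full information utility. -/
def VFI (θ : RiskType) : ℝ := m.u (m.cFI θ) * m.annuity m.T

/-- `M` is the competitive equilibrium contract `M^{V*}`: it maximizes profits given the utility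
pair `V*` that it delivers, where `V*` gives the low type the full information utility and yields
zero profits conditional on an initially high type. -/
def IsCompetitiveContract (M : m.Mechanism) : Prop :=
  ∃ Vstar : RiskType → ℝ, Vstar RiskType.low = m.VFI RiskType.low ∧
    m.IsProfitMaximizing Vstar M ∧ m.profitGiven M RiskType.high = 0

/-- Probability of a type history (most recent type first). -/
def historyProb : List RiskType → ℝ
  | [] => 1
  | [θ] => m.init θ
  | θ' :: θ :: past => historyProb (θ :: past) * m.trans θ θ'

/-- Interiority: consumption is strictly positive with probability one. -/
def Interior (M : m.Mechanism) : Prop :=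
  ∀ (past : List RiskType) (θ : RiskType), past.length < m.T → 0 < m.historyProb (θ :: past) →
    ∀ y, 0 < m.p θ y → 0 < M (θ :: past) y

/-- The low type is absorbing. -/
def LowAbsorbing : Prop := m.trans RiskType.low RiskType.low = 1

/-- Feasibility in the auxiliary cost minimization problem with parameters `(ν, Δ)`. -/
def AuxFeasible (ν Δ : ℝ) (z : m.FlowContract) : Prop :=
  m.v z RiskType.high = ν ∧ m.v z RiskType.low = ν - Δ

/-- Objective of the auxiliary problem: expected consumption of the high type. -/
def auxCost (z : m.FlowContract) : ℝ := ∑ y, m.p RiskType.high y * (z y : ℝ)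

/-- The auxiliary cost function. -/
def χ (ν Δ : ℝ) : ℝ := sInf (m.auxCost '' {z | m.AuxFeasible ν Δ z})

/-- The auxiliary problem at `(ν, Δ)` has an interior solution. -/
def HasInteriorAuxSolution (ν Δ : ℝ) : Prop :=
  ∃ z : m.FlowContract, m.AuxFeasible ν Δ z ∧
    (∀ z', m.AuxFeasible ν Δ z' → m.auxCost z ≤ m.auxCost z') ∧ ∀ y, 0 < z y

/-- Cost supermodularity: the cross derivative of the auxiliary cost function is nonnegative
wherever the auxiliary problem with a nonnegative distortion has an interior solution. -/
def CostSupermodular : Prop :=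
  ∀ ν Δ : ℝ, 0 ≤ Δ → m.HasInteriorAuxSolution ν Δ →
    0 ≤ deriv (fun Δ' => deriv (fun ν' => m.χ ν' Δ') ν) Δ

/-- Constant consumption in the pessimistic re-entry offer: the expected income of a low type. -/
def cO : ℝ := m.meanIncome RiskType.low

/-- The value `V^o_t = u(c^o) ∑_{τ=t}^T δ^{τ-t}` of the pessimistic re-entry offer in period `t`. -/
def VO (t : ℕ) : ℝ := m.u m.cO * ∑ τ ∈ Finset.Icc t m.T, m.δ ^ (τ - t)

/-- A re-entry plan: whether to leave for the re-entry offer, for each private history and each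
current type. -/
abbrev ReentryPlan : Type := m.PrivateHistory → RiskType → Bool

/-- Expected discounted utility over the `n` remaining periods of a consumer who starts out in the
mechanism `M`, reports according to `r` and, from the second period on, leaves for the pessimistic
re-entry offer (consumption `c^o` in all remaining periods) as soon as `e` tells her to. -/
def reentryUtility (M : m.Mechanism) (r : m.ReportingStrategy) (e : m.ReentryPlan) :
    ℕ → m.PrivateHistory → RiskType → ℝ
  | 0, _, _ => 0
  | n + 1, η, θ =>
      if η ≠ [] ∧ e η θ = true then m.VO (η.length + 1)
      else
        m.v (M (r η θ :: m.reports η)) θ +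
          m.δ * ∑ y, m.p θ y * ∑ θ', m.trans θ θ' *
            reentryUtility M r e n ((y, r η θ, θ) :: η) θ'

/-- Two mechanisms give the same consumption with probability one under truth-telling. -/
def SameOutcome (M M' : m.Mechanism) : Prop :=
  ∀ (past : List RiskType) (θ : RiskType), past.length < m.T → 0 < m.historyProb (θ :: past) →
    ∀ y, 0 < m.p θ y → M' (θ :: past) y = M (θ :: past) y

end InsuranceModel

end

/-! Let `q` be the probability that a high type becomes low. Since low is absorbing, a type history
of positive probability is a run of highs followed by lows. A mechanism therefore reduces to the
flow contracts `z i` along the all-high path and the certainty equivalents `c i` of a low type after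
`i` high announcements. Granting `c i` as full insurance keeps all utilities on these histories and,
by concavity of utility, costs no more (`IsReduction`). The value of the low type at the start is
`m.u m.cO * m.annuity m.T`, so `c 0` equals `m.cO`. It remains to show that `c i` never falls below
`c 0` and that a high type is never worse off than a low one.

Suppose `q > 0`. Incentive compatibility implies `UpwardIC`: a low type who pretends once more
deviates at a single history of positive probability (`IncentiveCompatible.pretendOnce_le`). The
constraint `DownwardIC` costs nothing: if it fails, pooling both types from the first such date on
is strictly cheaper (`UpwardIC.exists_downwardIC_lt`). This uses that the initial high type gets at
least as much as the low one, which follows from zero profits on the high type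
(`IsProfitMaximizing.low_le_high`). Hence the reduction of an optimal mechanism solves the relaxed
problem with upward constraints only (`CostMinimal`), and equality of costs forces the mechanism
itself to insure fully after a low announcement.

The Kuhn-Tucker conditions (`CostMinimal.exists_multipliers`) give one multiplier `lam` for the
promise and multipliers `μ i ≥ 0` for the upward constraints, linked by a recursion. Cost
supermodularity says that distorting `z i` does not lower the marginal cost of uniform utility: this
cost, `lam - μ i`, is at least the marginal cost of full insurance at the high type's utility
(`mc_le_of_costSupermodular`). With the recursion this makes `c` nondecreasing
(`CostMinimal.le_succ`), so `c i ≥ c 0`.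

If `q = 0`, later constraints are not implied on path and nothing is known about `c i` for `i > 0`.
Averaging utilities over time makes the high type's contract stationary, with equality of costs only
if it was stationary already, and `c` can be taken constant.

In both cases the reduced mechanism dominates leaving state by state
(`reentryUtility_insuringMechanism_le`). -/

noncomputable section

namespace InsuranceModel

variable (m : InsuranceModel)

/-! ### The Bernoulli utility -/

/-- Marginal utility (one-sided at zero). -/
def du (c : ℝ) : ℝ := derivWithin m.u (Set.Ici 0) c

/-- Marginal cost of providing utility at the consumption level `c`. -/
def mc (c : ℝ) : ℝ := (m.du c)⁻¹

theorem u_differentiableOn : DifferentiableOn ℝ m.u (Set.Ici 0) :=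
  m.u_contDiff.differentiableOn (by norm_num)

theorem u_continuousOn : ContinuousOn m.u (Set.Ici 0) := m.u_contDiff.continuousOn

theorem hasDerivWithinAt_u {c : ℝ} (hc : 0 ≤ c) :
    HasDerivWithinAt m.u (m.du c) (Set.Ici 0) c :=
  (m.u_differentiableOn c hc).hasDerivWithinAt

/-- Strict concavity in tangent form. The slope at `c = 0` is the one-sided derivative, which is
finite, so no positivity of consumption is needed. All cost comparisons below come from this
inequality. -/
theorem u_lt_tangent {c x : ℝ} (hc : 0 ≤ c) (hx : 0 ≤ x) (hne : x ≠ c) :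
    m.u x < m.u c + m.du c * (x - c) := by
  rcases lt_or_gt_of_ne hne with h | h
  · have := m.u_strictConcave.lt_slope_of_hasDerivWithinAt hx hc h (m.hasDerivWithinAt_u hc)
    rw [slope_def_field, lt_div_iff₀ (by linarith)] at this
    linarith
  · have := m.u_strictConcave.slope_lt_of_hasDerivWithinAt hc hx h (m.hasDerivWithinAt_u hc)
    rw [slope_def_field, div_lt_iff₀ (by linarith)] at this
    linarith

theorem du_pos {c : ℝ} (hc : 0 ≤ c) : 0 < m.du c := by
  have h1 := m.u_lt_tangent (x := c + 1) hc (by linarith) (by linarith)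
  have h2 := m.u_strictMono (a := c) (b := c + 1) hc (by simp only [Set.mem_Ici]; linarith)
    (by linarith)
  linarith

theorem mc_pos {c : ℝ} (hc : 0 ≤ c) : 0 < m.mc c := inv_pos.2 (m.du_pos hc)

theorem du_strictAntiOn : StrictAntiOn m.du (Set.Ici 0) :=
  m.u_strictConcave.strictAntiOn_derivWithin m.u_differentiableOn

theorem mc_strictMonoOn : StrictMonoOn m.mc (Set.Ici 0) := fun _ ha _ hb hab =>
  inv_strictAnti₀ (m.du_pos hb) (m.du_strictAntiOn ha hb hab)

/-- Providing the utility `u x` costs more than the linearized cost at `c`. -/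
theorem tangent_cost_lt {c x : ℝ} (hc : 0 ≤ c) (hx : 0 ≤ x) (hne : x ≠ c) :
    c + (m.u x - m.u c) * m.mc c < x := by
  have h := m.u_lt_tangent hc hx hne
  have : (m.u x - m.u c) * m.mc c < x - c := by
    rw [mc, ← div_eq_mul_inv, div_lt_iff₀ (m.du_pos hc)]
    linarith
  linarith

theorem tangent_cost_le {c x : ℝ} (hc : 0 ≤ c) (hx : 0 ≤ x) :
    c + (m.u x - m.u c) * m.mc c ≤ x := by
  rcases eq_or_ne x c with rfl | h
  · simp
  · exact (m.tangent_cost_lt hc hx h).le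

theorem du_contDiffOn : ContDiffOn ℝ 1 m.du (Set.Ici 0) :=
  m.u_contDiff.derivWithin (uniqueDiffOn_Ici 0) (by norm_num)

theorem mc_contDiffOn : ContDiffOn ℝ 1 m.mc (Set.Ici 0) :=
  m.du_contDiffOn.inv fun _ hc => (m.du_pos hc).ne'

theorem mc_continuousOn : ContinuousOn m.mc (Set.Ici 0) := m.mc_contDiffOn.continuousOn

/-- Every utility level between two attained ones is attained. -/
theorem exists_consumption {x b : ℝ} (hb : 0 ≤ b) (h0 : m.u 0 ≤ x) (hx : x ≤ m.u b) :
    ∃ c, 0 ≤ c ∧ c ≤ b ∧ m.u c = x := by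
  obtain ⟨c, hc, rfl⟩ := intermediate_value_Icc hb
    (m.u_continuousOn.mono Set.Icc_subset_Ici_self) ⟨h0, hx⟩
  exact ⟨c, hc.1, hc.2, rfl⟩

theorem u_zero_le {c : ℝ} (hc : 0 ≤ c) : m.u 0 ≤ m.u c :=
  m.u_strictMono.monotoneOn (by simp) hc hc

theorem u_le_u_iff {a b : ℝ} (ha : 0 ≤ a) (hb : 0 ≤ b) : m.u a ≤ m.u b ↔ a ≤ b :=
  m.u_strictMono.le_iff_le ha hb

theorem u_lt_u_iff {a b : ℝ} (ha : 0 ≤ a) (hb : 0 ≤ b) : m.u a < m.u b ↔ a < b :=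
  m.u_strictMono.lt_iff_lt ha hb

theorem mc_le_mc_iff {a b : ℝ} (ha : 0 ≤ a) (hb : 0 ≤ b) : m.mc a ≤ m.mc b ↔ a ≤ b :=
  m.mc_strictMonoOn.le_iff_le ha hb

theorem mc_lt_mc_iff {a b : ℝ} (ha : 0 ≤ a) (hb : 0 ≤ b) : m.mc a < m.mc b ↔ a < b :=
  m.mc_strictMonoOn.lt_iff_lt ha hb

theorem u_injOn : Set.InjOn m.u (Set.Ici 0) := m.u_strictMono.injOn

theorem hasStrictDerivAt_u {c : ℝ} (hc : 0 < c) : HasStrictDerivAt m.u (m.du c) c := by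
  have hn : Set.Ici (0 : ℝ) ∈ nhds c := Ici_mem_nhds hc
  have h1 : ContDiffAt ℝ 2 m.u c := m.u_contDiff.contDiffAt hn
  have h2 := h1.hasStrictDerivAt (by norm_num)
  have h3 : deriv m.u c = m.du c := (derivWithin_of_mem_nhds hn).symm
  rwa [h3] at h2

/-- A path of consumption levels along which utility moves with constant speed `d`. -/
theorem exists_utility_path {c : ℝ} (hc : 0 < c) (d : ℝ) :
    ∃ γ : ℝ → ℝ, γ 0 = c ∧ HasDerivAt γ (m.mc c * d) 0 ∧
      ∀ᶠ t in nhds (0 : ℝ), 0 ≤ γ t ∧ m.u (γ t) = m.u c + t * d := by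
  have hs := m.hasStrictDerivAt_u hc
  have hne := (m.du_pos hc.le).ne'
  -- The path is the local inverse of `m.u` along an affine function; `0 < c` makes the derivative
  -- of `m.u` at `c` two-sided.
  set g := hs.localInverse m.u (m.du c) c hne with hg
  have hg0 : g (m.u c) = c := HasStrictFDerivAt.localInverse_apply_image _
  have hgd : HasDerivAt g (m.mc c) (m.u c) := (hs.to_localInverse hne).hasDerivAt
  have hl : HasDerivAt (fun t : ℝ => m.u c + t * d) d 0 := by
    simpa using ((hasDerivAt_id (0 : ℝ)).mul_const d).const_add (m.u c)
  have hγ : HasDerivAt (fun t : ℝ => g (m.u c + t * d)) (m.mc c * d) 0 := by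
    have := HasDerivAt.comp (h₂ := g) (h := fun t : ℝ => m.u c + t * d) (h₂' := m.mc c) 0
      (by simpa using hgd) hl
    exact this
  refine ⟨fun t => g (m.u c + t * d), by simp [hg0], hγ, ?_⟩
  have ht : Filter.Tendsto (fun t : ℝ => m.u c + t * d) (nhds 0) (nhds (m.u c)) := by
    simpa using hl.continuousAt.tendsto
  have e1 := ht.eventually (hs.eventually_right_inverse hne)
  have e2 : ∀ᶠ t in nhds (0 : ℝ), 0 < g (m.u c + t * d) := by
    apply hγ.continuousAt.eventually_const_lt
    simpa [hg0] using hc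
  filter_upwards [e1, e2] with t h1 h2
  exact ⟨h2.le, h1⟩

/-- On compact sets, the marginal cost varies at most proportionally with utility. -/
theorem exists_sq_mc_sub_le {a b : ℝ} (ha : 0 ≤ a) :
    ∃ C, 0 ≤ C ∧ ∀ x ∈ Set.Icc a b, ∀ y ∈ Set.Icc a b,
      (m.mc x - m.mc y) ^ 2 ≤ C * ((m.mc x - m.mc y) * (m.u x - m.u y)) := by
  rcases lt_or_ge b a with hba | hab
  · exact ⟨0, le_rfl, fun x hx => absurd (hx.1.trans hx.2) (not_le.2 hba)⟩
  have hsub : Set.Icc a b ⊆ Set.Ici 0 := fun x hx => ha.trans hx.1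
  obtain ⟨K, hK⟩ := (m.mc_contDiffOn.mono hsub).exists_lipschitzOnWith (by norm_num)
    (convex_Icc a b) isCompact_Icc
  have hb : 0 ≤ b := ha.trans hab
  have hd := m.du_pos hb
  -- the slope of `u` on the interval is at least `du b`
  have key : ∀ x ∈ Set.Icc a b, ∀ y ∈ Set.Icc a b, y ≤ x →
      (m.mc x - m.mc y) ^ 2 ≤ (K * m.mc b) * ((m.mc x - m.mc y) * (m.u x - m.u y)) := by
    intro x hx y hy hyx
    have hx0 := hsub hx
    have hy0 := hsub hy
    have h1 : m.mc x - m.mc y ≤ K * (x - y) := by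
      have := hK.dist_le_mul x hx y hy
      rw [Real.dist_eq, Real.dist_eq, abs_of_nonneg (sub_nonneg.2 hyx)] at this
      exact (le_abs_self _).trans this
    have h0 : 0 ≤ m.mc x - m.mc y := sub_nonneg.2 ((m.mc_le_mc_iff hy0 hx0).2 hyx)
    have h2 : m.du b * (x - y) ≤ m.u x - m.u y := by
      have h3 : m.u y ≤ m.u x + m.du x * (y - x) := by
        rcases eq_or_ne y x with rfl | h
        · simp
        · exact (m.u_lt_tangent hx0 hy0 h).le
      have h4 : m.du b ≤ m.du x := m.du_strictAntiOn.antitoneOn hx0 hb hx.2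
      nlinarith [mul_le_mul_of_nonneg_right h4 (sub_nonneg.2 hyx)]
    have h5 : x - y ≤ m.mc b * (m.u x - m.u y) := by
      rw [mc, ← div_eq_inv_mul, le_div_iff₀ hd]
      linarith
    calc (m.mc x - m.mc y) ^ 2 = (m.mc x - m.mc y) * (m.mc x - m.mc y) := sq _
      _ ≤ (m.mc x - m.mc y) * (K * (m.mc b * (m.u x - m.u y))) :=
        mul_le_mul_of_nonneg_left (h1.trans (mul_le_mul_of_nonneg_left h5 K.2)) h0
      _ = _ := by ring
  refine ⟨K * m.mc b, mul_nonneg K.2 (m.mc_pos hb).le, fun x hx y hy => ?_⟩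
  rcases le_total y x with h | h
  · exact key x hx y hy h
  · have := key y hy x hx h
    nlinarith [this]

end InsuranceModel

end

/-! ### Two tools on real functions, and the auxiliary problem through its multipliers. -/

noncomputable section

/-- A Lipschitz function with nonnegative derivative is nondecreasing between the endpoints. -/
theorem LipschitzOnWith.le_of_deriv_nonneg {f : ℝ → ℝ} {K : ℝ≥0} {a b : ℝ} (hab : a ≤ b)
    (hf : LipschitzOnWith K f (Set.Icc a b)) (hd : ∀ x ∈ Set.Icc a b, 0 ≤ deriv f x) :
    f a ≤ f b := by
  -- A Lipschitz function is absolutely continuous, so its increment is the integral of `deriv f`.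
  -- The value `0` that `deriv` takes at points of non-differentiability is thus harmless.
  have hac : AbsolutelyContinuousOnInterval f a b := by
    apply LipschitzOnWith.absolutelyContinuousOnInterval (K := K)
    rwa [Set.uIcc_of_le hab]
  have h := hac.integral_deriv_eq_sub
  have h2 : 0 ≤ ∫ x in a..b, deriv f x := intervalIntegral.integral_nonneg hab hd
  linarith

/-- A continuous strictly increasing function on a compact interval extends to an order
isomorphism of the real line. -/
theorem StrictMonoOn.exists_orderIso_extension {f : ℝ → ℝ} {a b : ℝ} (hab : a ≤ b)
    (hf : StrictMonoOn f (Set.Icc a b)) (hc : ContinuousOn f (Set.Icc a b)) :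
    ∃ F : ℝ ≃o ℝ, ∀ x ∈ Set.Icc a b, F x = f x := by
  set P : ℝ → ℝ := fun x => max a (min b x) with hP
  have hPm : ∀ x, P x ∈ Set.Icc a b := fun x =>
    ⟨le_max_left _ _, max_le hab (min_le_left _ _)⟩
  have hPc : Continuous P := by fun_prop
  have hPmono : Monotone P := fun x y h => max_le_max le_rfl (min_le_min le_rfl h)
  have hPid : ∀ x ∈ Set.Icc a b, P x = x := fun x hx => by
    simp only [hP]; rw [min_eq_right hx.2, max_eq_right hx.1]
  have hQ : ∀ x y, x < y → P x = P y ∨ P x < P y := fun x y h => (hPmono h.le).eq_or_lt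
  have hR : Monotone fun x => x - P x := by
    intro x y h
    simp only [hP]
    rcases max_cases a (min b x) with h1 | h1 <;> rcases max_cases a (min b y) with h2 | h2 <;>
    rcases min_cases b x with h3 | h3 <;> rcases min_cases b y with h4 | h4 <;> linarith
  -- `P` projects onto the interval; outside it `f` is continued with slope one.
  set g : ℝ → ℝ := fun x => f (P x) + (x - P x) with hg
  have hgc : Continuous g :=
    (hc.comp_continuous hPc hPm).add (continuous_id.sub hPc)
  have hgm : StrictMono g := by
    intro x y h
    rcases hQ x y h with h1 | h1
    · simp only [hg, h1]; linarith
    · have := hf (hPm x) (hPm y) h1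
      have h2 := hR h.le
      simp only [hg]
      simp only at h2
      linarith
  have hgs : Function.Surjective g := by
    intro s
    apply mem_range_of_exists_le_of_exists_ge hgc
    · refine ⟨a - |s - f a|, ?_⟩
      have : P (a - |s - f a|) = a := by
        simp only [hP]
        rw [max_eq_left]
        exact (min_le_right _ _).trans (by linarith [abs_nonneg (s - f a)])
      simp only [hg, this]
      linarith [neg_abs_le (s - f a)]
    · refine ⟨b + |s - f b|, ?_⟩
      have : P (b + |s - f b|) = b := by
        simp only [hP]
        rw [min_eq_left (by linarith [abs_nonneg (s - f b)]), max_eq_right hab]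
      simp only [hg, this]
      linarith [le_abs_self (s - f b)]
  refine ⟨hgm.orderIsoOfSurjective g hgs, fun x hx => ?_⟩
  simp [hg, hPid x hx]

namespace InsuranceModel

variable (m : InsuranceModel)

/-! ### The auxiliary cost function -/

theorem v_mk (g : m.Y → ℝ) (h : ∀ y, 0 ≤ g y) (θ : RiskType) :
    m.v (fun y => ⟨g y, h y⟩) θ = ∑ y, m.p θ y * m.u (g y) := rfl

theorem v_const (c : ℝ≥0) (θ : RiskType) : m.v (fun _ => c) θ = m.u c := by
  simp only [v, ← Finset.sum_mul, m.p_sum, one_mul]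

/-- Likelihood ratio of the low relative to the high type. -/
def lr (y : m.Y) : ℝ := m.p RiskType.low y / m.p RiskType.high y

theorem p_high_mul_lr (y : m.Y) : m.p RiskType.high y * m.lr y = m.p RiskType.low y := by
  rw [lr, mul_div_cancel₀ _ (m.p_high_pos y).ne']

theorem lr_nonneg (y : m.Y) : 0 ≤ m.lr y := div_nonneg (m.p_nonneg _ _) (m.p_high_pos y).le

/-- Variance of the likelihood ratio. -/
def lrVar : ℝ := ∑ y, m.p RiskType.high y * (m.lr y - 1) ^ 2

theorem lrVar_pos : 0 < m.lrVar := by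
  have h0 : ∀ y ∈ Finset.univ, 0 ≤ m.p RiskType.high y * (m.lr y - 1) ^ 2 := fun y _ =>
    mul_nonneg (m.p_high_pos y).le (sq_nonneg _)
  refine lt_of_le_of_ne (Finset.sum_nonneg h0) fun h => ?_
  have h1 := (Finset.sum_eq_zero_iff_of_nonneg h0).1 h.symm
  have h2 : ∀ y, m.p RiskType.low y = m.p RiskType.high y := fun y => by
    have h3 := h1 y (Finset.mem_univ y)
    rw [mul_eq_zero, or_iff_right (m.p_high_pos y).ne', sq_eq_zero_iff, sub_eq_zero] at h3
    rw [← m.p_high_mul_lr, h3, mul_one]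
  have := m.mean_lt
  simp only [h2, lt_self_iff_false] at this

/-- `E_h [(α - β r) x] = α E_h x - β E_l x`. -/
theorem sum_high_affine (α β : ℝ) (x : m.Y → ℝ) :
    ∑ y, m.p RiskType.high y * ((α - β * m.lr y) * x y) =
      α * (∑ y, m.p RiskType.high y * x y) - β * ∑ y, m.p RiskType.low y * x y := by
  rw [Finset.mul_sum, Finset.mul_sum, ← Finset.sum_sub_distrib]
  refine Finset.sum_congr rfl fun y _ => ?_
  rw [← m.p_high_mul_lr]
  ring

theorem sum_high_affine_sq (α β : ℝ) :
    ∑ y, m.p RiskType.high y * (α - β * m.lr y) ^ 2 = (α - β) ^ 2 + m.lrVar * β ^ 2 := by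
  have h1 : ∑ y, m.p RiskType.high y * (m.lr y - 1) = 0 := by
    simp only [mul_sub, m.p_high_mul_lr, mul_one, Finset.sum_sub_distrib, m.p_sum, sub_self]
  have h2 : ∀ y, m.p RiskType.high y * (α - β * m.lr y) ^ 2 =
      (α - β) ^ 2 * m.p RiskType.high y - 2 * (α - β) * β * (m.p RiskType.high y * (m.lr y - 1))
        + β ^ 2 * (m.p RiskType.high y * (m.lr y - 1) ^ 2) := fun y => by ring
  simp only [h2, Finset.sum_add_distrib, Finset.sum_sub_distrib, ← Finset.mul_sum, h1, m.p_sum]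
  rw [lrVar]
  ring

/-- First order condition of the auxiliary problem with multipliers `lam` and `μ`. -/
def AuxFOC (z : m.FlowContract) (lam μ : ℝ) : Prop := ∀ y, m.mc (z y) = lam - μ * m.lr y

/-- Lagrangian bound. Marginal costs are affine in the likelihood ratio, so the linearized cost of
moving from `z` to `z'` depends only on the utility changes of the two types. -/
theorem auxCost_ge {z : m.FlowContract} {lam μ : ℝ} (hz : m.AuxFOC z lam μ)
    (z' : m.FlowContract) :
    m.auxCost z + lam * (m.v z' RiskType.high - m.v z RiskType.high)
      - μ * (m.v z' RiskType.low - m.v z RiskType.low) ≤ m.auxCost z' := by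
  have h1 : ∑ y, m.p RiskType.high y * ((z y : ℝ) + (m.u (z' y) - m.u (z y)) * m.mc (z y)) ≤
      m.auxCost z' :=
    Finset.sum_le_sum fun y _ => mul_le_mul_of_nonneg_left
      (m.tangent_cost_le (z y).2 (z' y).2) (m.p_high_pos y).le
  refine le_trans (le_of_eq ?_) h1
  have h2 := m.sum_high_affine lam μ (fun y => m.u (z' y) - m.u (z y))
  have h3 : ∀ y, (m.u (z' y) - m.u (z y)) * m.mc (z y) =
      (lam - μ * m.lr y) * (m.u (z' y) - m.u (z y)) := fun y => by rw [hz y, mul_comm]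
  simp only [mul_add, Finset.sum_add_distrib, h3, h2]
  simp only [v, auxCost, mul_sub, Finset.sum_sub_distrib]
  ring

theorem auxCost_nonneg (z : m.FlowContract) : 0 ≤ m.auxCost z :=
  Finset.sum_nonneg fun y _ => mul_nonneg (m.p_high_pos y).le (z y).2

theorem χ_le {ν Δ : ℝ} {z : m.FlowContract} (hz : m.AuxFeasible ν Δ z) : m.χ ν Δ ≤ m.auxCost z :=
  csInf_le ⟨0, by rintro _ ⟨z', -, rfl⟩; exact m.auxCost_nonneg z'⟩ ⟨z, hz, rfl⟩

/-- At an unchanged distortion both utilities move together, so only `lam - μ` matters. Feasibility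
at `ν'` is required because the infimum over the empty set would be `0`. -/
theorem le_χ {ν Δ : ℝ} {z : m.FlowContract} {lam μ ν' : ℝ} (hz : m.AuxFeasible ν Δ z)
    (hfoc : m.AuxFOC z lam μ) (hne : ∃ z', m.AuxFeasible ν' Δ z') :
    m.auxCost z + (lam - μ) * (ν' - ν) ≤ m.χ ν' Δ := by
  obtain ⟨z', hz'⟩ := hne
  refine le_csInf ⟨_, z', hz', rfl⟩ ?_
  rintro _ ⟨w, hw, rfl⟩
  have := m.auxCost_ge hfoc w
  rw [hw.1, hw.2, hz.1, hz.2] at this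
  linarith

theorem χ_eq {ν Δ : ℝ} {z : m.FlowContract} {lam μ : ℝ} (hz : m.AuxFeasible ν Δ z)
    (hfoc : m.AuxFOC z lam μ) : m.χ ν Δ = m.auxCost z := by
  refine le_antisymm (m.χ_le hz) ?_
  simpa using m.le_χ hz hfoc ⟨z, hz⟩

theorem hasInteriorAuxSolution_of_auxFOC {ν Δ : ℝ} {z : m.FlowContract} {lam μ : ℝ}
    (hz : m.AuxFeasible ν Δ z) (hfoc : m.AuxFOC z lam μ) (hpos : ∀ y, 0 < z y) :
    m.HasInteriorAuxSolution ν Δ := by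
  refine ⟨z, hz, fun z' hz' => ?_, hpos⟩
  rw [← m.χ_eq hz hfoc]
  exact m.χ_le hz'

/-- The marginal cost of uniformly higher utility is the difference of the multipliers. -/
theorem hasDerivAt_χ {ν Δ : ℝ} {z : m.FlowContract} {lam μ : ℝ} (hz : m.AuxFeasible ν Δ z)
    (hfoc : m.AuxFOC z lam μ) (hpos : ∀ y, 0 < z y) :
    HasDerivAt (fun ν' => m.χ ν' Δ) (lam - μ) ν := by
  -- Raising all utilities by `t` moves `ν` and keeps `Δ`. The cost `U t` of doing so bounds `m.χ`
  -- from above, the Lagrangian bound is a line below it, and both have slope `lam - μ` at the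
  -- common point.
  choose γ hγ0 hγd hγ using fun y => m.exists_utility_path (NNReal.coe_pos.2 (hpos y)) 1
  set U : ℝ → ℝ := fun t => ∑ y, m.p RiskType.high y * γ y t with hU
  have hUd : HasDerivAt U (lam - μ) 0 := by
    have h1 : HasDerivAt U (∑ y, m.p RiskType.high y * (m.mc (z y) * 1)) 0 :=
      HasDerivAt.fun_sum fun y _ => (hγd y).const_mul _
    have h2 : ∑ y, m.p RiskType.high y * (m.mc (z y) * 1) = lam - μ := by
      have := m.sum_high_affine lam μ (fun _ => 1)
      simp only [mul_one, m.p_sum] at this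
      simp only [hfoc _, mul_one, this]
    rwa [h2] at h1
  have hU0 : U 0 = m.auxCost z := by simp only [hU, hγ0, auxCost]
  have hev : ∀ᶠ t in nhds (0 : ℝ), ∀ y, 0 ≤ γ y t ∧ m.u (γ y t) = m.u (z y) + t * 1 :=
    Filter.eventually_all.2 hγ
  have hχ0 := m.χ_eq hz hfoc
  rw [hasDerivAt_iff_isLittleO_nhds_zero] at hUd ⊢
  refine Asymptotics.IsBigO.trans_isLittleO (Asymptotics.IsBigO.of_bound 1 ?_) hUd
  filter_upwards [hev] with t ht
  have hfe : m.AuxFeasible (ν + t) Δ (fun y => ⟨γ y t, (ht y).1⟩) := by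
    have hv : ∀ θ, m.v (fun y => ⟨γ y t, (ht y).1⟩) θ = m.v z θ + t := fun θ => by
      simp only [v_mk, (ht _).2, mul_add, Finset.sum_add_distrib, ← Finset.sum_mul,
        m.p_sum, mul_one, one_mul]
      rfl
    constructor
    · rw [hv, hz.1]
    · rw [hv, hz.2]; ring
  have h1 := m.χ_le hfe
  have h2 := m.le_χ hz hfoc ⟨_, hfe⟩
  have h3 : m.auxCost (fun y => ⟨γ y t, (ht y).1⟩) = U t := rfl
  rw [h3] at h1
  simp only [zero_add, Real.norm_eq_abs, one_mul, hχ0, hU0, smul_eq_mul]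
  rw [abs_of_nonneg (by linarith), abs_of_nonneg (by linarith)]
  linarith

/-- From a contract that satisfies the first order condition, the distortion can be reduced to any
smaller level along contracts that satisfy the first order condition, at constant utility of the
high type and without leaving the range of consumption levels. -/
theorem exists_auxFOC_path {z : m.FlowContract} {lam μ a b : ℝ} (hfoc : m.AuxFOC z lam μ)
    (hμ : 0 ≤ μ) (ha : 0 ≤ a) (hab : ∀ y, (z y : ℝ) ∈ Set.Icc a b) {Δ' : ℝ} (h0 : 0 ≤ Δ')
    (h1 : Δ' ≤ m.v z RiskType.high - m.v z RiskType.low) :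
    ∃ (w : m.FlowContract) (lam' μ' : ℝ), m.AuxFOC w lam' μ' ∧
      m.AuxFeasible (m.v z RiskType.high) Δ' w ∧ ∀ y, (w y : ℝ) ∈ Set.Icc a b := by
  have hne : (Finset.univ : Finset m.Y).Nonempty := by
    by_contra h
    rw [Finset.not_nonempty_iff_eq_empty] at h
    have := m.p_sum RiskType.high
    rw [h] at this
    simp at this
  obtain ⟨yR, -, hyR⟩ := Finset.exists_max_image _ m.lr hne
  obtain ⟨yr, -, hyr⟩ := Finset.exists_min_image _ m.lr hne
  replace hyR := fun y => hyR y (Finset.mem_univ y)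
  replace hyr := fun y => hyr y (Finset.mem_univ y)
  have hle : a ≤ b := (hab yR).1.trans (hab yR).2
  have hsub : Set.Icc a b ⊆ Set.Ici 0 := fun x hx => ha.trans hx.1
  obtain ⟨F, hF⟩ := (m.mc_strictMonoOn.mono hsub).exists_orderIso_extension hle
    (m.mc_continuousOn.mono hsub)
  obtain ⟨E, hE⟩ := (m.u_strictMono.mono hsub).exists_orderIso_extension hle
    (m.u_continuousOn.mono hsub)
  -- `G` turns marginal cost into utility. Being defined on all of `ℝ`, it lets the multiplier
  -- equations be solved without domain restrictions; `hw` shows afterwards that the solution stays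
  -- in the original range.
  set G : ℝ ≃o ℝ := F.symm.trans E with hG
  have hGc : Continuous G := G.continuous
  have hGz : ∀ y, G (lam - μ * m.lr y) = m.u (z y) := fun y => by
    rw [← hfoc y, ← hF _ (hab y), ← hE _ (hab y)]
    simp [hG]
  set ν := m.v z RiskType.high with hν
  -- multiplier of the promise
  have hex : ∀ s : ℝ, ∃ l, ∑ y, m.p RiskType.high y * G (l - s * m.lr y) = ν := by
    intro s
    have hsum : ∀ x : ℝ, ∑ y, m.p RiskType.high y * x = x := fun x => by
      rw [← Finset.sum_mul, m.p_sum, one_mul]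
    refine mem_range_of_exists_le_of_exists_ge
      (f := fun l => ∑ y, m.p RiskType.high y * G (l - s * m.lr y)) (by fun_prop) ?_ ?_
    · refine ⟨G.symm ν - |s| * m.lr yR, ?_⟩
      refine (Finset.sum_le_sum fun y _ => mul_le_mul_of_nonneg_left (?_ : _ ≤ ν)
        (m.p_high_pos y).le).trans (hsum ν).le
      rw [← OrderIso.le_symm_apply]
      have h2 : -s * m.lr y ≤ |s| * m.lr y :=
        mul_le_mul_of_nonneg_right (neg_le_abs s) (m.lr_nonneg y)
      have h3 := mul_le_mul_of_nonneg_left (hyR y) (abs_nonneg s)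
      linarith
    · refine ⟨G.symm ν + |s| * m.lr yR, ?_⟩
      refine (hsum ν).ge.trans (Finset.sum_le_sum fun y _ => mul_le_mul_of_nonneg_left
        (?_ : ν ≤ _) (m.p_high_pos y).le)
      rw [← OrderIso.symm_apply_le]
      have h2 : s * m.lr y ≤ |s| * m.lr y :=
        mul_le_mul_of_nonneg_right (le_abs_self s) (m.lr_nonneg y)
      have h3 := mul_le_mul_of_nonneg_left (hyR y) (abs_nonneg s)
      linarith
  choose L hL using hex
  have hcmp : ∀ l₁ l₂ s₁ s₂ : ℝ, ∑ y, m.p RiskType.high y * G (l₁ - s₁ * m.lr y) = ν →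
      ∑ y, m.p RiskType.high y * G (l₂ - s₂ * m.lr y) = ν →
      ¬ ∀ y, l₁ - s₁ * m.lr y < l₂ - s₂ * m.lr y := by
    intro l₁ l₂ s₁ s₂ e₁ e₂ h
    have := Finset.sum_lt_sum_of_nonempty hne (fun y _ => mul_lt_mul_of_pos_left
      (G.strictMono (h y)) (m.p_high_pos y))
    rw [e₁, e₂] at this
    exact lt_irrefl _ this
  -- Two solutions with the same utility of the high type cannot be strictly ordered at all incomes.
  -- So, as `s` grows, the promise multiplier grows at a rate between the smallest and the largest
  -- likelihood ratio.
  have hbound : ∀ l₁ l₂ s₁ s₂ : ℝ, ∑ y, m.p RiskType.high y * G (l₁ - s₁ * m.lr y) = ν →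
      ∑ y, m.p RiskType.high y * G (l₂ - s₂ * m.lr y) = ν → s₁ ≤ s₂ →
      m.lr yr * (s₂ - s₁) ≤ l₂ - l₁ ∧ l₂ - l₁ ≤ m.lr yR * (s₂ - s₁) := by
    intro l₁ l₂ s₁ s₂ e₁ e₂ h
    constructor
    · by_contra hc
      refine hcmp l₂ l₁ s₂ s₁ e₂ e₁ fun y => ?_
      have := mul_le_mul_of_nonneg_right (hyr y) (sub_nonneg.2 h)
      linarith
    · by_contra hc
      refine hcmp l₁ l₂ s₁ s₂ e₁ e₂ fun y => ?_
      have := mul_le_mul_of_nonneg_right (hyR y) (sub_nonneg.2 h)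
      linarith
  have hLc : Continuous L := by
    suffices hK : ∀ s t, L s ≤ L t + m.lr yR * dist s t from
      (LipschitzWith.of_le_add_mul' _ hK).continuous
    intro s t
    rw [Real.dist_eq]
    rcases le_total t s with h | h
    · have := (hbound _ _ _ _ (hL t) (hL s) h).2
      rw [abs_of_nonneg (sub_nonneg.2 h)]
      linarith
    · have := (hbound _ _ _ _ (hL s) (hL t) h).1
      have h2 := mul_nonneg (m.lr_nonneg yr) (sub_nonneg.2 h)
      have h3 := mul_nonneg (m.lr_nonneg yR) (abs_nonneg (s - t))
      linarith
  have hνz : ∑ y, m.p RiskType.high y * G (lam - μ * m.lr y) = ν := by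
    simp only [hGz, hν, v]
  have hLμ : L μ = lam := by
    have := hbound _ _ _ _ (hL μ) hνz le_rfl
    simp only [sub_self, mul_zero] at this
    linarith [this.1, this.2]
  set D : ℝ → ℝ := fun s => ν - ∑ y, m.p RiskType.low y * G (L s - s * m.lr y) with hD
  have hDc : Continuous D := by fun_prop
  have hD0 : D 0 = 0 := by
    have := hL 0
    simp only [zero_mul, sub_zero, ← Finset.sum_mul, m.p_sum, one_mul] at this
    simp only [hD, zero_mul, sub_zero, ← Finset.sum_mul, m.p_sum, one_mul, this, sub_self]
  have hDμ : D μ = m.v z RiskType.high - m.v z RiskType.low := by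
    simp only [hD, hLμ, hGz, v, hν]
  -- The distortion is continuous in the multiplier `s`, vanishes at `s = 0` (full insurance) and is
  -- that of `z` at `s = μ`.
  obtain ⟨s, hs, hDs⟩ := intermediate_value_Icc hμ hDc.continuousOn
    (show Δ' ∈ Set.Icc (D 0) (D μ) by rw [hD0, hDμ]; exact ⟨h0, h1⟩)
  have hb := hbound _ _ _ _ (hL s) (hL μ) hs.2
  rw [hLμ] at hb
  have hw : ∀ y, F.symm (L s - s * m.lr y) ∈ Set.Icc a b := by
    intro y
    constructor
    · rw [OrderIso.le_symm_apply]
      have h2 : F a ≤ F (z yR) := F.monotone (hab yR).1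
      rw [hF _ (hab yR), hfoc] at h2
      have h3 := mul_le_mul_of_nonneg_left (hyR y) hs.1
      linarith [hb.2]
    · rw [OrderIso.symm_apply_le]
      have h2 : F (z yr) ≤ F b := F.monotone (hab yr).2
      rw [hF _ (hab yr), hfoc] at h2
      have h3 := mul_le_mul_of_nonneg_left (hyr y) hs.1
      linarith [hb.1]
  have hu : ∀ y, m.u (F.symm (L s - s * m.lr y)) = G (L s - s * m.lr y) := fun y => by
    rw [← hE _ (hw y)]; rfl
  refine ⟨fun y => ⟨_, ha.trans (hw y).1⟩, L s, s, fun y => ?_, ⟨?_, ?_⟩, hw⟩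
  · change m.mc (F.symm (L s - s * m.lr y)) = _
    rw [← hF _ (hw y), OrderIso.apply_symm_apply]
  · simp only [v_mk, hu, hL]
  · simp only [v_mk, hu]
    simp only [hD] at hDs
    linarith

/-- The difference of the multipliers depends in a Lipschitz way on the distortion. -/
theorem abs_multiplier_sub_le {a b C : ℝ} (hC0 : 0 ≤ C)
    (hC : ∀ x ∈ Set.Icc a b, ∀ y ∈ Set.Icc a b,
      (m.mc x - m.mc y) ^ 2 ≤ C * ((m.mc x - m.mc y) * (m.u x - m.u y)))
    {z₁ z₂ : m.FlowContract} {l₁ l₂ μ₁ μ₂ ν Δ₁ Δ₂ : ℝ}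
    (hz₁ : ∀ y, (z₁ y : ℝ) ∈ Set.Icc a b) (hz₂ : ∀ y, (z₂ y : ℝ) ∈ Set.Icc a b)
    (hf₁ : m.AuxFOC z₁ l₁ μ₁) (hf₂ : m.AuxFOC z₂ l₂ μ₂)
    (h₁ : m.AuxFeasible ν Δ₁ z₁) (h₂ : m.AuxFeasible ν Δ₂ z₂) :
    |(l₁ - μ₁) - (l₂ - μ₂)| ≤ C * (m.lrVar⁻¹ + 1) * |Δ₁ - Δ₂| := by
  have hV := m.lrVar_pos
  have hmc : ∀ y, m.mc (z₁ y) - m.mc (z₂ y) = (l₁ - l₂) - (μ₁ - μ₂) * m.lr y := fun y => by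
    rw [hf₁ y, hf₂ y]; ring
  -- The left side is `x ^ 2 + m.lrVar * d ^ 2` in the notation below. On the right, only the change
  -- of the low type's utility survives, since the utility of the high type is the same in both
  -- contracts.
  have h3 : ∑ y, m.p RiskType.high y * ((l₁ - l₂) - (μ₁ - μ₂) * m.lr y) ^ 2 ≤
      C * ∑ y, m.p RiskType.high y *
        (((l₁ - l₂) - (μ₁ - μ₂) * m.lr y) * (m.u (z₁ y) - m.u (z₂ y))) := by
    rw [Finset.mul_sum]
    refine Finset.sum_le_sum fun y _ => ?_
    have := hC _ (hz₁ y) _ (hz₂ y)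
    rw [hmc] at this
    have := mul_le_mul_of_nonneg_left this (m.p_high_pos y).le
    linarith
  rw [sum_high_affine_sq, sum_high_affine] at h3
  have e1 : ∑ y, m.p RiskType.high y * (m.u (z₁ y) - m.u (z₂ y)) = 0 := by
    have := h₁.1.trans h₂.1.symm
    simp only [v] at this
    simp only [mul_sub, Finset.sum_sub_distrib, this, sub_self]
  have e2 : ∑ y, m.p RiskType.low y * (m.u (z₁ y) - m.u (z₂ y)) = -(Δ₁ - Δ₂) := by
    have h4 := h₁.2
    have h5 := h₂.2
    simp only [v] at h4 h5
    simp only [mul_sub, Finset.sum_sub_distrib, h4, h5]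
    ring
  rw [e1, e2] at h3
  set d := μ₁ - μ₂
  set x := (l₁ - μ₁) - (l₂ - μ₂) with hx
  set t := Δ₁ - Δ₂
  have h6 : x ^ 2 + m.lrVar * d ^ 2 ≤ C * (d * t) := by
    have : l₁ - l₂ - d = x := by rw [hx]; ring
    rw [this] at h3
    linarith
  have hinv : m.lrVar * m.lrVar⁻¹ = 1 := mul_inv_cancel₀ hV.ne'
  have hi : 0 < m.lrVar⁻¹ := inv_pos.2 hV
  -- Young's inequality, to absorb `d` into the variance term. In `h8`, the constant `m.lrVar⁻¹ + 1`
  -- serves because its square exceeds `m.lrVar⁻¹`.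
  have h7 : C * (d * t) ≤ m.lrVar * d ^ 2 + C ^ 2 * m.lrVar⁻¹ * t ^ 2 := by
    have h8 : 0 ≤ m.lrVar * (d - C * m.lrVar⁻¹ * t) ^ 2 := mul_nonneg hV.le (sq_nonneg _)
    have h9 : m.lrVar * (d - C * m.lrVar⁻¹ * t) ^ 2 = m.lrVar * d ^ 2
        - 2 * C * (d * t) * (m.lrVar * m.lrVar⁻¹)
        + C ^ 2 * m.lrVar⁻¹ * t ^ 2 * (m.lrVar * m.lrVar⁻¹) := by ring
    rw [h9, hinv] at h8
    have h10 : 0 ≤ m.lrVar * d ^ 2 := mul_nonneg hV.le (sq_nonneg _)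
    have h11 : 0 ≤ C ^ 2 * m.lrVar⁻¹ * t ^ 2 := by positivity
    linarith
  have h8 : x ^ 2 ≤ (C * (m.lrVar⁻¹ + 1) * |t|) ^ 2 := by
    rw [mul_pow, sq_abs]
    have : 0 ≤ C ^ 2 * t ^ 2 * (m.lrVar⁻¹ ^ 2 + 1 + m.lrVar⁻¹) := by positivity
    linarith
  exact abs_le_of_sq_le_sq h8 (by positivity)

/-- Under cost supermodularity, the marginal cost of full insurance at the utility of the high type
is at most the marginal cost of uniformly higher utility. -/
theorem mc_le_of_costSupermodular (hs : m.CostSupermodular) {z : m.FlowContract} {lam μ c : ℝ}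
    (hfoc : m.AuxFOC z lam μ) (hμ : 0 ≤ μ) (hpos : ∀ y, 0 < z y) (hc : 0 ≤ c)
    (hcu : m.u c = m.v z RiskType.high) (hΔ : m.v z RiskType.low ≤ m.v z RiskType.high) :
    m.mc c ≤ lam - μ := by
  have hne : (Finset.univ : Finset m.Y).Nonempty := by
    by_contra h
    rw [Finset.not_nonempty_iff_eq_empty] at h
    have := m.p_sum RiskType.high
    rw [h] at this
    simp at this
  obtain ⟨y1, -, hy1⟩ := Finset.exists_max_image _ (fun y => (z y : ℝ)) hne
  obtain ⟨y0, -, hy0⟩ := Finset.exists_min_image _ (fun y => (z y : ℝ)) hne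
  have ha : 0 < (z y0 : ℝ) := hpos y0
  have hab : ∀ y, (z y : ℝ) ∈ Set.Icc (z y0 : ℝ) (z y1) := fun y =>
    ⟨hy0 y (Finset.mem_univ y), hy1 y (Finset.mem_univ y)⟩
  set Δ := m.v z RiskType.high - m.v z RiskType.low with hΔd
  have hΔ0 : 0 ≤ Δ := sub_nonneg.2 hΔ
  obtain ⟨C, hC0, hC⟩ := m.exists_sq_mc_sub_le (a := z y0) (b := z y1) ha.le
  -- `f` equals `lam - μ` at the distortion of `z` and `m.mc c` at distortion zero, where `c` is
  -- optimal with `μ = 0`. Supermodularity only bounds `deriv f`, which says nothing where `f` is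
  -- not differentiable; the Lipschitz bound on multipliers closes this gap.
  set f : ℝ → ℝ := fun Δ' => deriv (fun ν' => m.χ ν' Δ') (m.v z RiskType.high) with hf
  have hfw : ∀ {Δ' l s : ℝ} {w : m.FlowContract}, m.AuxFOC w l s →
      m.AuxFeasible (m.v z RiskType.high) Δ' w →
      (∀ y, (w y : ℝ) ∈ Set.Icc (z y0 : ℝ) (z y1)) → f Δ' = l - s :=
    fun h1 h2 h3 => (m.hasDerivAt_χ h2 h1 fun y => NNReal.coe_pos.1
      (ha.trans_le (h3 y).1)).deriv
  have hlip : LipschitzOnWith ⟨C * (m.lrVar⁻¹ + 1), by have := m.lrVar_pos; positivity⟩ f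
      (Set.Icc 0 Δ) := by
    refine LipschitzOnWith.of_dist_le_mul fun x hx y hy => ?_
    obtain ⟨w, l, s, h1, h2, h3⟩ := m.exists_auxFOC_path hfoc hμ ha.le hab hx.1 hx.2
    obtain ⟨w', l', s', h1', h2', h3'⟩ := m.exists_auxFOC_path hfoc hμ ha.le hab hy.1 hy.2
    rw [hfw h1 h2 h3, hfw h1' h2' h3']
    exact m.abs_multiplier_sub_le hC0 hC h3 h3' h1 h1' h2 h2'
  have hd : ∀ x ∈ Set.Icc 0 Δ, 0 ≤ deriv f x := by
    intro x hx
    obtain ⟨w, l, s, h1, h2, h3⟩ := m.exists_auxFOC_path hfoc hμ ha.le hab hx.1 hx.2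
    exact hs _ _ hx.1 (m.hasInteriorAuxSolution_of_auxFOC h2 h1 fun y => NNReal.coe_pos.1
      (ha.trans_le (h3 y).1))
  have hle := hlip.le_of_deriv_nonneg hΔ0 hd
  have hfΔ : f Δ = lam - μ := hfw hfoc ⟨rfl, by rw [hΔd]; ring⟩ hab
  have hf0 : f 0 = m.mc c := by
    have hcpos : 0 < c := by
      rw [← m.u_lt_u_iff le_rfl hc, hcu]
      have : ∑ y, m.p RiskType.high y * m.u 0 < m.v z RiskType.high :=
        Finset.sum_lt_sum_of_nonempty hne fun y _ => mul_lt_mul_of_pos_left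
          ((m.u_lt_u_iff le_rfl (z y).2).2 (hpos y)) (m.p_high_pos y)
      rwa [← Finset.sum_mul, m.p_sum, one_mul] at this
    have hv : ∀ θ, m.v (fun _ => ⟨c, hc⟩) θ = m.u c := m.v_const ⟨c, hc⟩
    have := (m.hasDerivAt_χ (ν := m.v z RiskType.high) (Δ := 0) (z := fun _ => ⟨c, hc⟩)
      (lam := m.mc c) (μ := 0) ⟨by rw [hv, hcu], by rw [hv, hcu, sub_zero]⟩
      (fun y => by rw [zero_mul, sub_zero]; rfl) (fun y => hcpos)).deriv
    simpa using this
  rwa [hfΔ, hf0] at hle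

end InsuranceModel

end

/-! ### Annuities, and utilities, costs and incentives in fully insuring mechanisms. -/

noncomputable section

namespace InsuranceModel

variable (m : InsuranceModel)

/-! ### Elementary facts about the model -/

theorem sum_riskType (f : RiskType → ℝ) : ∑ θ, f θ = f RiskType.low + f RiskType.high := by
  have : (Finset.univ : Finset RiskType) = {RiskType.low, RiskType.high} := rfl
  rw [this, Finset.sum_pair (by decide)]

theorem annuity_zero : m.annuity 0 = 0 := by simp [annuity]

theorem annuity_succ (n : ℕ) : m.annuity (n + 1) = 1 + m.δ * m.annuity n := by
  rw [annuity, Finset.sum_range_succ', annuity, Finset.mul_sum, pow_zero, add_comm]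
  simp only [pow_succ']

theorem annuity_nonneg (n : ℕ) : 0 ≤ m.annuity n :=
  Finset.sum_nonneg fun _ _ => pow_nonneg m.δ_pos.le _

theorem annuity_pos {n : ℕ} (hn : 0 < n) : 0 < m.annuity n := by
  obtain ⟨k, rfl⟩ := Nat.exists_eq_succ_of_ne_zero hn.ne'
  rw [Nat.succ_eq_add_one, annuity_succ]
  have := mul_nonneg m.δ_pos.le (m.annuity_nonneg k)
  linarith

theorem trans_high_sum :
    m.trans RiskType.high RiskType.low + m.trans RiskType.high RiskType.high = 1 := by
  rw [← m.trans_sum RiskType.high, sum_riskType]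

theorem trans_high_high_pos : 0 < m.trans RiskType.high RiskType.high :=
  (m.trans_nonneg _ _).trans_lt (m.persistent RiskType.high RiskType.low (by decide))

variable {m} in
theorem LowAbsorbing.trans_low_high (h : m.LowAbsorbing) :
    m.trans RiskType.low RiskType.high = 0 := by
  have h1 := m.trans_sum RiskType.low
  rw [sum_riskType, h] at h1
  linarith

variable {m} in
theorem LowAbsorbing.sum_trans_low (h : m.LowAbsorbing) (f : RiskType → ℝ) :
    ∑ θ, m.trans RiskType.low θ * f θ = f RiskType.low := by
  rw [sum_riskType, h, h.trans_low_high, one_mul, zero_mul, add_zero]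

theorem sum_p_const (θ : RiskType) (x : ℝ) : ∑ y, m.p θ y * x = x := by
  rw [← Finset.sum_mul, m.p_sum, one_mul]

theorem cO_nonneg : 0 ≤ m.cO :=
  Finset.sum_nonneg fun y _ => mul_nonneg (m.p_nonneg _ _) (m.Y_nonneg y y.2)

theorem VO_eq {t n : ℕ} (h : t + n = m.T) : m.VO (t + 1) = m.u m.cO * m.annuity n := by
  rw [VO, annuity]
  congr 1
  rw [← h, Finset.range_eq_Ico, ← Finset.Ico_succ_right_eq_Icc, Order.succ_eq_add_one,
    show Finset.Ico (t + 1) (t + n + 1) = Finset.Ico (0 + (t + 1)) (n + (t + 1)) by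
      congr 1 <;> omega, ← Finset.sum_Ico_add']
  simp

/-- Expected discounted consumption over the `n` remaining periods under truth-telling. -/
def continuationCost (M : m.Mechanism) : ℕ → List RiskType → RiskType → ℝ
  | 0, _, _ => 0
  | n + 1, past, θ =>
      ∑ y, m.p θ y * (M (θ :: past) y : ℝ) +
        m.δ * ∑ θ', m.trans θ θ' * continuationCost M n (θ :: past) θ'

theorem continuationProfit_eq (M : m.Mechanism) (n : ℕ) (past : List RiskType) (θ : RiskType) :
    m.continuationProfit M n past θ = m.discountedIncome n θ - m.continuationCost M n past θ := by
  induction n generalizing past θ with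
  | zero => simp [continuationProfit, discountedIncome, continuationCost]
  | succ n ih =>
    simp only [continuationProfit, discountedIncome, continuationCost, ih, ξ, meanIncome, mul_sub,
      Finset.sum_sub_distrib]
    ring

/-! ### Mechanisms with full insurance after the first low announcement -/

/-- Number of announcements before the first low one. -/
def lowDate : List RiskType → Option ℕ
  | [] => none
  | θ :: past =>
      match lowDate past with
      | some i => some i
      | none => if θ = RiskType.low then some past.length else none

theorem lowDate_lt {L : List RiskType} {i : ℕ} (h : lowDate L = some i) : i < L.length := by
  induction L with
  | nil => simp [lowDate] at h
  | cons θ L ih =>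
    rw [lowDate] at h
    rw [List.length_cons]
    cases hL : lowDate L with
    | some j =>
      rw [hL] at h
      exact (ih (hL.trans h)).trans (Nat.lt_succ_self _)
    | none =>
      rw [hL] at h
      by_cases hθ : θ = RiskType.low
      · simp only [hθ, if_true, Option.some.injEq] at h
        omega
      · simp [hθ] at h

theorem lowDate_cons_of_some {L : List RiskType} {i : ℕ} (h : lowDate L = some i) (θ : RiskType) :
    lowDate (θ :: L) = some i := by rw [lowDate, h]

theorem lowDate_low_cons {L : List RiskType} (h : lowDate L = none) :
    lowDate (RiskType.low :: L) = some L.length := by rw [lowDate, h]; rfl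

theorem lowDate_high_cons {L : List RiskType} (h : lowDate L = none) :
    lowDate (RiskType.high :: L) = none := by rw [lowDate, h]; rfl

theorem lowDate_replicate (i : ℕ) : lowDate (List.replicate i RiskType.high) = none := by
  induction i with
  | zero => rfl
  | succ i ih => exact lowDate_high_cons ih

/-- The mechanism with flow contracts `z i` after `i + 1` high announcements, and with constant
consumption `c i` for the rest of life after a first low announcement that follows `i` high ones. -/
def insuringMechanism (z : ℕ → m.FlowContract) (c : ℕ → ℝ≥0) : m.Mechanism := fun L =>
  match lowDate L with
  | some i => fun _ => c i
  | none => z (L.length - 1)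

variable {m}
variable {z : ℕ → m.FlowContract} {c : ℕ → ℝ≥0}

theorem insuringMechanism_some {L : List RiskType} {i : ℕ} (h : lowDate L = some i) :
    m.insuringMechanism z c L = fun _ => c i := by rw [insuringMechanism, h]

theorem insuringMechanism_none {L : List RiskType} (h : lowDate L = none) :
    m.insuringMechanism z c L = z (L.length - 1) := by rw [insuringMechanism, h]

theorem insuringMechanism_high_cons {L : List RiskType} (h : lowDate L = none) :
    m.insuringMechanism z c (RiskType.high :: L) = z L.length :=
  insuringMechanism_none (lowDate_high_cons h)

variable (m z c)

/-- Truth-telling utility of a high type after `i` high announcements. -/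
def highValue : ℕ → ℕ → ℝ
  | 0, _ => 0
  | n + 1, i => m.v (z i) RiskType.high +
      m.δ * (m.trans RiskType.high RiskType.low * (m.u (c (i + 1)) * m.annuity n) +
        m.trans RiskType.high RiskType.high * highValue n (i + 1))

/-- Expected discounted consumption of a high type after `i` high announcements. -/
def highCost : ℕ → ℕ → ℝ
  | 0, _ => 0
  | n + 1, i => m.auxCost (z i) +
      m.δ * (m.trans RiskType.high RiskType.low * (c (i + 1) * m.annuity n) +
        m.trans RiskType.high RiskType.high * highCost n (i + 1))

/-- The low type does not gain by pretending to be a high type for one more period. -/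
def UpwardIC : Prop := ∀ i n, i + (n + 1) = m.T →
  m.v (z i) RiskType.low + m.δ * (m.u (c (i + 1)) * m.annuity n) ≤ m.u (c i) * m.annuity (n + 1)

/-- The high type does not gain by announcing low. -/
def DownwardIC : Prop := ∀ i n, i + n = m.T → m.u (c i) * m.annuity n ≤ m.highValue z c n i

/-- Truth-telling utility with `n` remaining periods, given the period of the first low
announcement, if any, the number of past announcements and the current type. -/
def stateValue (n : ℕ) : Option ℕ → ℕ → RiskType → ℝ
  | some i, _, _ => m.u (c i) * m.annuity n
  | none, j, RiskType.low => m.u (c j) * m.annuity n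
  | none, j, RiskType.high => m.highValue z c n j

/-- Expected discounted consumption corresponding to `stateValue`. -/
def stateCost (n : ℕ) : Option ℕ → ℕ → RiskType → ℝ
  | some i, _, _ => c i * m.annuity n
  | none, j, RiskType.low => c j * m.annuity n
  | none, j, RiskType.high => m.highCost z c n j

variable {m z c}

/-- Valid after every sequence of announcements, false ones included: after a low announcement
consumption is constant, so the true type no longer matters. -/
theorem truthfulUtility_insuringMechanism (habs : m.LowAbsorbing) (n : ℕ) (past : List RiskType)
    (θ : RiskType) : m.truthfulUtility (m.insuringMechanism z c) n past θ =
      m.stateValue z c n (lowDate past) past.length θ := by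
  induction n generalizing past θ with
  | zero =>
    cases lowDate past <;> cases θ <;>
      simp [truthfulUtility, stateValue, annuity_zero, highValue]
  | succ n ih =>
    simp only [truthfulUtility, ih]
    cases hL : lowDate past with
    | some i =>
      simp only [lowDate_cons_of_some hL, insuringMechanism_some (lowDate_cons_of_some hL θ),
        v_const, stateValue, ← Finset.sum_mul, m.trans_sum, annuity_succ]
      ring
    | none =>
      cases θ with
      | low =>
        rw [habs.sum_trans_low, insuringMechanism_some (lowDate_low_cons hL),
          lowDate_low_cons hL, v_const]
        simp only [stateValue, annuity_succ]
        ring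
      | high =>
        rw [sum_riskType, insuringMechanism_high_cons hL, lowDate_high_cons hL]
        simp only [stateValue, highValue, List.length_cons]

theorem continuationCost_insuringMechanism (habs : m.LowAbsorbing) (n : ℕ)
    (past : List RiskType) (θ : RiskType) :
    m.continuationCost (m.insuringMechanism z c) n past θ =
      m.stateCost z c n (lowDate past) past.length θ := by
  induction n generalizing past θ with
  | zero =>
    cases lowDate past <;> cases θ <;>
      simp [continuationCost, stateCost, annuity_zero, highCost]
  | succ n ih =>
    simp only [continuationCost, ih]
    cases hL : lowDate past with
    | some i =>
      simp only [lowDate_cons_of_some hL, insuringMechanism_some (lowDate_cons_of_some hL θ),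
        m.p_sum, stateCost, ← Finset.sum_mul, m.trans_sum, annuity_succ]
      ring
    | none =>
      cases θ with
      | low =>
        rw [habs.sum_trans_low, insuringMechanism_some (lowDate_low_cons hL),
          lowDate_low_cons hL, sum_p_const]
        simp only [stateCost, annuity_succ]
        ring
      | high =>
        rw [sum_riskType, insuringMechanism_high_cons hL, lowDate_high_cons hL]
        simp only [stateCost, highCost, List.length_cons, auxCost]

/-- No combination of a reporting strategy with a plan of leaving beats truth-telling. -/
theorem reentryUtility_insuringMechanism_le (habs : m.LowAbsorbing) (hup : m.UpwardIC z c)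
    (hdown : m.DownwardIC z c) {r : m.ReportingStrategy} {e : m.ReentryPlan}
    (hout : ∀ η θ, e η θ = true → ∀ i < m.T, m.u m.cO ≤ m.u (c i)) (n : ℕ)
    (η : m.PrivateHistory) (θ : RiskType) (hn : η.length + n = m.T) :
    m.reentryUtility (m.insuringMechanism z c) r e n η θ ≤
      m.stateValue z c n (lowDate (m.reports η)) η.length θ := by
  -- The bound `hout` is only required where `e` asks to leave. The plan of never leaving satisfies
  -- it vacuously, so the same induction also yields incentive compatibility.
  induction n generalizing η θ with
  | zero =>
    cases lowDate (m.reports η) <;> cases θ <;>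
      simp [reentryUtility, stateValue, annuity_zero, highValue]
  | succ n ih =>
    have hlen : (m.reports η).length = η.length := List.length_map _
    rw [reentryUtility]
    split_ifs with he
    · rw [m.VO_eq hn]
      have ho := hout η θ he.2
      have hA := m.annuity_nonneg (n + 1)
      cases hL : lowDate (m.reports η) with
      | some i =>
        have := lowDate_lt hL
        exact mul_le_mul_of_nonneg_right (ho i (by omega)) hA
      | none =>
        have h1 := mul_le_mul_of_nonneg_right (ho η.length (by omega)) hA
        cases θ with
        | low => exact h1
        | high => exact h1.trans (hdown _ _ hn)
    · have hstep : ∀ y θ', m.reentryUtility (m.insuringMechanism z c) r e n ((y, r η θ, θ) :: η) θ'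
          ≤ m.stateValue z c n (lowDate (r η θ :: m.reports η)) (η.length + 1) θ' := fun y θ' =>
        ih _ _ (by simp only [List.length_cons]; omega)
      have hsum : m.v (m.insuringMechanism z c (r η θ :: m.reports η)) θ +
          m.δ * ∑ y, m.p θ y * ∑ θ', m.trans θ θ' *
            m.reentryUtility (m.insuringMechanism z c) r e n ((y, r η θ, θ) :: η) θ' ≤
          m.v (m.insuringMechanism z c (r η θ :: m.reports η)) θ +
          m.δ * ∑ θ', m.trans θ θ' *
            m.stateValue z c n (lowDate (r η θ :: m.reports η)) (η.length + 1) θ' := by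
        gcongr
        · exact m.δ_pos.le
        · rw [← m.sum_p_const θ (∑ θ', m.trans θ θ' *
            m.stateValue z c n (lowDate (r η θ :: m.reports η)) (η.length + 1) θ')]
          exact Finset.sum_le_sum fun y _ => mul_le_mul_of_nonneg_left
            (Finset.sum_le_sum fun θ' _ => mul_le_mul_of_nonneg_left (hstep y θ')
              (m.trans_nonneg _ _)) (m.p_nonneg _ _)
      refine hsum.trans ?_
      cases hL : lowDate (m.reports η) with
      | some i =>
        simp only [lowDate_cons_of_some hL, insuringMechanism_some (lowDate_cons_of_some hL _),
          v_const, stateValue, ← Finset.sum_mul, m.trans_sum, annuity_succ]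
        exact le_of_eq (by ring)
      | none =>
        -- Before any low announcement, the two false reports are covered by `hdown` and `hup`, and
        -- the two true ones give equality. By induction the continuation is valued as under
        -- truth-telling, so one-period deviations suffice.
        cases hr : r η θ with
        | low =>
          rw [insuringMechanism_some (lowDate_low_cons hL), lowDate_low_cons hL, v_const]
          simp only [stateValue, ← Finset.sum_mul, m.trans_sum, hlen]
          have h1 : m.u (c η.length) + m.δ * (1 * (m.u (c η.length) * m.annuity n)) =
            m.u (c η.length) * m.annuity (n + 1) := by rw [annuity_succ]; ring
          simp only [one_mul] at h1
          simp only [one_mul]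
          rw [h1]
          cases θ with
          | low => exact le_rfl
          | high => exact hdown _ _ hn
        | high =>
          rw [insuringMechanism_high_cons hL, lowDate_high_cons hL, hlen]
          cases θ with
          | low =>
            rw [habs.sum_trans_low]
            exact hup _ _ hn
          | high =>
            rw [sum_riskType]
            simp only [stateValue, highValue, le_refl]

theorem reentryUtility_never (M : m.Mechanism) (r : m.ReportingStrategy) (n : ℕ)
    (η : m.PrivateHistory) (θ : RiskType) :
    m.reentryUtility M r (fun _ _ => false) n η θ = m.strategyUtility M r n η θ := by
  induction n generalizing η θ with
  | zero => rfl
  | succ n ih => simp [reentryUtility, strategyUtility, ih]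

theorem exAnteUtility_truthful (M : m.Mechanism) :
    m.exAnteUtility M m.truthful = ∑ θ, m.init θ * m.V M [] θ :=
  Finset.sum_congr rfl fun θ _ => by rw [strategyUtility_truthful]; rfl

theorem incentiveCompatible_insuringMechanism (habs : m.LowAbsorbing) (hup : m.UpwardIC z c)
    (hdown : m.DownwardIC z c) : m.IncentiveCompatible (m.insuringMechanism z c) := by
  intro r
  rw [exAnteUtility_truthful]
  refine Finset.sum_le_sum fun θ _ => mul_le_mul_of_nonneg_left ?_ (m.init_pos θ).le
  rw [← reentryUtility_never, V, truthfulUtility_insuringMechanism habs]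
  exact reentryUtility_insuringMechanism_le habs hup hdown (by simp) _ _ _ (by simp)

theorem V_insuringMechanism_low (habs : m.LowAbsorbing) :
    m.V (m.insuringMechanism z c) [] RiskType.low = m.u (c 0) * m.annuity m.T :=
  truthfulUtility_insuringMechanism habs _ _ _

theorem V_insuringMechanism_high (habs : m.LowAbsorbing) :
    m.V (m.insuringMechanism z c) [] RiskType.high = m.highValue z c m.T 0 :=
  truthfulUtility_insuringMechanism habs _ _ _

theorem profit_eq (M : m.Mechanism) :
    m.profit M = ∑ θ, m.init θ * m.discountedIncome m.T θ -
      (m.init RiskType.low * m.continuationCost M m.T [] RiskType.low +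
        m.init RiskType.high * m.continuationCost M m.T [] RiskType.high) := by
  rw [← sum_riskType (fun θ => m.init θ * m.continuationCost M m.T [] θ),
    ← Finset.sum_sub_distrib]
  exact Finset.sum_congr rfl fun θ _ => by rw [profitGiven, continuationProfit_eq, mul_sub]

/-- A profit maximizing mechanism costs at most as much as an incentive compatible mechanism with
full insurance after the first low announcement that yields the same utilities. -/
theorem IsProfitMaximizing.cost_le {W : RiskType → ℝ} {M : m.Mechanism}
    (hM : m.IsProfitMaximizing W M) (habs : m.LowAbsorbing) (hup : m.UpwardIC z c)
    (hdown : m.DownwardIC z c) (hlow : m.u (c 0) * m.annuity m.T = W RiskType.low)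
    (hhigh : m.highValue z c m.T 0 = W RiskType.high) :
    m.init RiskType.low * m.continuationCost M m.T [] RiskType.low +
        m.init RiskType.high * m.continuationCost M m.T [] RiskType.high ≤
      m.init RiskType.low * (c 0 * m.annuity m.T) + m.init RiskType.high * m.highCost z c m.T 0 := by
  have h := hM.2.2 _ (incentiveCompatible_insuringMechanism habs hup hdown) (fun θ => by
    cases θ
    · rw [V_insuringMechanism_low habs, hlow]
    · rw [V_insuringMechanism_high habs, hhigh])
  rw [profit_eq, profit_eq, continuationCost_insuringMechanism habs,
    continuationCost_insuringMechanism habs] at h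
  have h1 : m.stateCost z c m.T (lowDate []) ([] : List RiskType).length RiskType.low =
    c 0 * m.annuity m.T := rfl
  have h2 : m.stateCost z c m.T (lowDate []) ([] : List RiskType).length RiskType.high =
    m.highCost z c m.T 0 := rfl
  rw [h1, h2] at h
  linarith

end InsuranceModel

end

/-! ### Pooling makes the downward constraints redundant. -/

noncomputable section

namespace InsuranceModel

variable {m : InsuranceModel} {z : ℕ → m.FlowContract} {c : ℕ → ℝ≥0}

/-! ### Removing incentives of the high type to announce low -/

theorem tangent_sum_cost_le (θ : RiskType) (w : m.FlowContract) {x : ℝ} (hx : 0 ≤ x) :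
    x + (m.v w θ - m.u x) * m.mc x ≤ ∑ y, m.p θ y * (w y : ℝ) := by
  have h : ∑ y, m.p θ y * (x + (m.u (w y) - m.u x) * m.mc x) ≤ ∑ y, m.p θ y * (w y : ℝ) :=
    Finset.sum_le_sum fun y _ => mul_le_mul_of_nonneg_left (m.tangent_cost_le hx (w y).coe_nonneg)
      (m.p_nonneg _ _)
  refine le_trans (le_of_eq ?_) h
  simp only [mul_add, Finset.sum_add_distrib, ← mul_assoc, mul_sub, Finset.sum_sub_distrib,
    ← Finset.sum_mul, m.p_sum, v]
  ring

/-- Jensen's inequality over dates, types and incomes: the discounted weights along the path of a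
high type add up to `m.annuity n`. -/
theorem tangent_highCost_le {x : ℝ} (hx : 0 ≤ x) (n i : ℕ) :
    x * m.annuity n + (m.highValue z c n i - m.u x * m.annuity n) * m.mc x ≤
      m.highCost z c n i := by
  induction n generalizing i with
  | zero => simp [highValue, highCost, annuity_zero]
  | succ n ih =>
    have h1 := tangent_sum_cost_le RiskType.high (z i) hx
    have h2 := m.tangent_cost_le hx (c (i + 1)).coe_nonneg
    have hA := m.annuity_nonneg n
    have hq := m.trans_high_sum
    have h3 := mul_le_mul_of_nonneg_left (mul_le_mul_of_nonneg_right h2 hA)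
      (m.trans_nonneg RiskType.high RiskType.low)
    have h4 := mul_le_mul_of_nonneg_left (ih (i + 1)) m.trans_high_high_pos.le
    have h5 := mul_le_mul_of_nonneg_left (add_le_add h3 h4) m.δ_pos.le
    rw [highValue, highCost, annuity_succ, auxCost]
    refine le_trans (le_of_eq ?_) (add_le_add h1 h5)
    have hq' : m.trans RiskType.high RiskType.low = 1 - m.trans RiskType.high RiskType.high := by
      linarith
    rw [hq']
    change _ = _ + m.δ * ((1 - m.trans RiskType.high RiskType.high) *
      ((x + (m.u (c (i + 1)) - m.u x) * m.mc x) * m.annuity n) + _)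
    ring

theorem u_zero_le_v (w : m.FlowContract) (θ : RiskType) : m.u 0 ≤ m.v w θ := by
  rw [← m.sum_p_const θ (m.u 0)]
  exact Finset.sum_le_sum fun y _ => mul_le_mul_of_nonneg_left (m.u_zero_le (w y).coe_nonneg)
    (m.p_nonneg _ _)

theorem u_zero_mul_le_highValue (n i : ℕ) : m.u 0 * m.annuity n ≤ m.highValue z c n i := by
  induction n generalizing i with
  | zero => simp [highValue, annuity_zero]
  | succ n ih =>
    have h1 := u_zero_le_v (z i) RiskType.high
    have h2 := mul_le_mul_of_nonneg_right (m.u_zero_le (c (i + 1)).coe_nonneg) (m.annuity_nonneg n)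
    have h3 := mul_le_mul_of_nonneg_left h2 (m.trans_nonneg RiskType.high RiskType.low)
    have h4 := mul_le_mul_of_nonneg_left (ih (i + 1)) m.trans_high_high_pos.le
    have h5 := mul_le_mul_of_nonneg_left (add_le_add h3 h4) m.δ_pos.le
    rw [← add_mul, m.trans_high_sum, one_mul] at h5
    rw [highValue, annuity_succ]
    refine le_trans (le_of_eq ?_) (add_le_add h1 h5)
    ring

theorem highValue_const (x : ℝ≥0) (i : ℕ) (hz : ∀ j, i ≤ j → z j = fun _ => x)
    (hc : ∀ j, i ≤ j → c j = x) (n j : ℕ) (hj : i ≤ j) :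
    m.highValue z c n j = m.u x * m.annuity n := by
  induction n generalizing j with
  | zero => simp [highValue, annuity_zero]
  | succ n ih =>
    rw [highValue, ih _ (by omega), hz j hj, hc (j + 1) (by omega), v_const, ← add_mul,
      m.trans_high_sum, annuity_succ]
    ring

theorem highCost_const (x : ℝ≥0) (i : ℕ) (hz : ∀ j, i ≤ j → z j = fun _ => x)
    (hc : ∀ j, i ≤ j → c j = x) (n j : ℕ) (hj : i ≤ j) :
    m.highCost z c n j = x * m.annuity n := by
  induction n generalizing j with
  | zero => simp [highCost, annuity_zero]
  | succ n ih =>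
    rw [highCost, ih _ (by omega), hz j hj, hc (j + 1) (by omega), ← add_mul,
      m.trans_high_sum, annuity_succ, auxCost, sum_p_const]
    ring

/-- If the high type would gain by announcing low, full insurance from the first such date on
saves costs. -/
theorem UpwardIC.exists_downwardIC_lt (hup : m.UpwardIC z c)
    (hq : 0 < m.trans RiskType.high RiskType.low)
    (h0 : m.u (c 0) * m.annuity m.T ≤ m.highValue z c m.T 0) (hnot : ¬ m.DownwardIC z c) :
    ∃ z' c', m.UpwardIC z' c' ∧ m.DownwardIC z' c' ∧ c' 0 = c 0 ∧
      m.highValue z' c' m.T 0 = m.highValue z c m.T 0 ∧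
      m.highCost z' c' m.T 0 < m.highCost z c m.T 0 := by
  classical
  have hex : ∃ i, i ≤ m.T ∧ m.highValue z c (m.T - i) i < m.u (c i) * m.annuity (m.T - i) := by
    simp only [DownwardIC, not_forall, not_le] at hnot
    obtain ⟨i, n, h, hlt⟩ := hnot
    exact ⟨i, by omega, by rwa [← h, Nat.add_sub_cancel_left]⟩
  set i := Nat.find hex with hi
  obtain ⟨hiT, hviol⟩ := Nat.find_spec hex
  rw [← hi] at hiT hviol
  have hmin : ∀ j k, j < i → j + k = m.T → m.u (c j) * m.annuity k ≤ m.highValue z c k j := by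
    intro j k hj hjk
    have := Nat.find_min hex hj
    simp only [not_and, not_lt] at this
    have h2 := this (by omega)
    rwa [← hjk, Nat.add_sub_cancel_left] at h2
  obtain ⟨n, hn⟩ := Nat.exists_eq_add_of_le hiT
  rw [hn, Nat.add_sub_cancel_left] at hviol
  -- Pooling mixes the two types as they evolve from a high type one period earlier, so the first
  -- violation must not be at the initial date; `h0` excludes that.
  have hi0 : 0 < i := by
    rcases Nat.eq_zero_or_pos i with h | h
    · rw [h, zero_add] at hn
      rw [h, ← hn] at hviol
      exact absurd h0 (not_le.2 hviol)
    · exact h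
  have hn0 : 0 < n := by
    rcases Nat.eq_zero_or_pos n with h | h
    · rw [h, annuity_zero, mul_zero] at hviol
      exact absurd hviol (lt_irrefl _)
    · exact h
  have hA := m.annuity_pos hn0
  set qh := m.trans RiskType.high RiskType.high with hqh
  set ql := m.trans RiskType.high RiskType.low with hql
  have hqq : ql + qh = 1 := m.trans_high_sum
  have hqh0 : 0 < qh := m.trans_high_high_pos
  -- `W` is what a high type of the previous period expects from date `i` on. Pooling at its
  -- certainty equivalent `x` leaves all earlier values of the high type unchanged.
  set W := ql * (m.u (c i) * m.annuity n) + qh * m.highValue z c n i with hW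
  have hW1 : W < m.u (c i) * m.annuity n := by
    have h1 := mul_lt_mul_of_pos_left hviol hqh0
    have h2 : ql * (m.u (c i) * m.annuity n) + qh * (m.u (c i) * m.annuity n) =
      m.u (c i) * m.annuity n := by rw [← add_mul, hqq, one_mul]
    linarith
  have hW0 : m.u 0 * m.annuity n ≤ W := by
    have h1 := mul_le_mul_of_nonneg_left (u_zero_mul_le_highValue (z := z) (c := c) n i) hqh0.le
    have h2 := mul_le_mul_of_nonneg_left (mul_le_mul_of_nonneg_right (m.u_zero_le (c i).coe_nonneg) hA.le)
      hq.le
    have h3 : ql * (m.u 0 * m.annuity n) + qh * (m.u 0 * m.annuity n) =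
      m.u 0 * m.annuity n := by rw [← add_mul, hqq, one_mul]
    linarith
  obtain ⟨x, hx0, hxc, hxu⟩ := m.exists_consumption (c i).coe_nonneg
    ((le_div_iff₀ hA).2 hW0) ((div_le_iff₀ hA).2 hW1.le)
  have hxW : m.u x * m.annuity n = W := by rw [hxu, div_mul_cancel₀ _ hA.ne']
  -- The source of the strict saving: the low branch has probability `ql > 0` and its level differs
  -- from `x`, so the tangent inequality at `x` is strict there.
  have hne : (c i : ℝ) ≠ x := by
    intro h
    rw [← h] at hxW
    exact hW1.ne' hxW
  set x' : ℝ≥0 := ⟨x, hx0⟩ with hx'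
  have hxx : (x' : ℝ) = x := rfl
  set z' : ℕ → m.FlowContract := fun j => if j < i then z j else fun _ => x' with hz'
  set c' : ℕ → ℝ≥0 := fun j => if j < i then c j else x' with hc'
  have hz1 : ∀ j, j < i → z' j = z j := fun j h => by simp [hz', h]
  have hc1 : ∀ j, j < i → c' j = c j := fun j h => by simp [hc', h]
  have hz2 : ∀ j, i ≤ j → z' j = fun _ => x' := fun j h => by simp [hz', not_lt.2 h]
  have hc2 : ∀ j, i ≤ j → c' j = x' := fun j h => by simp [hc', not_lt.2 h]
  have hval : ∀ k j, j < i → j + k = m.T → m.highValue z' c' k j = m.highValue z c k j := by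
    intro k
    induction k with
    | zero => intro j hj hjk; omega
    | succ k ih =>
      intro j hj hjk
      rw [highValue, highValue, hz1 j hj]
      rcases lt_or_eq_of_le (Nat.succ_le_of_lt hj) with h | h
      · rw [hc1 (j + 1) h, ih (j + 1) h (by omega)]
      · have hji : j + 1 = i := h
        have hkn : k = n := by omega
        rw [highValue_const x' i hz2 hc2 k (j + 1) hji.ge, hc2 (j + 1) hji.ge, hji, hkn,
          ← add_mul, m.trans_high_sum, one_mul, hxx, hxW]
  have hcost : ∀ k j, j < i → j + k = m.T → m.highCost z' c' k j < m.highCost z c k j := by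
    intro k
    induction k with
    | zero => intro j hj hjk; omega
    | succ k ih =>
      intro j hj hjk
      rw [highCost, highCost, hz1 j hj]
      rcases lt_or_eq_of_le (Nat.succ_le_of_lt hj) with h | h
      · rw [hc1 (j + 1) h]
        have h1 := mul_lt_mul_of_pos_left (mul_lt_mul_of_pos_left (ih (j + 1) h (by omega))
          hqh0) m.δ_pos
        simp only [mul_add]
        linarith
      · have hji : j + 1 = i := h
        have hkn : k = n := by omega
        rw [highCost_const x' i hz2 hc2 k (j + 1) hji.ge, hc2 (j + 1) hji.ge, hji, hkn,
          ← add_mul, m.trans_high_sum, one_mul, hxx]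
        have t1 := mul_lt_mul_of_pos_left (mul_lt_mul_of_pos_right
          (m.tangent_cost_lt hx0 (c i).coe_nonneg hne) hA) hq
        have t2 := mul_le_mul_of_nonneg_left
          (tangent_highCost_le (z := z) (c := c) hx0 n i) hqh0.le
        have t3 : x * m.annuity n < ql * (c i * m.annuity n) + qh * m.highCost z c n i := by
          refine lt_of_le_of_lt (le_of_eq ?_) (add_lt_add_of_lt_of_le t1 t2)
          have e1 : ql = 1 - qh := by linarith
          have e2 : m.u x * m.annuity n * m.mc x = (ql * (m.u (c i) * m.annuity n) +
            qh * m.highValue z c n i) * m.mc x := by rw [hxW]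
          rw [e1] at e2 ⊢
          change _ = (1 - qh) * ((x + (m.u (c i) - m.u x) * m.mc x) * m.annuity n) + _
          linear_combination e2
        have := mul_lt_mul_of_pos_left t3 m.δ_pos
        linarith
  refine ⟨z', c', ?_, ?_, hc1 0 hi0, hval _ _ hi0 (zero_add _), hcost _ _ hi0 (zero_add _)⟩
  · intro j k hjk
    rcases lt_or_ge j i with hj | hj
    · rw [hz1 j hj, hc1 j hj]
      rcases lt_or_eq_of_le (Nat.succ_le_of_lt hj) with h | h
      · rw [hc1 (j + 1) h]
        exact hup j k hjk
      · have hji : j + 1 = i := h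
        have hkn : k = n := by omega
        rw [hc2 (j + 1) hji.ge, hxx, hkn, hxW]
        -- One period before pooling, a pretending low type now continues with `W`, which is less
        -- than `m.u (c i) * m.annuity n`.
        have h1 := hup j k hjk
        rw [hkn, hji] at h1
        have h2 := mul_lt_mul_of_pos_left hW1 m.δ_pos
        linarith
    · rw [hz2 j hj, hc2 j hj, hc2 (j + 1) (by omega), v_const, annuity_succ]
      exact le_of_eq (by ring)
  · intro j k hjk
    rcases lt_or_ge j i with hj | hj
    · rw [hc1 j hj, hval k j hj hjk]
      exact hmin j k hj hjk
    · rw [hc2 j hj, highValue_const x' i hz2 hc2 k j hj]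

end InsuranceModel

end

/-! ### Perturbations in utility units and the Kuhn-Tucker conditions. -/

noncomputable section

namespace InsuranceModel

variable {m : InsuranceModel} {z : ℕ → m.FlowContract} {c : ℕ → ℝ≥0}

/-! ### First order conditions of the cost minimization problem -/

theorem highValue_eq_sum (n i : ℕ) : m.highValue z c n i =
    ∑ j ∈ Finset.range n, (m.δ * m.trans RiskType.high RiskType.high) ^ j *
      (m.v (z (i + j)) RiskType.high + m.δ * m.trans RiskType.high RiskType.low *
        (m.u (c (i + j + 1)) * m.annuity (n - 1 - j))) := by
  induction n generalizing i with
  | zero => rfl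
  | succ n ih =>
    rw [highValue, ih, Finset.sum_range_succ', mul_add, ← mul_assoc m.δ _ (Finset.sum _ _),
      Finset.mul_sum]
    have h : ∀ j ∈ Finset.range n, m.δ * m.trans RiskType.high RiskType.high *
        ((m.δ * m.trans RiskType.high RiskType.high) ^ j *
          (m.v (z (i + 1 + j)) RiskType.high + m.δ * m.trans RiskType.high RiskType.low *
            (m.u (c (i + 1 + j + 1)) * m.annuity (n - 1 - j)))) =
        (m.δ * m.trans RiskType.high RiskType.high) ^ (j + 1) *
          (m.v (z (i + (j + 1))) RiskType.high + m.δ * m.trans RiskType.high RiskType.low *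
            (m.u (c (i + (j + 1) + 1)) * m.annuity (n + 1 - 1 - (j + 1)))) := fun j _ => by
      rw [show i + 1 + j = i + (j + 1) by omega, show n - 1 - j = n + 1 - 1 - (j + 1) by omega]
      ring
    rw [Finset.sum_congr rfl h]
    simp only [pow_zero, add_zero, Nat.add_sub_cancel, Nat.sub_zero]
    ring

theorem highCost_eq_sum (n i : ℕ) : m.highCost z c n i =
    ∑ j ∈ Finset.range n, (m.δ * m.trans RiskType.high RiskType.high) ^ j *
      (m.auxCost (z (i + j)) + m.δ * m.trans RiskType.high RiskType.low *
        (c (i + j + 1) * m.annuity (n - 1 - j))) := by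
  induction n generalizing i with
  | zero => rfl
  | succ n ih =>
    rw [highCost, ih, Finset.sum_range_succ', mul_add, ← mul_assoc m.δ _ (Finset.sum _ _),
      Finset.mul_sum]
    have h : ∀ j ∈ Finset.range n, m.δ * m.trans RiskType.high RiskType.high *
        ((m.δ * m.trans RiskType.high RiskType.high) ^ j *
          (m.auxCost (z (i + 1 + j)) + m.δ * m.trans RiskType.high RiskType.low *
            (c (i + 1 + j + 1) * m.annuity (n - 1 - j)))) =
        (m.δ * m.trans RiskType.high RiskType.high) ^ (j + 1) *
          (m.auxCost (z (i + (j + 1))) + m.δ * m.trans RiskType.high RiskType.low *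
            (c (i + (j + 1) + 1) * m.annuity (n + 1 - 1 - (j + 1)))) := fun j _ => by
      rw [show i + 1 + j = i + (j + 1) by omega, show n - 1 - j = n + 1 - 1 - (j + 1) by omega]
      ring
    rw [Finset.sum_congr rfl h]
    simp only [pow_zero, add_zero, Nat.add_sub_cancel, Nat.sub_zero]
    ring

variable (m z c) in
/-- Cost minimality given the initial utilities, when only the low type has to be deterred from
misreporting. -/
def CostMinimal : Prop :=
  m.UpwardIC z c ∧ ∀ z' c', m.UpwardIC z' c' → c' 0 = c 0 →
    m.highValue z' c' m.T 0 = m.highValue z c m.T 0 →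
    m.highCost z c m.T 0 ≤ m.highCost z' c' m.T 0

theorem _root_.HasDerivAt.nonneg_of_eventually_ge {f : ℝ → ℝ} {D : ℝ} (hf : HasDerivAt f D 0)
    (h : ∀ᶠ t in nhdsWithin 0 (Set.Ioi 0), f 0 ≤ f t) : 0 ≤ D := by
  have ht := hf.tendsto_slope_zero_right
  refine ge_of_tendsto ht ?_
  filter_upwards [h, self_mem_nhdsWithin] with t h1 h2
  rw [zero_add, smul_eq_mul]
  exact mul_nonneg (inv_nonneg.2 (le_of_lt h2)) (sub_nonneg.2 h1)

/-- No feasible direction, measured in utility, lowers the cost. -/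
theorem CostMinimal.derivative_nonneg (hopt : m.CostMinimal z c)
    (hz : ∀ i < m.T, ∀ y, 0 < z i y) (hc : ∀ i, 0 < i → i < m.T → 0 < c i)
    (d : ℕ → m.Y → ℝ) (e : ℕ → ℝ) (he : e 0 = 0)
    (hIC : ∀ i n, i + (n + 1) = m.T →
      (∑ y, m.p RiskType.low y * d i y + m.δ * (e (i + 1) * m.annuity n) ≤
        e i * m.annuity (n + 1)) ∨
      m.v (z i) RiskType.low + m.δ * (m.u (c (i + 1)) * m.annuity n) <
        m.u (c i) * m.annuity (n + 1))
    (hprom : ∑ j ∈ Finset.range m.T, (m.δ * m.trans RiskType.high RiskType.high) ^ j *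
      (∑ y, m.p RiskType.high y * d j y + m.δ * m.trans RiskType.high RiskType.low *
        (e (j + 1) * m.annuity (m.T - 1 - j))) = 0) :
    0 ≤ ∑ j ∈ Finset.range m.T, (m.δ * m.trans RiskType.high RiskType.high) ^ j *
      (∑ y, m.p RiskType.high y * (m.mc (z j y) * d j y) +
        m.δ * m.trans RiskType.high RiskType.low *
          ((m.mc (c (j + 1)) * e (j + 1)) * m.annuity (m.T - 1 - j))) := by
  have hpz : ∀ i y, ∃ γ : ℝ → ℝ, γ 0 = z i y ∧ (i < m.T → HasDerivAt γ (m.mc (z i y) * d i y) 0 ∧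
      ∀ᶠ t in nhds (0 : ℝ), 0 ≤ γ t ∧ m.u (γ t) = m.u (z i y) + t * d i y) := by
    intro i y
    by_cases h : i < m.T
    · obtain ⟨γ, h1, h2, h3⟩ := m.exists_utility_path (NNReal.coe_pos.2 (hz i h y)) (d i y)
      exact ⟨γ, h1, fun _ => ⟨h2, h3⟩⟩
    · exact ⟨fun _ => z i y, rfl, fun h' => absurd h' h⟩
  have hpc : ∀ i, ∃ γ : ℝ → ℝ, γ 0 = c i ∧ (i = 0 → ∀ t, γ t = c i) ∧
      (i < m.T → HasDerivAt γ (m.mc (c i) * e i) 0 ∧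
      ∀ᶠ t in nhds (0 : ℝ), 0 ≤ γ t ∧ m.u (γ t) = m.u (c i) + t * e i) := by
    intro i
    -- The level `c 0` is fixed by the promise and not assumed positive, so its path is constant.
    rcases Nat.eq_zero_or_pos i with rfl | h0
    · refine ⟨fun _ => c 0, rfl, fun _ _ => rfl, fun _ => ⟨?_, ?_⟩⟩
      · rw [he, mul_zero]; exact hasDerivAt_const _ _
      · exact Filter.Eventually.of_forall fun t => ⟨(c 0).coe_nonneg, by rw [he]; ring⟩
    · by_cases h : i < m.T
      · obtain ⟨γ, h1, h2, h3⟩ := m.exists_utility_path (NNReal.coe_pos.2 (hc i h0 h)) (e i)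
        exact ⟨γ, h1, fun h => absurd h h0.ne', fun _ => ⟨h2, h3⟩⟩
      · exact ⟨fun _ => c i, rfl, fun _ _ => rfl, fun h' => absurd h' h⟩
  choose γ hγ0 hγ using hpz
  choose κ hκ0 hκc hκ using hpc
  set f : ℝ → ℝ := fun t => ∑ j ∈ Finset.range m.T,
    (m.δ * m.trans RiskType.high RiskType.high) ^ j * (∑ y, m.p RiskType.high y * γ j y t +
      m.δ * m.trans RiskType.high RiskType.low * (κ (j + 1) t * m.annuity (m.T - 1 - j))) with hf
  have hfd : HasDerivAt f (∑ j ∈ Finset.range m.T,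
      (m.δ * m.trans RiskType.high RiskType.high) ^ j *
      (∑ y, m.p RiskType.high y * (m.mc (z j y) * d j y) +
        m.δ * m.trans RiskType.high RiskType.low *
          ((m.mc (c (j + 1)) * e (j + 1)) * m.annuity (m.T - 1 - j)))) 0 := by
    refine HasDerivAt.fun_sum fun j hj => ?_
    rw [Finset.mem_range] at hj
    refine HasDerivAt.const_mul _ (HasDerivAt.add
      (HasDerivAt.fun_sum fun y _ => ((hγ j y hj).1).const_mul _) (HasDerivAt.const_mul _ ?_))
    by_cases h : j + 1 < m.T
    · exact ((hκ (j + 1) h).1).mul_const _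
    · have h0 : m.T - 1 - j = 0 := by omega
      simp only [h0, annuity_zero, mul_zero]
      exact hasDerivAt_const _ _
  refine hfd.nonneg_of_eventually_ge ?_
  have ev1 : ∀ᶠ t in nhds (0 : ℝ), ∀ i ∈ Finset.range m.T, ∀ y,
      0 ≤ γ i y t ∧ m.u (γ i y t) = m.u (z i y) + t * d i y := by
    rw [Filter.eventually_all_finset]
    exact fun i hi => Filter.eventually_all.2 fun y => (hγ i y (Finset.mem_range.1 hi)).2
  have ev2 : ∀ᶠ t in nhds (0 : ℝ), ∀ i ∈ Finset.range m.T,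
      0 ≤ κ i t ∧ m.u (κ i t) = m.u (c i) + t * e i := by
    rw [Filter.eventually_all_finset]
    exact fun i hi => (hκ i (Finset.mem_range.1 hi)).2
  -- The constraints are affine in utilities, which move linearly in `t`. A constraint not tightened
  -- by the direction therefore holds for all `t > 0`, and a slack one for small `t`.
  have ev3 : ∀ᶠ t in nhdsWithin (0 : ℝ) (Set.Ioi 0), ∀ i ∈ Finset.range m.T,
      m.v (z i) RiskType.low + t * ∑ y, m.p RiskType.low y * d i y +
        m.δ * ((m.u (c (i + 1)) + t * e (i + 1)) * m.annuity (m.T - 1 - i)) ≤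
      (m.u (c i) + t * e i) * m.annuity (m.T - i) := by
    rw [Filter.eventually_all_finset]
    intro i hi
    have hi' := Finset.mem_range.1 hi
    have hT : i + ((m.T - 1 - i) + 1) = m.T := by omega
    rcases hIC i _ hT with h | h
    · filter_upwards [self_mem_nhdsWithin] with t ht
      have h1 := hopt.1 i _ hT
      have h2 := mul_le_mul_of_nonneg_left h (le_of_lt ht)
      rw [show m.T - i = m.T - 1 - i + 1 by omega]
      linarith
    · refine Filter.Eventually.mono (mem_nhdsWithin_of_mem_nhds ?_) fun t => le_of_lt
      refine ContinuousAt.eventually_lt (by fun_prop) (by fun_prop) ?_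
      rw [show m.T - i = m.T - 1 - i + 1 by omega]
      simpa using h
  filter_upwards [mem_nhdsWithin_of_mem_nhds ev1, mem_nhdsWithin_of_mem_nhds ev2, ev3]
    with t h1 h2 h3
  set z' : ℕ → m.FlowContract := fun i y => Real.toNNReal (γ i y t) with hz'
  set c' : ℕ → ℝ≥0 := fun i => Real.toNNReal (κ i t) with hc'
  have ez : ∀ i < m.T, ∀ y, (z' i y : ℝ) = γ i y t := fun i hi y =>
    Real.coe_toNNReal _ (h1 i (Finset.mem_range.2 hi) y).1
  have ec : ∀ i < m.T, (c' i : ℝ) = κ i t := fun i hi =>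
    Real.coe_toNNReal _ (h2 i (Finset.mem_range.2 hi)).1
  have eu : ∀ i < m.T, m.u (c' i) = m.u (c i) + t * e i := fun i hi => by
    rw [ec i hi, (h2 i (Finset.mem_range.2 hi)).2]
  have ev : ∀ i < m.T, ∀ θ, m.v (z' i) θ = m.v (z i) θ + t * ∑ y, m.p θ y * d i y := by
    intro i hi θ
    rw [v, v, Finset.mul_sum, ← Finset.sum_add_distrib]
    refine Finset.sum_congr rfl fun y _ => ?_
    rw [ez i hi, (h1 i (Finset.mem_range.2 hi) y).2]
    ring
  -- The level `c m.T` lies beyond the horizon and always appears with the factor `m.annuity 0 = 0`.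
  have eA : ∀ j < m.T, ∀ x x' : ℝ, (j + 1 < m.T → x = x') →
      x * m.annuity (m.T - 1 - j) = x' * m.annuity (m.T - 1 - j) := by
    intro j hj x x' h
    by_cases hj' : j + 1 < m.T
    · rw [h hj']
    · rw [show m.T - 1 - j = 0 by omega, annuity_zero, mul_zero, mul_zero]
  have hup : m.UpwardIC z' c' := by
    intro i n hin
    have hi : i < m.T := by omega
    have h := h3 i (Finset.mem_range.2 hi)
    have hn : n = m.T - 1 - i := by omega
    rw [ev i hi, eu i hi, hn, eA i hi _ _ (eu (i + 1)), show m.T - 1 - i + 1 = m.T - i by omega]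
    exact h
  have h0 : c' 0 = c 0 := by
    rw [hc']
    simp only [hκc 0 rfl t, Real.toNNReal_coe]
  have hH : m.highValue z' c' m.T 0 = m.highValue z c m.T 0 := by
    rw [highValue_eq_sum, highValue_eq_sum, ← sub_eq_zero, ← Finset.sum_sub_distrib]
    have : t * ∑ j ∈ Finset.range m.T, (m.δ * m.trans RiskType.high RiskType.high) ^ j *
      (∑ y, m.p RiskType.high y * d j y + m.δ * m.trans RiskType.high RiskType.low *
        (e (j + 1) * m.annuity (m.T - 1 - j))) = 0 := by rw [hprom, mul_zero]
    rw [← this, Finset.mul_sum]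
    refine Finset.sum_congr rfl fun j hj => ?_
    rw [Finset.mem_range] at hj
    simp only [zero_add]
    rw [ev j hj, eA j hj _ _ (eu (j + 1))]
    ring
  have hle := hopt.2 z' c' hup h0 hH
  have e0 : f 0 = m.highCost z c m.T 0 := by
    rw [highCost_eq_sum]
    simp only [hf, hγ0, hκ0, zero_add, auxCost]
  have et : f t = m.highCost z' c' m.T 0 := by
    rw [highCost_eq_sum]
    refine Finset.sum_congr rfl fun j hj => ?_
    rw [Finset.mem_range] at hj
    simp only [zero_add, auxCost]
    rw [eA j hj _ _ (ec (j + 1))]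
    simp only [ez j hj]
  rw [e0, et]
  exact hle

theorem sum_low_lr : ∑ y, m.p RiskType.low y * m.lr y = 1 + m.lrVar := by
  have h1 := m.sum_high_affine_sq 0 1
  have h2 : ∀ y, m.p RiskType.high y * (0 - 1 * m.lr y) ^ 2 = m.p RiskType.low y * m.lr y :=
    fun y => by rw [← m.p_high_mul_lr]; ring
  simp only [h2] at h1
  linarith

theorem sum_high_lr : ∑ y, m.p RiskType.high y * m.lr y = 1 := by
  simp only [m.p_high_mul_lr, m.p_sum]

/-- Any pair of changes of the flow utilities of the two types is achieved by some direction. -/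
theorem exists_flow_direction (s τ : ℝ) : ∃ d : m.Y → ℝ,
    ∑ y, m.p RiskType.high y * d y = s ∧ ∑ y, m.p RiskType.low y * d y = τ := by
  have hV := m.lrVar_pos.ne'
  refine ⟨fun y => (s - (τ - s) / m.lrVar) + (τ - s) / m.lrVar * m.lr y, ?_, ?_⟩
  · simp only [mul_add, Finset.sum_add_distrib, sum_p_const]
    simp only [mul_left_comm _ ((τ - s) / m.lrVar), ← Finset.mul_sum, sum_high_lr]
    ring
  · simp only [mul_add, Finset.sum_add_distrib, sum_p_const]
    simp only [mul_left_comm _ ((τ - s) / m.lrVar), ← Finset.mul_sum, sum_low_lr]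
    field_simp
    ring

/-- The flow contracts of a cost minimum solve auxiliary problems. -/
theorem CostMinimal.exists_auxFOC (hopt : m.CostMinimal z c)
    (hz : ∀ i < m.T, ∀ y, 0 < z i y) (hc : ∀ i, 0 < i → i < m.T → 0 < c i) {i : ℕ}
    (hi : i < m.T) : ∃ lam μ, m.AuxFOC (z i) lam μ := by
  have hV := m.lrVar_pos.ne'
  set a : m.Y → ℝ := fun y => m.mc (z i y) with ha
  set μ := (∑ y, m.p RiskType.high y * a y - ∑ y, m.p RiskType.low y * a y) / m.lrVar with hμ
  set lam := ∑ y, m.p RiskType.high y * a y + μ with hlam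
  -- `ρ` is the residual of projecting marginal cost on `1` and the likelihood ratio. Moving
  -- utilities along `-ρ` changes neither type's expected utility and lowers cost at the rate `E_h[ρ
  -- ^ 2]`, which must vanish.
  set ρ : m.Y → ℝ := fun y => a y - (lam - μ * m.lr y) with hρ
  have h1 : ∑ y, m.p RiskType.high y * ρ y = 0 := by
    simp only [hρ, mul_sub, Finset.sum_sub_distrib, sum_p_const]
    simp only [mul_left_comm _ μ, ← Finset.mul_sum, sum_high_lr]
    rw [hlam]; ring
  have h2 : ∑ y, m.p RiskType.low y * ρ y = 0 := by
    simp only [hρ, mul_sub, Finset.sum_sub_distrib, sum_p_const]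
    simp only [mul_left_comm _ μ, ← Finset.mul_sum, sum_low_lr]
    have : μ * m.lrVar = ∑ y, m.p RiskType.high y * a y - ∑ y, m.p RiskType.low y * a y :=
      div_mul_cancel₀ _ hV
    rw [hlam]; linarith
  have h3 : ∑ y, m.p RiskType.high y * (a y * ρ y) = ∑ y, m.p RiskType.high y * ρ y ^ 2 := by
    have h4 := m.sum_high_affine lam μ ρ
    rw [h1, h2, mul_zero, mul_zero, sub_zero] at h4
    rw [← sub_eq_zero, ← h4, ← Finset.sum_sub_distrib]
    exact Finset.sum_congr rfl fun y _ => by simp only [hρ]; ring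
  have hD := hopt.derivative_nonneg hz hc (fun j y => if j = i then -ρ y else 0) (fun _ => 0) rfl
    (fun j n _ => Or.inl (by
      by_cases h : j = i
      · simp only [h, if_true, mul_neg, Finset.sum_neg_distrib, h2, neg_zero, zero_mul, mul_zero,
          add_zero, le_refl]
      · simp [h]))
    (Finset.sum_eq_zero fun j _ => by
      by_cases h : j = i
      · simp only [h, if_true, mul_neg, Finset.sum_neg_distrib, h1, neg_zero, zero_mul, mul_zero,
          add_zero]
      · simp [h])
  rw [Finset.sum_eq_single i (fun j _ hj => by simp [hj])
    (fun h => absurd (Finset.mem_range.2 hi) h)] at hD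
  simp only [if_true, mul_neg, Finset.sum_neg_distrib, mul_zero, zero_mul, add_zero] at hD
  have h4 : ∑ y, m.p RiskType.high y * (m.mc (z i y) * ρ y) = ∑ y, m.p RiskType.high y * ρ y ^ 2 := h3
  rw [h4] at hD
  have hpos : 0 < (m.δ * m.trans RiskType.high RiskType.high) ^ i :=
    pow_pos (mul_pos m.δ_pos m.trans_high_high_pos) i
  have hnn : ∀ y ∈ Finset.univ, 0 ≤ m.p RiskType.high y * ρ y ^ 2 := fun y _ =>
    mul_nonneg (m.p_high_pos y).le (sq_nonneg _)
  have hz0 : ∑ y, m.p RiskType.high y * ρ y ^ 2 = 0 := by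
    refine le_antisymm ?_ (Finset.sum_nonneg hnn)
    by_contra hcon
    have := mul_pos hpos (not_le.1 hcon)
    linarith
  refine ⟨lam, μ, fun y => ?_⟩
  have h5 := (Finset.sum_eq_zero_iff_of_nonneg hnn).1 hz0 y (Finset.mem_univ y)
  rw [mul_eq_zero, or_iff_right (m.p_high_pos y).ne', sq_eq_zero_iff] at h5
  exact sub_eq_zero.1 h5

/-- The first order condition in terms of changes `s` and `τ` of the flow utilities of the high and
the low type. -/
theorem CostMinimal.derivative_nonneg' (hopt : m.CostMinimal z c)
    (hz : ∀ i < m.T, ∀ y, 0 < z i y) (hc : ∀ i, 0 < i → i < m.T → 0 < c i)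
    {lam μ : ℕ → ℝ} (hfoc : ∀ i < m.T, m.AuxFOC (z i) (lam i) (μ i))
    (s τ e : ℕ → ℝ) (he : e 0 = 0)
    (hIC : ∀ i n, i + (n + 1) = m.T →
      (τ i + m.δ * (e (i + 1) * m.annuity n) ≤ e i * m.annuity (n + 1)) ∨
      m.v (z i) RiskType.low + m.δ * (m.u (c (i + 1)) * m.annuity n) <
        m.u (c i) * m.annuity (n + 1))
    (hprom : ∑ j ∈ Finset.range m.T, (m.δ * m.trans RiskType.high RiskType.high) ^ j *
      (s j + m.δ * m.trans RiskType.high RiskType.low *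
        (e (j + 1) * m.annuity (m.T - 1 - j))) = 0) :
    0 ≤ ∑ j ∈ Finset.range m.T, (m.δ * m.trans RiskType.high RiskType.high) ^ j *
      (lam j * s j - μ j * τ j +
        m.δ * m.trans RiskType.high RiskType.low *
          ((m.mc (c (j + 1)) * e (j + 1)) * m.annuity (m.T - 1 - j))) := by
  choose d hd1 hd2 using fun j => exists_flow_direction (m := m) (s j) (τ j)
  have h := hopt.derivative_nonneg hz hc d e he (by simpa only [hd2] using hIC)
    (by simpa only [hd1] using hprom)
  refine h.trans (le_of_eq (Finset.sum_congr rfl fun j hj => ?_))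
  have := m.sum_high_affine (lam j) (μ j) (d j)
  rw [hd1, hd2] at this
  rw [← this]
  simp only [hfoc j (Finset.mem_range.1 hj) _]

/-- The Kuhn-Tucker conditions of the cost minimization problem. -/
theorem CostMinimal.exists_multipliers (hopt : m.CostMinimal z c)
    (hz : ∀ i < m.T, ∀ y, 0 < z i y) (hc : ∀ i, 0 < i → i < m.T → 0 < c i) :
    ∃ (lam : ℝ) (μ : ℕ → ℝ), (∀ i < m.T, m.AuxFOC (z i) lam (μ i)) ∧ (∀ i < m.T, 0 ≤ μ i) ∧
      (∀ i n, i + (n + 1) = m.T →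
        m.v (z i) RiskType.low + m.δ * (m.u (c (i + 1)) * m.annuity n) <
          m.u (c i) * m.annuity (n + 1) → μ i = 0) ∧
      ∀ i, i + 1 < m.T →
        m.trans RiskType.high RiskType.low * m.mc (c (i + 1)) =
          m.trans RiskType.high RiskType.low * lam - μ i +
            m.trans RiskType.high RiskType.high * μ (i + 1) := by
  have hex : ∀ i, ∃ l s, i < m.T → m.AuxFOC (z i) l s := fun i => by
    by_cases hi : i < m.T
    · obtain ⟨l, s, h⟩ := hopt.exists_auxFOC hz hc hi
      exact ⟨l, s, fun _ => h⟩
    · exact ⟨0, 0, fun h => absurd h hi⟩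
  choose lam μ hfoc using hex
  have hD := hopt.derivative_nonneg' hz hc hfoc
  set β := m.δ * m.trans RiskType.high RiskType.high with hβ
  have hβ0 : 0 < β := mul_pos m.δ_pos m.trans_high_high_pos
  have hT : 0 < m.T := m.T_pos
  have hsum1 : ∀ i < m.T, ∀ g : ℕ → ℝ, (∀ j, j ≠ i → g j = 0) →
      ∑ j ∈ Finset.range m.T, g j = g i := fun i hi g hg =>
    Finset.sum_eq_single i (fun j _ hj => hg j hj) (fun h => absurd (Finset.mem_range.2 hi) h)
  have hsum2 : ∀ i k, i < m.T → k < m.T → i ≠ k → ∀ g : ℕ → ℝ,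
      (∀ j, j ≠ i → j ≠ k → g j = 0) → ∑ j ∈ Finset.range m.T, g j = g i + g k :=
    fun i k hi hk hik g hg => Finset.sum_eq_add i k hik (fun j _ hj => hg j hj.1 hj.2)
      (fun h => absurd (Finset.mem_range.2 hi) h) (fun h => absurd (Finset.mem_range.2 hk) h)
  -- equality of the multipliers of the promise
  have hlam : ∀ i < m.T, lam i = lam 0 := by
    intro i hi
    rcases Nat.eq_zero_or_pos i with rfl | hi0
    · rfl
    -- Shifts utility of the high type between the first period and period `i` at the rate that
    -- keeps the promise, with the low type's flow utilities unchanged. Both signs of `x` are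
    -- feasible.
    have key : ∀ x : ℝ, 0 ≤ lam 0 * (-(β ^ i * x)) + β ^ i * (lam i * x) := by
      intro x
      have h := hD (fun j => if j = 0 then -(β ^ i * x) else if j = i then x else 0) (fun _ => 0)
        (fun _ => 0) rfl (fun j n _ => Or.inl (by simp)) (by
          refine (hsum2 0 i hT hi hi0.ne _ (fun j h1 h2 => by simp [h1, h2])).trans ?_
          simp [hi0.ne'])
      replace h := h.trans_eq (hsum2 0 i hT hi hi0.ne _ (fun j h1 h2 => by simp [h1, h2]))
      simpa [hi0.ne'] using h
    have k1 := key 1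
    have k2 := key (-1)
    have h3 : β ^ i * (lam i - lam 0) = 0 := by linarith
    rw [mul_eq_zero, or_iff_right (pow_pos hβ0 i).ne', sub_eq_zero] at h3
    exact h3
  -- Changes the flow utility of the low type in period `i` alone: always feasible downwards, and in
  -- both directions if the constraint is slack. This gives the sign and complementary slackness.
  have hμ : ∀ i < m.T, ∀ x : ℝ, (x ≤ 0 ∨ ∀ n, i + (n + 1) = m.T →
      m.v (z i) RiskType.low + m.δ * (m.u (c (i + 1)) * m.annuity n) <
        m.u (c i) * m.annuity (n + 1)) → μ i * x ≤ 0 := by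
    intro i hi x hx
    have h := hD (fun _ => 0) (fun j => if j = i then x else 0) (fun _ => 0) rfl (fun j n hj => by
        by_cases hji : j = i
        · subst hji
          rcases hx with hx | hx
          · left; simpa using hx
          · exact Or.inr (hx n hj)
        · left; simp [hji]) (by simp)
    replace h := h.trans_eq (hsum1 i hi _ (fun j h1 => by simp [h1]))
    simp only [mul_zero, if_true, zero_sub, zero_mul, add_zero, mul_neg] at h
    by_contra hcon
    have := mul_pos (pow_pos hβ0 i) (not_le.1 hcon)
    linarith
  refine ⟨lam 0, μ, fun i hi => hlam i hi ▸ hfoc i hi, fun i hi => ?_, fun i n hin hlt => ?_,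
    fun i hi => ?_⟩
  · have := hμ i hi (-1) (Or.inl (by norm_num))
    linarith
  · have hi : i < m.T := by omega
    have h1 := hμ i hi (-1) (Or.inl (by norm_num))
    have h2 := hμ i hi 1 (Or.inr fun k hk => by
      rwa [show k = n by omega])
    linarith
  · obtain ⟨n, hn⟩ := Nat.exists_eq_add_of_lt hi
    have hA : 0 < m.annuity (n + 1) := m.annuity_pos (Nat.succ_pos n)
    have hTi : m.T - 1 - i = n + 1 := by omega
    have hi' : i < m.T := by omega
    -- Raises `m.u (c (i + 1))` by `x`. The flow utilities in period `i` offset this for the high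
    -- type and for a pretending low type, and the low type's flow utility in period `i + 1` rises
    -- as much as the relaxed constraint there allows. No constraint changes, so both signs of `x`
    -- are feasible.
    have key : ∀ x : ℝ, 0 ≤ β ^ i * (lam i * (-(m.δ * m.trans RiskType.high RiskType.low *
        (x * m.annuity (n + 1)))) - μ i * (-(m.δ * (x * m.annuity (n + 1)))) +
        m.δ * m.trans RiskType.high RiskType.low *
          (m.mc (c (i + 1)) * x * m.annuity (n + 1))) +
        β ^ (i + 1) * (-(μ (i + 1) * (x * m.annuity (n + 1)))) := by
      intro x
      have h := hD
        (fun j => if j = i then -(m.δ * m.trans RiskType.high RiskType.low *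
          (x * m.annuity (n + 1))) else 0)
        (fun j => if j = i then -(m.δ * (x * m.annuity (n + 1))) else
          if j = i + 1 then x * m.annuity (n + 1) else 0)
        (fun j => if j = i + 1 then x else 0) (by simp)
        (fun j k hj => Or.inl (by
          by_cases h1 : j = i
          · have : k = n + 1 := by omega
            simp [h1, this]
          · by_cases h2 : j = i + 1
            · have : k = n := by omega
              simp [h2, this]
            · simp [h1, h2]))
        (by
          refine (hsum1 i hi' _ (fun j h1 => by simp [h1])).trans ?_
          simp [hTi])
      replace h := h.trans_eq (hsum2 i (i + 1) hi' hi (Nat.succ_ne_self i).symm _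
        (fun j h1 h2 => by simp [h1, h2]))
      simpa [hTi] using h
    have k1 := key 1
    have k2 := key (-1)
    have h3 : β ^ i * (m.δ * m.annuity (n + 1)) *
        (-(m.trans RiskType.high RiskType.low * lam i) + μ i +
          m.trans RiskType.high RiskType.low * m.mc (c (i + 1)) -
          m.trans RiskType.high RiskType.high * μ (i + 1)) = 0 := by
      rw [pow_succ, hβ] at k1 k2
      rw [hβ]
      linarith
    rw [mul_eq_zero, or_iff_right (mul_pos (pow_pos hβ0 i) (mul_pos m.δ_pos hA)).ne',
      hlam i hi'] at h3
    linarith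

end InsuranceModel

end

/-! ### Multiplier recursion and supermodularity give nondecreasing insurance levels. -/

noncomputable section

namespace InsuranceModel

variable {m : InsuranceModel} {z : ℕ → m.FlowContract} {c : ℕ → ℝ≥0}

/-! ### Monotonicity of the full insurance levels -/

theorem univ_nonempty : (Finset.univ : Finset m.Y).Nonempty := by
  by_contra h
  rw [Finset.not_nonempty_iff_eq_empty] at h
  have := m.p_sum RiskType.high
  rw [h] at this
  simp at this

theorem v_mono {w w' : m.FlowContract} (h : ∀ y, w y ≤ w' y) (θ : RiskType) :
    m.v w θ ≤ m.v w' θ :=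
  Finset.sum_le_sum fun y _ => mul_le_mul_of_nonneg_left
    ((m.u_le_u_iff (w y).coe_nonneg (w' y).coe_nonneg).2 (h y)) (m.p_nonneg _ _)

/-- A larger multiplier on the utility of the low type lowers consumption. -/
theorem AuxFOC.le_of_le {w w' : m.FlowContract} {lam μ μ' : ℝ} (h : m.AuxFOC w lam μ)
    (h' : m.AuxFOC w' lam μ') (hμ : μ' ≤ μ) (y : m.Y) : w y ≤ w' y := by
  have h1 : m.mc (w y) ≤ m.mc (w' y) := by
    rw [h y, h' y]
    have := mul_le_mul_of_nonneg_right hμ (m.lr_nonneg y)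
    linarith
  exact (m.mc_le_mc_iff (w y).coe_nonneg (w' y).coe_nonneg).1 h1

/-- With a nonnegative multiplier on the utility of the low type, the high type values the flow
contract more. -/
theorem AuxFOC.v_low_le {w : m.FlowContract} {lam μ : ℝ} (h : m.AuxFOC w lam μ) (hμ : 0 ≤ μ) :
    m.v w RiskType.low ≤ m.v w RiskType.high := by
  -- Chebyshev's sum inequality: likelihood ratio and utility are oppositely ordered, and their
  -- covariance under the high distribution is the utility difference of the two types.
  have hle : ∀ y y', (m.lr y - m.lr y') * (m.u (w y) - m.u (w y')) ≤ 0 := by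
    have key : ∀ y y', m.lr y ≤ m.lr y' → m.u (w y') ≤ m.u (w y) := fun y y' hr => by
      rw [m.u_le_u_iff (w y').coe_nonneg (w y).coe_nonneg,
        ← m.mc_le_mc_iff (w y').coe_nonneg (w y).coe_nonneg, h y, h y']
      have := mul_le_mul_of_nonneg_left hr hμ
      linarith
    intro y y'
    rcases le_total (m.lr y) (m.lr y') with hr | hr
    · exact mul_nonpos_of_nonpos_of_nonneg (sub_nonpos.2 hr) (sub_nonneg.2 (key _ _ hr))
    · exact mul_nonpos_of_nonneg_of_nonpos (sub_nonneg.2 hr) (sub_nonpos.2 (key _ _ hr))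
  have h1 : ∀ y, ∑ y', m.p RiskType.high y' * ((m.lr y - m.lr y') * (m.u (w y) - m.u (w y'))) =
      m.lr y * m.u (w y) - m.lr y * m.v w RiskType.high - m.u (w y) + m.v w RiskType.low := by
    intro y
    have e : ∀ y', m.p RiskType.high y' * ((m.lr y - m.lr y') * (m.u (w y) - m.u (w y'))) =
        m.p RiskType.high y' * (m.lr y * m.u (w y)) -
          m.lr y * (m.p RiskType.high y' * m.u (w y')) - m.p RiskType.low y' * m.u (w y) +
          m.p RiskType.low y' * m.u (w y') := fun y' => by rw [← m.p_high_mul_lr]; ring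
    simp only [e, Finset.sum_add_distrib, Finset.sum_sub_distrib, sum_p_const, ← Finset.mul_sum]
    rfl
  have h2 : ∑ y, m.p RiskType.high y *
      ∑ y', m.p RiskType.high y' * ((m.lr y - m.lr y') * (m.u (w y) - m.u (w y'))) ≤ 0 :=
    Finset.sum_nonpos fun y _ => mul_nonpos_of_nonneg_of_nonpos (m.p_nonneg _ _)
      (Finset.sum_nonpos fun y' _ => mul_nonpos_of_nonneg_of_nonpos (m.p_nonneg _ _) (hle y y'))
  have e : ∀ y, m.p RiskType.high y * (m.lr y * m.u (w y) - m.lr y * m.v w RiskType.high -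
      m.u (w y) + m.v w RiskType.low) = m.p RiskType.low y * m.u (w y) -
        m.p RiskType.low y * m.v w RiskType.high - m.p RiskType.high y * m.u (w y) +
        m.p RiskType.high y * m.v w RiskType.low := fun y => by rw [← m.p_high_mul_lr]; ring
  simp only [h1, e, Finset.sum_add_distrib, Finset.sum_sub_distrib, sum_p_const] at h2
  change m.v w RiskType.low - m.v w RiskType.high - m.v w RiskType.high + m.v w RiskType.low ≤ 0 at h2
  linarith

theorem exists_consumption_eq_v (w : m.FlowContract) (θ : RiskType) :
    ∃ x, 0 ≤ x ∧ m.u x = m.v w θ := by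
  have hb : (0 : ℝ) ≤ ∑ y, (w y : ℝ) := Finset.sum_nonneg fun y _ => (w y).coe_nonneg
  obtain ⟨x, h0, -, h⟩ := m.exists_consumption hb (u_zero_le_v w θ) (by
    rw [← m.sum_p_const θ (m.u (∑ y, (w y : ℝ)))]
    exact Finset.sum_le_sum fun y _ => mul_le_mul_of_nonneg_left
      ((m.u_le_u_iff (w y).coe_nonneg hb).2 (Finset.single_le_sum
        (f := fun y => (w y : ℝ)) (fun y _ => (w y).coe_nonneg) (Finset.mem_univ y)))
      (m.p_nonneg _ _))
  exact ⟨x, h0, h⟩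

/-- Full insurance levels increase along a cost minimum that deters the high type from announcing
low, if costs are supermodular. -/
theorem CostMinimal.le_succ (hopt : m.CostMinimal z c) (hsuper : m.CostSupermodular)
    (hq : 0 < m.trans RiskType.high RiskType.low) (hdown : m.DownwardIC z c)
    (hz : ∀ i < m.T, ∀ y, 0 < z i y) (hc : ∀ i, 0 < i → i < m.T → 0 < c i) {i : ℕ}
    (hi : i + 1 < m.T) : c i ≤ c (i + 1) := by
  obtain ⟨lam, μ, hfoc, hμ, hslack, hb⟩ := hopt.exists_multipliers hz hc
  have hup := hopt.1
  have hqq := m.trans_high_sum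
  have hqh := m.trans_high_high_pos
  set ql := m.trans RiskType.high RiskType.low
  set qh := m.trans RiskType.high RiskType.high
  have hu : ∀ j k, m.u (c j) < m.u (c k) ↔ c j < c k := fun j k => by
    rw [m.u_lt_u_iff (c j).coe_nonneg (c k).coe_nonneg, NNReal.coe_lt_coe]
  -- Backward induction; in the last period this is the upward constraint. If the claim fails at
  -- `j`, that constraint forces `c (j + 1)` below `c j`, hence below the certainty equivalent of `z
  -- j` for the high type. Supermodularity and the recursion then give `μ (j + 1) < μ j`, so `z (j +
  -- 1)` lies above `z j` and the claim fails at `j + 1` too.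
  have hlow : ∀ n j, j + (n + 1) = m.T → m.v (z j) RiskType.low ≤ m.u (c j) := by
    intro n
    induction n with
    | zero =>
      intro j hj
      have := hup j 0 hj
      simpa [annuity_zero, annuity_succ] using this
    | succ n ih =>
      intro j hj
      by_contra hcon
      rw [not_le] at hcon
      have hIC := hup j (n + 1) hj
      rw [annuity_succ m (n + 1)] at hIC
      have hA := mul_pos m.δ_pos (m.annuity_pos (Nat.succ_pos n))
      have h1 : m.u (c (j + 1)) < m.u (c j) := by
        by_contra h
        have := mul_le_mul_of_nonneg_right (not_lt.1 h) hA.le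
        linarith
      have hjT : j < m.T := by omega
      have hν := (hfoc j hjT).v_low_le (hμ j hjT)
      obtain ⟨x, hx0, hx⟩ := exists_consumption_eq_v (z j) RiskType.high
      have h2 := m.mc_le_of_costSupermodular hsuper (hfoc j hjT) (hμ j hjT) (hz j hjT) hx0 hx hν
      have h3 : (c (j + 1) : ℝ) < x := by
        rw [← m.u_lt_u_iff (c (j + 1)).coe_nonneg hx0, hx]
        linarith
      have h4 := (m.mc_lt_mc_iff (c (j + 1)).coe_nonneg hx0).2 h3
      have h5 := mul_lt_mul_of_pos_left (h4.trans_le h2) hq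
      rw [hb j (by omega)] at h5
      have h6 : μ (j + 1) < μ j := by
        have e : ql * (lam - μ j) = ql * lam - μ j + qh * μ j := by
          have : qh = 1 - ql := by linarith
          rw [this]; ring
        rw [e] at h5
        by_contra h
        have := mul_le_mul_of_nonneg_left (not_lt.1 h) hqh.le
        linarith
      have h7 := v_mono ((hfoc j hjT).le_of_le (hfoc (j + 1) (by omega)) h6.le) RiskType.low
      have h8 := ih (j + 1) (by omega)
      linarith
  have hbind : ∀ j n, j + (n + 1) = m.T → 0 < μ j →
      m.v (z j) RiskType.low + m.δ * (m.u (c (j + 1)) * m.annuity n) =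
        m.u (c j) * m.annuity (n + 1) := by
    intro j n hjn hpos
    refine le_antisymm (hup j n hjn) (not_lt.1 fun h => hpos.ne' (hslack j n hjn h))
  have hbind' : ∀ j n, j + (n + 2) = m.T → 0 < μ j → m.u (c j) - m.v (z j) RiskType.low =
      m.δ * m.annuity (n + 1) * (m.u (c (j + 1)) - m.u (c j)) := by
    intro j n hjn hpos
    have h := hbind j (n + 1) hjn hpos
    rw [annuity_succ m (n + 1)] at h
    linarith
  obtain ⟨n, hn⟩ : ∃ n, i + (n + 2) = m.T := ⟨m.T - i - 2, by omega⟩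
  have hiT : i < m.T := by omega
  -- If `μ i > 0`, the constraint binds, and a flow contract worth at most `c i` to the low type
  -- must be compensated by a higher `c (i + 1)`. If `μ i = 0`, all later consumption equals the
  -- constant `g` paid by `z i`, and the downward constraint gives `c i ≤ g`.
  rcases (hμ i hiT).lt_or_eq with hpos | hzero
  · have h1 := hbind' i n hn hpos
    have h2 := hlow (n + 1) i hn
    have hA := mul_pos m.δ_pos (m.annuity_pos (Nat.succ_pos n))
    by_contra hcon
    have h3 := (hu (i + 1) i).2 (not_le.1 hcon)
    have := mul_pos_of_neg_of_neg (sub_neg.2 h3) (neg_neg_of_pos hA)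
    linarith
  · obtain ⟨y0, -⟩ := univ_nonempty (m := m)
    set g := z i y0 with hg
    have hgl : m.mc g = lam := by rw [hg, hfoc i hiT y0, ← hzero, zero_mul, sub_zero]
    have hzg : ∀ j, j < m.T → μ j = 0 → z j = fun _ => g := by
      intro j hj h0
      funext y
      have h1 : m.mc (z j y) = m.mc g := by rw [hgl, hfoc j hj y, h0, zero_mul, sub_zero]
      exact NNReal.coe_injective
        (m.mc_strictMonoOn.injOn (z j y).coe_nonneg g.coe_nonneg h1)
    have hcg : ∀ j, lam < m.mc (c j) → m.u g < m.u (c j) := fun j h => by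
      rw [m.u_lt_u_iff g.coe_nonneg (c j).coe_nonneg,
        ← m.mc_lt_mc_iff g.coe_nonneg (c j).coe_nonneg, hgl]
      exact h
    have hcg' : ∀ j, m.u g < m.u (c j) → lam < m.mc (c j) := fun j h => by
      rw [← hgl, m.mc_lt_mc_iff g.coe_nonneg (c j).coe_nonneg,
        ← m.u_lt_u_iff g.coe_nonneg (c j).coe_nonneg]
      exact h
    have hlowg : ∀ j < m.T, m.v (z j) RiskType.low ≤ m.u g := by
      intro j hj
      have := v_mono ((hfoc j hj).le_of_le (hfoc i hiT) (hzero ▸ hμ j hj)) RiskType.low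
      rwa [hzg i hiT hzero.symm, v_const] at this
    -- With a binding constraint and `c k` above `g`, levels rise further, since no `z k` is worth
    -- more than `g` to the low type. The recursion keeps the multiplier positive, up to the last
    -- period, where binding contradicts `hlowg`.
    have hR : ∀ n k, k + (n + 1) = m.T → ¬ (0 < μ k ∧ m.u g < m.u (c k)) := by
      intro n
      induction n with
      | zero =>
        rintro k hk ⟨h1, h2⟩
        have h3 := hbind k 0 hk h1
        simp only [annuity_zero, annuity_succ, mul_zero, add_zero, mul_one] at h3
        have := hlowg k (by omega)
        linarith
      | succ n ih =>
        rintro k hk ⟨h1, h2⟩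
        have h3 := hbind' k n hk h1
        have h4 := hlowg k (by omega)
        have hA := mul_pos m.δ_pos (m.annuity_pos (Nat.succ_pos n))
        have h5 : 0 < m.u (c (k + 1)) - m.u (c k) := by
          refine pos_of_mul_pos_right ?_ hA.le
          rw [← h3]
          linarith
        have h6 : m.u g < m.u (c (k + 1)) := by linarith
        have h7 := mul_lt_mul_of_pos_left (hcg' _ h6) hq
        rw [hb k (by omega)] at h7
        have h8 : 0 < μ (k + 1) := pos_of_mul_pos_right (by linarith : 0 < qh * μ (k + 1)) hqh.le
        exact ih (k + 1) (by omega) ⟨h8, h6⟩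
    -- After `μ j = 0`, a positive `μ (j + 1)` would put the marginal cost at `c (j + 1)` above
    -- `lam`, the situation excluded by `hR`.
    have hnext : ∀ j, j + 1 < m.T → μ j = 0 → μ (j + 1) = 0 ∧ c (j + 1) = g := by
      intro j hj h0
      have h1 := hb j hj
      rw [h0] at h1
      have h2 : μ (j + 1) = 0 := by
        refine le_antisymm (not_lt.1 fun h3 => ?_) (hμ _ hj)
        refine hR (m.T - 1 - (j + 1)) (j + 1) (by omega) ⟨h3, hcg _ ?_⟩
        have h4 := mul_pos hqh h3
        exact lt_of_mul_lt_mul_left (by linarith) hq.le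
      refine ⟨h2, NNReal.coe_injective
        (m.mc_strictMonoOn.injOn (c (j + 1)).coe_nonneg g.coe_nonneg ?_)⟩
      rw [h2, mul_zero, add_zero, sub_zero] at h1
      rw [hgl]
      exact mul_left_cancel₀ hq.ne' h1
    have hval : ∀ k j, j + (k + 1) = m.T → μ j = 0 →
        m.highValue z c (k + 1) j = m.u g * m.annuity (k + 1) := by
      intro k
      induction k with
      | zero =>
        intro j hj h0
        rw [highValue, hzg j (by omega) h0, v_const]
        simp [highValue, annuity_zero, annuity_succ]
      | succ k ih =>
        intro j hj h0
        obtain ⟨h1, h2⟩ := hnext j (by omega) h0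
        rw [highValue, hzg j (by omega) h0, v_const, ih (j + 1) (by omega) h1, h2, ← add_mul,
          m.trans_high_sum, annuity_succ m (k + 1)]
        ring
    have h1 := hdown i (n + 2) hn
    rw [hval (n + 1) i hn hzero.symm] at h1
    have h2 := le_of_mul_le_mul_right h1 (m.annuity_pos (Nat.succ_pos (n + 1)))
    rw [(hnext i hi hzero.symm).2]
    exact (m.u_le_u_iff (c i).coe_nonneg g.coe_nonneg).1 h2

theorem CostMinimal.zero_le (hopt : m.CostMinimal z c) (hsuper : m.CostSupermodular)
    (hq : 0 < m.trans RiskType.high RiskType.low) (hdown : m.DownwardIC z c)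
    (hz : ∀ i < m.T, ∀ y, 0 < z i y) (hc : ∀ i, 0 < i → i < m.T → 0 < c i) (i : ℕ)
    (hi : i < m.T) : c 0 ≤ c i := by
  induction i with
  | zero => exact le_rfl
  | succ i ih => exact (ih (by omega)).trans (hopt.le_succ hsuper hq hdown hz hc hi)

end InsuranceModel

end

/-! ### Incentives by initial type, and the utility ranking of the two types. -/

noncomputable section

namespace InsuranceModel

variable {m : InsuranceModel}

/-! ### Incentive compatibility conditional on the initial type -/

/-- The type of the first period. -/
def initialType (η : m.PrivateHistory) (θ : RiskType) : RiskType :=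
  match η.getLast? with
  | some e => e.2.2
  | none => θ

theorem initialType_cons (η : m.PrivateHistory) (y : m.Y) (ρ θ θ' : RiskType) :
    initialType ((y, ρ, θ) :: η) θ' = initialType η θ := by
  cases η with
  | nil => rfl
  | cons e η => simp only [initialType, List.getLast?_cons_cons]; rw [List.getLast?_cons]

theorem strategyUtility_initialType (M : m.Mechanism) (r : m.ReportingStrategy) (θ₀ : RiskType)
    (n : ℕ) (η : m.PrivateHistory) (θ : RiskType) :
    m.strategyUtility M (fun η θ => if initialType η θ = θ₀ then r η θ else θ) n η θ =
      if initialType η θ = θ₀ then m.strategyUtility M r n η θ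
      else m.strategyUtility M m.truthful n η θ := by
  induction n generalizing η θ with
  | zero => simp [strategyUtility]
  | succ n ih =>
    simp only [strategyUtility, ih, initialType_cons]
    split_ifs <;> rfl

theorem strategyUtility_nil_truthful (M : m.Mechanism) (θ : RiskType) :
    m.strategyUtility M m.truthful m.T [] θ = m.V M [] θ := by
  rw [strategyUtility_truthful]; rfl

/-- Both initial types have positive probability, and the private history records the initial type.
A deviation confined to one initial type thus gains ex ante if it gains for that type. -/
theorem IncentiveCompatible.strategyUtility_le {M : m.Mechanism} (hM : m.IncentiveCompatible M)
    (r : m.ReportingStrategy) (θ : RiskType) :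
    m.strategyUtility M r m.T [] θ ≤ m.V M [] θ := by
  have h := hM (fun η θ' => if initialType η θ' = θ then r η θ' else θ')
  simp only [exAnteUtility, strategyUtility_initialType, sum_riskType,
    strategyUtility_nil_truthful] at h
  have hp := m.init_pos θ
  have hi : ∀ θ' : RiskType, initialType (m := m) [] θ' = θ' := fun _ => rfl
  simp only [hi] at h
  cases θ
  · simp only [if_true, reduceCtorEq, if_false, add_le_add_iff_right] at h
    exact le_of_mul_le_mul_left h hp
  · simp only [if_true, reduceCtorEq, if_false, add_le_add_iff_left] at h
    exact le_of_mul_le_mul_left h hp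

/-! ### The high type obtains at least the utility of the low type -/

theorem discountedIncome_low (habs : m.LowAbsorbing) (n : ℕ) :
    m.discountedIncome n RiskType.low = m.cO * m.annuity n := by
  induction n with
  | zero => simp [discountedIncome, annuity_zero]
  | succ n ih =>
    rw [discountedIncome, habs.sum_trans_low, ih, annuity_succ, cO]
    ring

theorem VFI_low (habs : m.LowAbsorbing) : m.VFI RiskType.low = m.u m.cO * m.annuity m.T := by
  rw [VFI, cFI, discountedIncome_low habs, mul_div_cancel_right₀ _ (m.annuity_pos m.T_pos).ne']

theorem le_discountedIncome_high (habs : m.LowAbsorbing) (n : ℕ) :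
    m.cO * m.annuity n ≤ m.discountedIncome n RiskType.high ∧
      (0 < n → m.cO * m.annuity n < m.discountedIncome n RiskType.high) := by
  induction n with
  | zero => simp [discountedIncome, annuity_zero]
  | succ n ih =>
    suffices h : m.cO * m.annuity (n + 1) < m.discountedIncome (n + 1) RiskType.high from
      ⟨h.le, fun _ => h⟩
    have h1 : m.cO < m.meanIncome RiskType.high := m.mean_lt
    have h2 := mul_le_mul_of_nonneg_left ih.1 m.trans_high_high_pos.le
    have h3 : m.cO * m.annuity n ≤ ∑ θ', m.trans RiskType.high θ' * m.discountedIncome n θ' := by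
      rw [sum_riskType, discountedIncome_low habs]
      have h4 : m.cO * m.annuity n = m.trans RiskType.high RiskType.low * (m.cO * m.annuity n) +
        m.trans RiskType.high RiskType.high * (m.cO * m.annuity n) := by
        rw [← add_mul, m.trans_high_sum, one_mul]
      linarith
    have h5 := mul_le_mul_of_nonneg_left h3 m.δ_pos.le
    rw [discountedIncome, annuity_succ]
    linarith

theorem u_zero_mul_le_truthfulUtility (M : m.Mechanism) (n : ℕ) (past : List RiskType)
    (θ : RiskType) : m.u 0 * m.annuity n ≤ m.truthfulUtility M n past θ := by
  induction n generalizing past θ with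
  | zero => simp [truthfulUtility, annuity_zero]
  | succ n ih =>
    have h1 : m.u 0 * m.annuity n ≤
        ∑ θ', m.trans θ θ' * m.truthfulUtility M n (θ :: past) θ' := by
      have := Finset.sum_le_sum fun θ' (_ : θ' ∈ Finset.univ) =>
        mul_le_mul_of_nonneg_left (ih (θ :: past) θ') (m.trans_nonneg θ θ')
      rwa [← Finset.sum_mul, m.trans_sum, one_mul] at this
    have h2 := mul_le_mul_of_nonneg_left h1 m.δ_pos.le
    have h3 := u_zero_le_v (M (θ :: past)) θ
    rw [truthfulUtility, annuity_succ]
    linarith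

variable (m) in
/-- The mechanism that insures at the level `x` everybody who first announced high, and coincides
with `M` otherwise. -/
def insureInitialHigh (M : m.Mechanism) (x : ℝ≥0) : m.Mechanism := fun L =>
  if L.getLast? = some RiskType.high then fun _ => x else M L

theorem strategyUtility_insureInitialHigh_of_high (M : m.Mechanism) (x : ℝ≥0)
    (r : m.ReportingStrategy) (n : ℕ) (η : m.PrivateHistory) (θ : RiskType)
    (h : (m.reports η).getLast? = some RiskType.high) :
    m.strategyUtility (m.insureInitialHigh M x) r n η θ = m.u x * m.annuity n := by
  induction n generalizing η θ with
  | zero => simp [strategyUtility, annuity_zero]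
  | succ n ih =>
    have h1 : ∀ ρ, (ρ :: m.reports η).getLast? = some RiskType.high := fun ρ => by
      rw [List.getLast?_cons, h]; rfl
    have h2 : ∀ y θ', m.strategyUtility (m.insureInitialHigh M x) r n ((y, r η θ, θ) :: η) θ' =
        m.u x * m.annuity n := fun y θ' => ih _ _ (h1 _)
    simp only [strategyUtility, h2, ← Finset.sum_mul, m.trans_sum, m.p_sum, insureInitialHigh, h1,
      if_true, v_const, annuity_succ]
    ring

theorem strategyUtility_insureInitialHigh_of_low (M : m.Mechanism) (x : ℝ≥0)
    (r : m.ReportingStrategy) (n : ℕ) (η : m.PrivateHistory) (θ : RiskType)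
    (h : (m.reports η).getLast? = some RiskType.low) :
    m.strategyUtility (m.insureInitialHigh M x) r n η θ = m.strategyUtility M r n η θ := by
  induction n generalizing η θ with
  | zero => rfl
  | succ n ih =>
    have h1 : ∀ ρ, (ρ :: m.reports η).getLast? = some RiskType.low := fun ρ => by
      rw [List.getLast?_cons, h]; rfl
    have h2 : ∀ y θ', m.strategyUtility (m.insureInitialHigh M x) r n ((y, r η θ, θ) :: η) θ' =
        m.strategyUtility M r n ((y, r η θ, θ) :: η) θ' := fun y θ' => ih _ _ (h1 _)
    simp only [strategyUtility, h2, insureInitialHigh, h1, Option.some.injEq, reduceCtorEq,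
      if_false]

theorem strategyUtility_insureInitialHigh_nil (M : m.Mechanism) (x : ℝ≥0)
    (r : m.ReportingStrategy) (n : ℕ) (θ : RiskType) :
    m.strategyUtility (m.insureInitialHigh M x) r n [] θ =
      if r [] θ = RiskType.high then m.u x * m.annuity n else m.strategyUtility M r n [] θ := by
  cases n with
  | zero => simp [strategyUtility, annuity_zero]
  | succ n =>
    cases hr : r [] θ with
    | low =>
      have h2 : ∀ y θ', m.strategyUtility (m.insureInitialHigh M x) r n [(y, RiskType.low, θ)] θ' =
        m.strategyUtility M r n [(y, RiskType.low, θ)] θ' := fun y θ' =>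
          strategyUtility_insureInitialHigh_of_low _ _ _ _ _ _ rfl
      simp [strategyUtility, hr, h2, insureInitialHigh, reports]
    | high =>
      have h2 : ∀ y θ', m.strategyUtility (m.insureInitialHigh M x) r n [(y, RiskType.high, θ)] θ' =
        m.u x * m.annuity n := fun y θ' =>
          strategyUtility_insureInitialHigh_of_high _ _ _ _ _ _ rfl
      have h3 : m.insureInitialHigh M x [RiskType.high] = fun _ => x := rfl
      simp only [strategyUtility, hr, h2, ← Finset.sum_mul, m.trans_sum, m.p_sum, annuity_succ,
        reports, List.map_nil, h3, v_const, if_true]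
      ring

theorem continuationCost_insureInitialHigh_of_high (M : m.Mechanism) (x : ℝ≥0) (n : ℕ)
    (past : List RiskType) (θ : RiskType) (h : (θ :: past).getLast? = some RiskType.high) :
    m.continuationCost (m.insureInitialHigh M x) n past θ = x * m.annuity n := by
  induction n generalizing past θ with
  | zero => simp [continuationCost, annuity_zero]
  | succ n ih =>
    have h1 : ∀ θ', m.continuationCost (m.insureInitialHigh M x) n (θ :: past) θ' =
        x * m.annuity n := fun θ' => ih _ _ (by rw [List.getLast?_cons_cons]; exact h)
    simp only [continuationCost, h1, insureInitialHigh, h, if_true, ← Finset.sum_mul, m.p_sum,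
      m.trans_sum, annuity_succ]
    ring

theorem continuationCost_insureInitialHigh_of_low (M : m.Mechanism) (x : ℝ≥0) (n : ℕ)
    (past : List RiskType) (θ : RiskType) (h : (θ :: past).getLast? = some RiskType.low) :
    m.continuationCost (m.insureInitialHigh M x) n past θ = m.continuationCost M n past θ := by
  induction n generalizing past θ with
  | zero => rfl
  | succ n ih =>
    have h1 : ∀ θ', m.continuationCost (m.insureInitialHigh M x) n (θ :: past) θ' =
        m.continuationCost M n (θ :: past) θ' :=
      fun θ' => ih _ _ (by rw [List.getLast?_cons_cons]; exact h)
    simp only [continuationCost, h1, insureInitialHigh, h, Option.some.injEq, reduceCtorEq,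
      if_false]

/-- Otherwise, give those who first announce high full insurance at their promised utility. The low
type does not want it, and its level is at most `m.cO`, which is less than the average income of an
initially high type. Profits on the high type become positive instead of zero while those on the low
type are unchanged, contradicting optimality. -/
theorem IsProfitMaximizing.low_le_high {W : RiskType → ℝ} {M : m.Mechanism}
    (hM : m.IsProfitMaximizing W M) (habs : m.LowAbsorbing)
    (hW : W RiskType.low = m.u m.cO * m.annuity m.T) (h0 : m.profitGiven M RiskType.high = 0) :
    W RiskType.low ≤ W RiskType.high := by
  by_contra hcon
  rw [not_le] at hcon
  have hA := m.annuity_pos m.T_pos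
  have hl : m.u 0 * m.annuity m.T ≤ W RiskType.high := by
    rw [← hM.2.1 RiskType.high]
    exact u_zero_mul_le_truthfulUtility _ _ _ _
  obtain ⟨x, hx0, hxc, hxu⟩ := m.exists_consumption m.cO_nonneg ((le_div_iff₀ hA).2 hl)
    ((div_le_iff₀ hA).2 (hcon.le.trans hW.le))
  have hxW : m.u x * m.annuity m.T = W RiskType.high := by
    rw [hxu, div_mul_cancel₀ _ hA.ne']
  set x' : ℝ≥0 := ⟨x, hx0⟩ with hx'
  set M' := m.insureInitialHigh M x' with hM'
  have hV : ∀ θ, m.V M' [] θ = W θ := by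
    intro θ
    rw [← strategyUtility_nil_truthful, strategyUtility_insureInitialHigh_nil,
      strategyUtility_nil_truthful, hM.2.1]
    cases θ
    · simp [truthful]
    · rw [if_pos (show m.truthful [] RiskType.high = RiskType.high from rfl)]
      exact hxW
  have hIC : m.IncentiveCompatible M' := by
    intro r
    rw [exAnteUtility_truthful]
    refine Finset.sum_le_sum fun θ _ => mul_le_mul_of_nonneg_left ?_ (m.init_pos θ).le
    rw [hV, strategyUtility_insureInitialHigh_nil]
    split_ifs
    · refine hxW.le.trans ?_
      cases θ
      · exact hcon.le
      · exact le_rfl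
    · rw [← hM.2.1 θ]
      exact hM.1.strategyUtility_le r θ
  have hle := hM.2.2 M' hIC hV
  rw [profit, profit, sum_riskType, sum_riskType, h0] at hle
  have e1 : m.profitGiven M' RiskType.low = m.profitGiven M RiskType.low := by
    rw [profitGiven, profitGiven, continuationProfit_eq, continuationProfit_eq,
      continuationCost_insureInitialHigh_of_low _ _ _ _ _ rfl]
  have e2 : 0 < m.profitGiven M' RiskType.high := by
    rw [profitGiven, continuationProfit_eq,
      continuationCost_insureInitialHigh_of_high _ _ _ _ _ rfl]
    have h1 := (le_discountedIncome_high habs m.T).2 m.T_pos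
    have h2 := mul_le_mul_of_nonneg_right hxc hA.le
    change 0 < m.discountedIncome m.T RiskType.high - x * m.annuity m.T
    linarith
  rw [e1] at hle
  have := mul_pos (m.init_pos RiskType.high) e2
  linarith

end InsuranceModel

end

/-! ### Certainty equivalents, the reduction and its costs, and the single pretence of a low type.
-/

noncomputable section

namespace InsuranceModel

variable {m : InsuranceModel} {z : ℕ → m.FlowContract} {c : ℕ → ℝ≥0}

/-! ### Full insurance after a low announcement -/

theorem eq_of_tangent_sum_cost_eq {θ : RiskType} {w : m.FlowContract} {x : ℝ} (hx : 0 ≤ x)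
    (h : x + (m.v w θ - m.u x) * m.mc x = ∑ y, m.p θ y * (w y : ℝ)) (y : m.Y)
    (hy : 0 < m.p θ y) : (w y : ℝ) = x := by
  by_contra hne
  have hlt : ∑ y, m.p θ y * (x + (m.u (w y) - m.u x) * m.mc x) < ∑ y, m.p θ y * (w y : ℝ) :=
    Finset.sum_lt_sum (fun y _ => mul_le_mul_of_nonneg_left
      (m.tangent_cost_le hx (w y).coe_nonneg) (m.p_nonneg _ _))
      ⟨y, Finset.mem_univ y, mul_lt_mul_of_pos_left
        (m.tangent_cost_lt hx (w y).coe_nonneg hne) hy⟩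
  rw [← h] at hlt
  refine hlt.ne ?_
  simp only [mul_add, Finset.sum_add_distrib, ← mul_assoc, mul_sub, Finset.sum_sub_distrib,
    ← Finset.sum_mul, m.p_sum, v]
  ring

theorem tangent_continuationCost_le (habs : m.LowAbsorbing) (M : m.Mechanism) {x : ℝ}
    (hx : 0 ≤ x) (n : ℕ) (past : List RiskType) :
    x * m.annuity n + (m.truthfulUtility M n past RiskType.low - m.u x * m.annuity n) * m.mc x ≤
      m.continuationCost M n past RiskType.low := by
  induction n generalizing past with
  | zero => simp [truthfulUtility, continuationCost, annuity_zero]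
  | succ n ih =>
    have h1 := tangent_sum_cost_le RiskType.low (M (RiskType.low :: past)) hx
    have h2 := mul_le_mul_of_nonneg_left (ih (RiskType.low :: past)) m.δ_pos.le
    rw [truthfulUtility, continuationCost, habs.sum_trans_low, habs.sum_trans_low, annuity_succ]
    linarith

/-- Equality in the sum forces equality in the tangent inequality of each period, which is strict
away from `x` at incomes of positive probability. -/
theorem eq_of_continuationCost_eq (habs : m.LowAbsorbing) (M : m.Mechanism) {x : ℝ}
    (hx : 0 ≤ x) (n : ℕ) (past : List RiskType)
    (h : x * m.annuity n + (m.truthfulUtility M n past RiskType.low - m.u x * m.annuity n) *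
      m.mc x = m.continuationCost M n past RiskType.low) (j : ℕ) (hj : j < n) (y : m.Y)
    (hy : 0 < m.p RiskType.low y) :
    (M (List.replicate (j + 1) RiskType.low ++ past) y : ℝ) = x := by
  induction n generalizing past j with
  | zero => omega
  | succ n ih =>
    have h1 := tangent_sum_cost_le RiskType.low (M (RiskType.low :: past)) hx
    have h2 := mul_le_mul_of_nonneg_left
      (tangent_continuationCost_le habs M hx n (RiskType.low :: past)) m.δ_pos.le
    rw [truthfulUtility, continuationCost, habs.sum_trans_low, habs.sum_trans_low,
      annuity_succ] at h
    cases j with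
    | zero =>
      have h3 : x + (m.v (M (RiskType.low :: past)) RiskType.low - m.u x) * m.mc x =
        ∑ y, m.p RiskType.low y * (M (RiskType.low :: past) y : ℝ) := by linarith
      exact eq_of_tangent_sum_cost_eq hx h3 y hy
    | succ j =>
      have h3 := ih (RiskType.low :: past) (mul_left_cancel₀ m.δ_pos.ne' (by linarith)) j (by omega)
      rwa [List.replicate_succ', List.append_assoc]

/-- Provides an attained utility level above the average continuation utility, so that a certainty
equivalent exists even if `m.u` is bounded. -/
theorem exists_truthfulUtility_le (habs : m.LowAbsorbing) (M : m.Mechanism) (n : ℕ)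
    (past : List RiskType) :
    ∃ b : ℝ, 0 ≤ b ∧ m.truthfulUtility M n past RiskType.low ≤ m.u b * m.annuity n := by
  induction n generalizing past with
  | zero => exact ⟨0, le_rfl, by simp [truthfulUtility, annuity_zero]⟩
  | succ n ih =>
    obtain ⟨b, hb, h⟩ := ih (RiskType.low :: past)
    obtain ⟨b', hb', h'⟩ := exists_consumption_eq_v (M (RiskType.low :: past)) RiskType.low
    have hm : 0 ≤ max b b' := hb.trans (le_max_left _ _)
    refine ⟨max b b', hm, ?_⟩
    have h1 := mul_le_mul_of_nonneg_right ((m.u_le_u_iff hb hm).2 (le_max_left b b'))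
      (m.annuity_nonneg n)
    have h2 := (m.u_le_u_iff hb' hm).2 (le_max_right b b')
    have h3 := mul_le_mul_of_nonneg_left (h.trans h1) m.δ_pos.le
    rw [truthfulUtility, habs.sum_trans_low, annuity_succ, ← h']
    linarith

/-- Certainty equivalent of the continuation utility of a low type. -/
theorem exists_certaintyEquivalent (habs : m.LowAbsorbing) (M : m.Mechanism) (n : ℕ)
    (past : List RiskType) :
    ∃ x : ℝ≥0, m.u x * m.annuity n = m.truthfulUtility M n past RiskType.low := by
  rcases Nat.eq_zero_or_pos n with rfl | hn
  · exact ⟨0, by simp [truthfulUtility, annuity_zero]⟩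
  · have hA := m.annuity_pos hn
    obtain ⟨b, hb, h⟩ := exists_truthfulUtility_le habs M n past
    obtain ⟨x, h0, -, hx⟩ := m.exists_consumption hb
      ((le_div_iff₀ hA).2 (u_zero_mul_le_truthfulUtility M n past RiskType.low))
      ((div_le_iff₀ hA).2 h)
    refine ⟨⟨x, h0⟩, ?_⟩
    change m.u x * _ = _
    rw [hx, div_mul_cancel₀ _ hA.ne']

/-! ### The reduction of a mechanism -/

/-- The flow contracts `z` and full insurance levels `c` are derived from the mechanism `M`. -/
structure IsReduction (M : m.Mechanism) (z : ℕ → m.FlowContract) (c : ℕ → ℝ≥0) : Prop where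
  flow : ∀ i, z i = M (List.replicate (i + 1) RiskType.high)
  level : ∀ i n, i + n = m.T →
    m.u (c i) * m.annuity n = m.truthfulUtility M n (List.replicate i RiskType.high) RiskType.low

theorem exists_isReduction (habs : m.LowAbsorbing) (M : m.Mechanism) :
    ∃ z c, IsReduction M z c := by
  choose x hx using fun i =>
    exists_certaintyEquivalent habs M (m.T - i) (List.replicate i RiskType.high)
  refine ⟨fun i => M (List.replicate (i + 1) RiskType.high), x, fun _ => rfl, fun i n h => ?_⟩
  rw [show n = m.T - i by omega]
  exact hx i

namespace IsReduction

variable {M : m.Mechanism}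

theorem highValue_eq (h : IsReduction M z c) (n i : ℕ) (hin : i + n = m.T) :
    m.highValue z c n i =
      m.truthfulUtility M n (List.replicate i RiskType.high) RiskType.high := by
  induction n generalizing i with
  | zero => rfl
  | succ n ih =>
    have e : RiskType.high :: List.replicate i RiskType.high =
      List.replicate (i + 1) RiskType.high := rfl
    rw [highValue, truthfulUtility, sum_riskType, e, ih (i + 1) (by omega),
      h.level (i + 1) n (by omega), h.flow]

theorem cost_low_le (habs : m.LowAbsorbing) (h : IsReduction M z c) (i n : ℕ)
    (hin : i + n = m.T) : c i * m.annuity n ≤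
      m.continuationCost M n (List.replicate i RiskType.high) RiskType.low := by
  have := tangent_continuationCost_le habs M (c i).coe_nonneg n (List.replicate i RiskType.high)
  rwa [← h.level i n hin, sub_self, zero_mul, add_zero] at this

theorem eq_of_cost_low_eq (habs : m.LowAbsorbing) (h : IsReduction M z c) (i n : ℕ)
    (hin : i + n = m.T) (he : c i * m.annuity n =
      m.continuationCost M n (List.replicate i RiskType.high) RiskType.low) (j : ℕ) (hj : j < n)
    (y : m.Y) (hy : 0 < m.p RiskType.low y) :
    M (List.replicate (j + 1) RiskType.low ++ List.replicate i RiskType.high) y = c i := by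
  refine NNReal.coe_injective (eq_of_continuationCost_eq habs M (c i).coe_nonneg n _ ?_ j hj y hy)
  rw [← h.level i n hin, sub_self, zero_mul, add_zero, he]

theorem highCost_le (habs : m.LowAbsorbing) (h : IsReduction M z c) (n i : ℕ)
    (hin : i + n = m.T) : m.highCost z c n i ≤
      m.continuationCost M n (List.replicate i RiskType.high) RiskType.high := by
  induction n generalizing i with
  | zero => exact le_rfl
  | succ n ih =>
    have e : RiskType.high :: List.replicate i RiskType.high =
      List.replicate (i + 1) RiskType.high := rfl
    rw [highCost, continuationCost, sum_riskType, e, auxCost, h.flow]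
    have h1 := mul_le_mul_of_nonneg_left (h.cost_low_le habs (i + 1) n (by omega))
      (m.trans_nonneg RiskType.high RiskType.low)
    have h2 := mul_le_mul_of_nonneg_left (ih (i + 1) (by omega)) m.trans_high_high_pos.le
    have h3 := mul_le_mul_of_nonneg_left (add_le_add h1 h2) m.δ_pos.le
    linarith

/-- The cost comparison is a sum of inequalities in which every low branch has positive weight,
because `hq` holds. Equality of the totals therefore passes to each branch. -/
theorem cost_low_eq_of_highCost_eq (habs : m.LowAbsorbing) (h : IsReduction M z c)
    (hq : 0 < m.trans RiskType.high RiskType.low) (n i : ℕ) (hin : i + n = m.T)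
    (he : m.highCost z c n i =
      m.continuationCost M n (List.replicate i RiskType.high) RiskType.high)
    (j k : ℕ) (hij : i < j) (hjk : j + k = m.T) : c j * m.annuity k =
      m.continuationCost M k (List.replicate j RiskType.high) RiskType.low := by
  induction n generalizing i with
  | zero => omega
  | succ n ih =>
    have e : RiskType.high :: List.replicate i RiskType.high =
      List.replicate (i + 1) RiskType.high := rfl
    rw [highCost, continuationCost, sum_riskType, e, auxCost, h.flow] at he
    have h1 := mul_le_mul_of_nonneg_left (h.cost_low_le habs (i + 1) n (by omega)) hq.le
    have h2 := mul_le_mul_of_nonneg_left (h.highCost_le habs n (i + 1) (by omega))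
      m.trans_high_high_pos.le
    have h3 := mul_left_cancel₀ m.δ_pos.ne' (add_left_cancel he)
    rcases Nat.lt_or_ge (i + 1) j with hj | hj
    · exact ih (i + 1) (by omega) (mul_left_cancel₀ m.trans_high_high_pos.ne' (by linarith)) hj
    · have hj' : j = i + 1 := by omega
      have hk : k = n := by omega
      rw [hj', hk]
      exact mul_left_cancel₀ hq.ne' (by linarith)

end IsReduction

/-! ### Incentives of the low type in an incentive compatible mechanism -/

theorem strategyUtility_succ_of_truthful {M : m.Mechanism} {r : m.ReportingStrategy} {n : ℕ}
    {η : m.PrivateHistory} {θ : RiskType} (hr : r η θ = θ)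
    (h : ∀ y θ', m.strategyUtility M r n ((y, θ, θ) :: η) θ' =
      m.truthfulUtility M n (θ :: m.reports η) θ') :
    m.strategyUtility M r (n + 1) η θ = m.truthfulUtility M (n + 1) (m.reports η) θ := by
  simp only [strategyUtility, hr, h, ← Finset.sum_mul, m.p_sum, one_mul, truthfulUtility]

variable (m) in
/-- Truth-telling, except that a low type announces high once, after `i` high announcements. -/
def pretendOnce (i : ℕ) : m.ReportingStrategy := fun η θ =>
  if m.reports η = List.replicate i RiskType.high then RiskType.high else θ

theorem strategyUtility_pretendOnce_of_ne (M : m.Mechanism) (i n : ℕ) (η : m.PrivateHistory)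
    (θ : RiskType) (h : i < η.length ∨ RiskType.low ∈ m.reports η) :
    m.strategyUtility M (m.pretendOnce i) n η θ = m.truthfulUtility M n (m.reports η) θ := by
  induction n generalizing η θ with
  | zero => rfl
  | succ n ih =>
    have hne : m.reports η ≠ List.replicate i RiskType.high := by
      intro he
      rcases h with h | h
      · have := congrArg List.length he
        rw [reports, List.length_map, List.length_replicate] at this
        omega
      · rw [he] at h
        exact absurd (List.eq_of_mem_replicate h) (by decide)
    refine strategyUtility_succ_of_truthful (if_neg hne) fun y θ' => ih _ _ ?_
    rcases h with h | h
    · left; rw [List.length_cons]; omega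
    · right; exact List.mem_cons_of_mem _ h

theorem length_of_reports_eq {η : m.PrivateHistory} {i : ℕ} {θ : RiskType}
    (h : m.reports η = List.replicate i θ) : η.length = i := by
  have := congrArg List.length h
  rwa [reports, List.length_map, List.length_replicate] at this

theorem strategyUtility_pretendOnce_low (habs : m.LowAbsorbing) (M : m.Mechanism) {i : ℕ} (n : ℕ)
    {η : m.PrivateHistory} (h : m.reports η = List.replicate i RiskType.high) :
    m.strategyUtility M (m.pretendOnce i) (n + 1) η RiskType.low =
      m.v (M (List.replicate (i + 1) RiskType.high)) RiskType.low +
        m.δ * m.truthfulUtility M n (List.replicate (i + 1) RiskType.high) RiskType.low := by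
  have hr : m.pretendOnce i η RiskType.low = RiskType.high := if_pos h
  have h1 : ∀ y θ', m.strategyUtility M (m.pretendOnce i) n
      ((y, RiskType.high, RiskType.low) :: η) θ' =
      m.truthfulUtility M n (List.replicate (i + 1) RiskType.high) θ' := fun y θ' => by
    rw [strategyUtility_pretendOnce_of_ne _ _ _ _ _ (Or.inl (by
      rw [List.length_cons, length_of_reports_eq h]; omega))]
    congr 1
    exact congrArg _ h
  simp only [strategyUtility, hr, h1, habs.sum_trans_low, ← Finset.sum_mul, m.p_sum, one_mul, h]
  rfl

/-- A gain from pretending after `i` highs is carried back along the all-high path. The history at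
which it accrues has positive probability, so the gain is strict for a high type at any earlier
date; at date `i` itself a high type reports truthfully and the utilities coincide. -/
theorem truthfulUtility_le_pretendOnce_high (habs : m.LowAbsorbing) (M : m.Mechanism) {i n : ℕ}
    (hin : i + (n + 1) = m.T) (hq : i = 0 ∨ 0 < m.trans RiskType.high RiskType.low)
    (hlt : m.truthfulUtility M (n + 1) (List.replicate i RiskType.high) RiskType.low <
      m.v (M (List.replicate (i + 1) RiskType.high)) RiskType.low +
        m.δ * m.truthfulUtility M n (List.replicate (i + 1) RiskType.high) RiskType.low)
    (k j : ℕ) (η : m.PrivateHistory) (hη : m.reports η = List.replicate j RiskType.high)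
    (hjk : j + k = m.T) (hj : j ≤ i) :
    m.truthfulUtility M k (m.reports η) RiskType.high ≤
        m.strategyUtility M (m.pretendOnce i) k η RiskType.high ∧
      (j < i → m.truthfulUtility M k (m.reports η) RiskType.high <
        m.strategyUtility M (m.pretendOnce i) k η RiskType.high) := by
  induction k generalizing j η with
  | zero => omega
  | succ k ih =>
    have hlen := length_of_reports_eq hη
    have hr : m.pretendOnce i η RiskType.high = RiskType.high := by
      rw [pretendOnce]; split_ifs <;> rfl
    rcases hj.lt_or_eq with hji | hji
    · suffices h : m.truthfulUtility M (k + 1) (m.reports η) RiskType.high <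
          m.strategyUtility M (m.pretendOnce i) (k + 1) η RiskType.high from ⟨h.le, fun _ => h⟩
      have hql : 0 < m.trans RiskType.high RiskType.low := hq.resolve_left (by omega)
      have hη' : ∀ y : m.Y, m.reports ((y, RiskType.high, RiskType.high) :: η) =
        List.replicate (j + 1) RiskType.high := fun y => congrArg _ hη
      have hcons : RiskType.high :: m.reports η = List.replicate (j + 1) RiskType.high :=
        congrArg _ hη
      -- the low type after one more period
      have hlow : ∀ y, m.truthfulUtility M k (RiskType.high :: m.reports η) RiskType.low ≤
          m.strategyUtility M (m.pretendOnce i) k ((y, RiskType.high, RiskType.high) :: η)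
            RiskType.low ∧ (j + 1 = i →
          m.truthfulUtility M k (RiskType.high :: m.reports η) RiskType.low <
          m.strategyUtility M (m.pretendOnce i) k ((y, RiskType.high, RiskType.high) :: η)
            RiskType.low) := by
        intro y
        rcases Nat.lt_or_ge (j + 1) i with h | h
        · refine ⟨?_, fun h' => absurd h' h.ne⟩
          obtain ⟨k', rfl⟩ : ∃ k', k = k' + 1 := ⟨k - 1, by omega⟩
          refine (strategyUtility_succ_of_truthful
            (η := (y, RiskType.high, RiskType.high) :: η) ?_ fun y' θ' => ?_).ge
          · refine if_neg fun he => ?_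
            have := length_of_reports_eq he
            rw [List.length_cons] at this
            omega
          · exact strategyUtility_pretendOnce_of_ne _ _ _ _ _ (Or.inr (List.mem_cons_self ..))
        · have hji' : j + 1 = i := by omega
          have hkn : k = n + 1 := by omega
          have : m.truthfulUtility M k (RiskType.high :: m.reports η) RiskType.low <
              m.strategyUtility M (m.pretendOnce i) k ((y, RiskType.high, RiskType.high) :: η)
                RiskType.low := by
            rw [hkn, strategyUtility_pretendOnce_low habs M n ((hη' y).trans (by rw [hji'])),
              hcons, hji']
            exact hlt
          exact ⟨this.le, fun _ => this⟩
      have hstep : ∀ y, ∑ θ', m.trans RiskType.high θ' *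
            m.truthfulUtility M k (RiskType.high :: m.reports η) θ' <
          ∑ θ', m.trans RiskType.high θ' * m.strategyUtility M (m.pretendOnce i) k
            ((y, RiskType.high, RiskType.high) :: η) θ' := by
        intro y
        have h1 := hlow y
        have h2 := ih (j + 1) ((y, RiskType.high, RiskType.high) :: η) (hη' y) (by omega) (by omega)
        have h3 : m.reports ((y, RiskType.high, RiskType.high) :: η) =
          RiskType.high :: m.reports η := rfl
        rw [h3] at h2
        rw [sum_riskType, sum_riskType]
        rcases Nat.lt_or_ge (j + 1) i with h | h
        · exact add_lt_add_of_le_of_lt (mul_le_mul_of_nonneg_left h1.1 hql.le)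
            (mul_lt_mul_of_pos_left (h2.2 h) m.trans_high_high_pos)
        · exact add_lt_add_of_lt_of_le (mul_lt_mul_of_pos_left (h1.2 (by omega)) hql)
            (mul_le_mul_of_nonneg_left h2.1 m.trans_high_high_pos.le)
      have hsum := Finset.sum_lt_sum_of_nonempty univ_nonempty fun y (_ : y ∈ Finset.univ) =>
        mul_lt_mul_of_pos_left (hstep y) (m.p_high_pos y)
      rw [sum_p_const] at hsum
      have := mul_lt_mul_of_pos_left hsum m.δ_pos
      simp only [truthfulUtility, strategyUtility, hr]
      linarith
    · refine ⟨le_of_eq (strategyUtility_succ_of_truthful hr fun y θ' => ?_).symm,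
        fun h => absurd h hji.not_lt⟩
      exact strategyUtility_pretendOnce_of_ne _ _ _ _ _ (Or.inl (by
        rw [List.length_cons]; omega))

/-- In an incentive compatible mechanism, a low type does not gain by pretending once. -/
theorem IncentiveCompatible.pretendOnce_le (habs : m.LowAbsorbing) {M : m.Mechanism}
    (hM : m.IncentiveCompatible M) {i n : ℕ} (hin : i + (n + 1) = m.T)
    (hq : i = 0 ∨ 0 < m.trans RiskType.high RiskType.low) :
    m.v (M (List.replicate (i + 1) RiskType.high)) RiskType.low +
        m.δ * m.truthfulUtility M n (List.replicate (i + 1) RiskType.high) RiskType.low ≤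
      m.truthfulUtility M (n + 1) (List.replicate i RiskType.high) RiskType.low := by
  by_contra hcon
  rw [not_le] at hcon
  rcases Nat.eq_zero_or_pos i with rfl | hi
  · have h := hM.strategyUtility_le (m.pretendOnce 0) RiskType.low
    rw [V, List.length_nil, Nat.sub_zero, ← hin, zero_add,
      strategyUtility_pretendOnce_low habs M n (η := []) rfl] at h
    exact absurd hcon (not_lt.2 h)
  · have h := hM.strategyUtility_le (m.pretendOnce i) RiskType.high
    have h2 := (truthfulUtility_le_pretendOnce_high habs M hin hq hcon m.T 0 [] rfl (zero_add _)
      hi.le).2 hi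
    exact absurd h2 (not_lt.2 h)

theorem IsReduction.upwardIC (habs : m.LowAbsorbing) {M : m.Mechanism} (h : IsReduction M z c)
    (hM : m.IncentiveCompatible M) (hq : 0 < m.trans RiskType.high RiskType.low) :
    m.UpwardIC z c := by
  intro i n hin
  rw [h.level i (n + 1) hin, h.level (i + 1) n (by omega), h.flow]
  exact hM.pretendOnce_le habs hin (Or.inr hq)

end InsuranceModel

end

/-! ### Histories on path, survival of re-entry, and the cases of changing and of permanent types.
-/

noncomputable section

namespace InsuranceModel

variable {m : InsuranceModel} {z : ℕ → m.FlowContract} {c : ℕ → ℝ≥0}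

/-! ### Histories of positive probability -/

theorem historyProb_nonneg (L : List RiskType) : 0 ≤ m.historyProb L := by
  induction L with
  | nil => exact zero_le_one
  | cons θ L ih =>
    cases L with
    | nil => exact (m.init_pos θ).le
    | cons θ' L => exact mul_nonneg ih (m.trans_nonneg _ _)

theorem historyProb_pos_cons {θ θ' : RiskType} {L : List RiskType}
    (h : 0 < m.historyProb (θ' :: θ :: L)) :
    0 < m.historyProb (θ :: L) ∧ 0 < m.trans θ θ' :=
  ⟨pos_of_mul_pos_left h (m.trans_nonneg _ _), pos_of_mul_pos_right h (historyProb_nonneg _)⟩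

/-- Histories of positive probability consist of high types followed by low types. -/
theorem historyProb_pos_cases (habs : m.LowAbsorbing) (past : List RiskType) (θ : RiskType)
    (h : 0 < m.historyProb (θ :: past)) :
    θ :: past = List.replicate (past.length + 1) RiskType.high ∨
      ∃ i j, θ :: past = List.replicate (j + 1) RiskType.low ++ List.replicate i RiskType.high ∧
        (i = 0 ∨ 0 < m.trans RiskType.high RiskType.low) := by
  induction past generalizing θ with
  | nil =>
    cases θ
    · exact Or.inr ⟨0, 0, rfl, Or.inl rfl⟩
    · exact Or.inl rfl
  | cons θ₁ past ih =>
    obtain ⟨h1, h2⟩ := historyProb_pos_cons h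
    rcases ih θ₁ h1 with h3 | ⟨i, j, h3, h4⟩
    · have hθ : θ₁ = RiskType.high := by
        rw [List.replicate_succ] at h3
        exact (List.cons.inj h3).1
      cases θ with
      | low =>
        rw [hθ] at h2
        exact Or.inr ⟨past.length + 1, 0, congrArg _ h3, Or.inr h2⟩
      | high => exact Or.inl (congrArg _ h3)
    · have hθ : θ₁ = RiskType.low := by
        rw [List.replicate_succ, List.cons_append] at h3
        exact (List.cons.inj h3).1
      rw [hθ] at h2
      cases θ with
      | low => exact Or.inr ⟨i, j + 1, congrArg _ h3, h4⟩
      | high =>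
        rw [habs.trans_low_high] at h2
        exact absurd h2 (lt_irrefl _)

theorem lowDate_replicate_append (i j : ℕ) :
    lowDate (List.replicate (j + 1) RiskType.low ++ List.replicate i RiskType.high) = some i := by
  induction j with
  | zero =>
    have := lowDate_low_cons (lowDate_replicate i)
    rwa [List.length_replicate] at this
  | succ j ih => exact lowDate_cons_of_some ih _

theorem historyProb_replicate_pos (i : ℕ) :
    0 < m.historyProb (List.replicate (i + 1) RiskType.high) := by
  induction i with
  | zero => exact m.init_pos _
  | succ i ih => exact mul_pos ih m.trans_high_high_pos

theorem SameOutcome.truthfulUtility_eq {M M' : m.Mechanism} (h : m.SameOutcome M M') (n : ℕ)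
    (past : List RiskType) (θ : RiskType) (hn : past.length + n = m.T)
    (hp : 0 < m.historyProb (θ :: past)) :
    m.truthfulUtility M' n past θ = m.truthfulUtility M n past θ := by
  induction n generalizing past θ with
  | zero => rfl
  | succ n ih =>
    have h1 : m.v (M' (θ :: past)) θ = m.v (M (θ :: past)) θ := by
      refine Finset.sum_congr rfl fun y _ => ?_
      rcases (m.p_nonneg θ y).lt_or_eq with hy | hy
      · rw [h past θ (by omega) hp y hy]
      · rw [← hy, zero_mul, zero_mul]
    rw [truthfulUtility, truthfulUtility, h1]
    congr 2
    refine Finset.sum_congr rfl fun θ' _ => ?_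
    rcases (m.trans_nonneg θ θ').lt_or_eq with hθ | hθ
    · rw [ih (θ :: past) θ' (by rw [List.length_cons]; omega) (mul_pos hp hθ)]
    · rw [← hθ, zero_mul, zero_mul]

theorem sameOutcome_insuringMechanism (habs : m.LowAbsorbing) {M : m.Mechanism}
    (hz : ∀ i < m.T, ∀ y, z i y = M (List.replicate (i + 1) RiskType.high) y)
    (hc : ∀ i j, i + (j + 1) ≤ m.T → (i = 0 ∨ 0 < m.trans RiskType.high RiskType.low) →
      ∀ y, 0 < m.p RiskType.low y →
        M (List.replicate (j + 1) RiskType.low ++ List.replicate i RiskType.high) y = c i) :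
    m.SameOutcome M (m.insuringMechanism z c) := by
  intro past θ hlen hp y hy
  rcases historyProb_pos_cases habs past θ hp with h | ⟨i, j, h, hq⟩
  · rw [h, insuringMechanism_none (lowDate_replicate _), List.length_replicate,
      Nat.add_sub_cancel, hz _ hlen]
  · have hθ : θ = RiskType.low := by
      rw [List.replicate_succ, List.cons_append] at h
      exact (List.cons.inj h).1
    have hl := congrArg List.length h
    rw [List.length_cons, List.length_append, List.length_replicate, List.length_replicate] at hl
    rw [hθ] at hy
    rw [h, insuringMechanism_some (lowDate_replicate_append i j), hc i j (by omega) hq y hy]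

/-- A mechanism with the outcome of an incentive compatible mechanism that fully insures at least
at the level of the re-entry offer after the first low announcement survives re-entry. -/
theorem SameOutcome.survives_reentry (habs : m.LowAbsorbing) {M : m.Mechanism}
    (hsame : m.SameOutcome M (m.insuringMechanism z c)) (hup : m.UpwardIC z c)
    (hdown : m.DownwardIC z c) (hx : ∀ i < m.T, m.u m.cO ≤ m.u (c i)) :
    (∀ (past : List RiskType) (θ : RiskType), past.length < m.T →
      0 < m.historyProb (θ :: past) → m.VO (past.length + 1) ≤ m.V M past θ) ∧
    (∃ M' : m.Mechanism, m.SameOutcome M M' ∧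
      ∀ (r : m.ReportingStrategy) (e : m.ReentryPlan) (θ : RiskType),
        m.reentryUtility M' r e m.T [] θ ≤ m.V M' [] θ) := by
  refine ⟨fun past θ hlen hp => ?_, _, hsame, fun r e θ => ?_⟩
  · have hn : past.length + (m.T - past.length) = m.T := by omega
    have hA := m.annuity_nonneg (m.T - past.length)
    rw [V, ← hsame.truthfulUtility_eq _ _ _ hn hp, truthfulUtility_insuringMechanism habs,
      m.VO_eq hn]
    have h1 := mul_le_mul_of_nonneg_right (hx past.length hlen) hA
    cases hL : lowDate past with
    | some i => exact mul_le_mul_of_nonneg_right (hx i ((lowDate_lt hL).trans hlen)) hA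
    | none =>
      cases θ with
      | low => exact h1
      | high => exact h1.trans (hdown _ _ hn)
  · rw [V, truthfulUtility_insuringMechanism habs]
    exact reentryUtility_insuringMechanism_le habs hup hdown (fun _ _ _ => hx) _ _ _ (zero_add _)

/-! ### Competitive contracts when the high type may become low -/

theorem IsReduction.level_zero {M : m.Mechanism} (h : IsReduction M z c) {W : RiskType → ℝ}
    (hV : ∀ θ, m.V M [] θ = W θ) : m.u (c 0) * m.annuity m.T = W RiskType.low := by
  rw [h.level 0 m.T (zero_add _), ← hV]
  rfl

theorem IsReduction.value_zero {M : m.Mechanism} (h : IsReduction M z c) {W : RiskType → ℝ}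
    (hV : ∀ θ, m.V M [] θ = W θ) : m.highValue z c m.T 0 = W RiskType.high := by
  rw [h.highValue_eq m.T 0 (zero_add _), ← hV]
  rfl

theorem coe_eq_cO_of_u_mul {x : ℝ≥0} (h : m.u x * m.annuity m.T = m.u m.cO * m.annuity m.T) :
    (x : ℝ) = m.cO :=
  m.u_injOn x.coe_nonneg m.cO_nonneg (mul_right_cancel₀ (m.annuity_pos m.T_pos).ne' h)

/-- The reduction of `M` is feasible in the profit maximization once `DownwardIC` is known, and that
follows from the cost comparison itself, since a violation would allow a strictly cheaper feasible
contract. -/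
theorem IsProfitMaximizing.survives_reentry_of_trans_pos {W : RiskType → ℝ} {M : m.Mechanism}
    (hM : m.IsProfitMaximizing W M) (habs : m.LowAbsorbing) (hsuper : m.CostSupermodular)
    (hint : m.Interior M) (hW : W RiskType.low = m.u m.cO * m.annuity m.T)
    (hWle : W RiskType.low ≤ W RiskType.high)
    (hq : 0 < m.trans RiskType.high RiskType.low) :
    (∀ (past : List RiskType) (θ : RiskType), past.length < m.T →
      0 < m.historyProb (θ :: past) → m.VO (past.length + 1) ≤ m.V M past θ) ∧
    (∃ M' : m.Mechanism, m.SameOutcome M M' ∧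
      ∀ (r : m.ReportingStrategy) (e : m.ReentryPlan) (θ : RiskType),
        m.reentryUtility M' r e m.T [] θ ≤ m.V M' [] θ) := by
  obtain ⟨z, c, hred⟩ := exists_isReduction habs M
  have hup := hred.upwardIC habs hM.1 hq
  have hc0 := hred.level_zero hM.2.1
  have hH0 := hred.value_zero hM.2.1
  have hl := hred.cost_low_le habs 0 m.T (zero_add _)
  have hh := hred.highCost_le habs m.T 0 (zero_add _)
  rw [List.replicate_zero] at hl hh
  have hil := m.init_pos RiskType.low
  have hih := m.init_pos RiskType.high
  have hl' := mul_le_mul_of_nonneg_left hl hil.le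
  have hh' := mul_le_mul_of_nonneg_left hh hih.le
  have hle0 : m.u (c 0) * m.annuity m.T ≤ m.highValue z c m.T 0 := by rw [hc0, hH0]; exact hWle
  -- any contract that deters the low type costs at least as much
  have hmin : ∀ z' c', m.UpwardIC z' c' → c' 0 = c 0 →
      m.highValue z' c' m.T 0 = m.highValue z c m.T 0 →
      m.highCost z c m.T 0 ≤ m.highCost z' c' m.T 0 ∧
        (¬ m.DownwardIC z' c' → m.highCost z c m.T 0 < m.highCost z' c' m.T 0) := by
    intro z' c' hup' h0 hval
    have key : ∀ z'' c'', m.UpwardIC z'' c'' → m.DownwardIC z'' c'' → c'' 0 = c 0 →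
        m.highValue z'' c'' m.T 0 = m.highValue z c m.T 0 →
        m.highCost z c m.T 0 ≤ m.highCost z'' c'' m.T 0 := by
      intro z'' c'' hu hd h0' hval'
      have h1 := hM.cost_le habs hu hd (by rw [h0', hc0]) (by rw [hval', hH0])
      rw [h0'] at h1
      exact le_of_mul_le_mul_left (by linarith) hih
    by_cases hd : m.DownwardIC z' c'
    · exact ⟨key z' c' hup' hd h0 hval, fun h => absurd hd h⟩
    · obtain ⟨z'', c'', h1, h2, h3, h4, h5⟩ :=
        hup'.exists_downwardIC_lt hq (by rw [h0, hval]; exact hle0) hd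
      have := (key z'' c'' h1 h2 (h3.trans h0) (h4.trans hval)).trans_lt h5
      exact ⟨this.le, fun _ => this⟩
  have hdown : m.DownwardIC z c := by
    by_contra h
    exact lt_irrefl _ ((hmin z c hup rfl rfl).2 h)
  have hopt : m.CostMinimal z c := ⟨hup, fun z' c' h1 h2 h3 => (hmin z' c' h1 h2 h3).1⟩
  have hcost := hM.cost_le habs hup hdown hc0 hH0
  -- The reduction costs no more than `M` for each type, and optimality gives the reverse inequality
  -- on average, so both are equalities.
  have hel : c 0 * m.annuity m.T = m.continuationCost M m.T [] RiskType.low :=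
    mul_left_cancel₀ hil.ne' (by linarith)
  have heh : m.highCost z c m.T 0 = m.continuationCost M m.T [] RiskType.high :=
    mul_left_cancel₀ hih.ne' (by linarith)
  have hconst : ∀ i j, i + (j + 1) ≤ m.T → ∀ y, 0 < m.p RiskType.low y →
      M (List.replicate (j + 1) RiskType.low ++ List.replicate i RiskType.high) y = c i := by
    intro i j hij
    have hi : i + (m.T - i) = m.T := by omega
    refine hred.eq_of_cost_low_eq habs i (m.T - i) hi ?_ j (by omega)
    rcases Nat.eq_zero_or_pos i with rfl | hi0
    · exact hel
    · exact hred.cost_low_eq_of_highCost_eq habs hq m.T 0 (zero_add _) heh i _ hi0 hi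
  have hzpos : ∀ i < m.T, ∀ y, 0 < z i y := by
    intro i hi y
    rw [hred.flow]
    exact hint (List.replicate i RiskType.high) RiskType.high (by rwa [List.length_replicate])
      (historyProb_replicate_pos i) y (m.p_high_pos y)
  have hcpos : ∀ i, 0 < i → i < m.T → 0 < c i := by
    intro i hi0 hi
    obtain ⟨y, hy⟩ : ∃ y, 0 < m.p RiskType.low y := by
      by_contra h
      push Not at h
      have h1 := Finset.sum_nonpos fun y (_ : y ∈ Finset.univ) => h y
      rw [m.p_sum] at h1
      linarith
    rw [← hconst i 0 (by omega) y hy]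
    obtain ⟨k, rfl⟩ : ∃ k, i = k + 1 := ⟨i - 1, by omega⟩
    exact hint (List.replicate (k + 1) RiskType.high) RiskType.low
      (by rwa [List.length_replicate]) (mul_pos (historyProb_replicate_pos k) hq) y hy
  have hx : ∀ i < m.T, m.u m.cO ≤ m.u (c i) := by
    intro i hi
    rw [← coe_eq_cO_of_u_mul (hc0.trans hW), m.u_le_u_iff (c 0).coe_nonneg (c i).coe_nonneg]
    exact NNReal.coe_le_coe.2 (hopt.zero_le hsuper hq hdown hzpos hcpos i hi)
  refine SameOutcome.survives_reentry habs (sameOutcome_insuringMechanism habs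
    (fun i _ y => by rw [hred.flow]) fun i j hij _ => hconst i j hij) hup hdown hx

/-! ### Competitive contracts when types are permanent -/

theorem exists_time_average (w : ℕ → m.FlowContract) :
    ∃ x : m.FlowContract, ∀ y, m.u (x y) * m.annuity m.T =
      ∑ j ∈ Finset.range m.T, m.δ ^ j * m.u (w j y) := by
  have hA := m.annuity_pos m.T_pos
  have hex : ∀ y, ∃ x, 0 ≤ x ∧ m.u x * m.annuity m.T =
      ∑ j ∈ Finset.range m.T, m.δ ^ j * m.u (w j y) := by
    intro y
    set b : ℝ := ∑ j ∈ Finset.range m.T, (w j y : ℝ) with hb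
    have hb0 : 0 ≤ b := Finset.sum_nonneg fun j _ => (w j y).coe_nonneg
    have h1 : m.u 0 * m.annuity m.T ≤ ∑ j ∈ Finset.range m.T, m.δ ^ j * m.u (w j y) := by
      rw [annuity, Finset.mul_sum]
      refine Finset.sum_le_sum fun j _ => ?_
      rw [mul_comm]
      exact mul_le_mul_of_nonneg_left (m.u_zero_le (w j y).coe_nonneg) (pow_nonneg m.δ_pos.le _)
    have h2 : ∑ j ∈ Finset.range m.T, m.δ ^ j * m.u (w j y) ≤ m.u b * m.annuity m.T := by
      rw [annuity, Finset.mul_sum]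
      refine Finset.sum_le_sum fun j hj => ?_
      rw [mul_comm (m.u b)]
      exact mul_le_mul_of_nonneg_left ((m.u_le_u_iff (w j y).coe_nonneg hb0).2
        (Finset.single_le_sum (f := fun j => (w j y : ℝ)) (fun j _ => (w j y).coe_nonneg) hj))
        (pow_nonneg m.δ_pos.le _)
    obtain ⟨x, hx0, -, hx⟩ := m.exists_consumption hb0 ((le_div_iff₀ hA).2 h1)
      ((div_le_iff₀ hA).2 h2)
    exact ⟨x, hx0, by rw [hx, div_mul_cancel₀ _ hA.ne']⟩
  choose x hx0 hx using hex
  exact ⟨fun y => ⟨x y, hx0 y⟩, hx⟩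

theorem v_time_average {w : ℕ → m.FlowContract} {x : m.FlowContract}
    (hx : ∀ y, m.u (x y) * m.annuity m.T = ∑ j ∈ Finset.range m.T, m.δ ^ j * m.u (w j y))
    (θ : RiskType) :
    m.v x θ * m.annuity m.T = ∑ j ∈ Finset.range m.T, m.δ ^ j * m.v (w j) θ := by
  simp only [v, Finset.mul_sum, Finset.sum_mul]
  rw [Finset.sum_comm]
  refine Finset.sum_congr rfl fun y _ => ?_
  rw [mul_assoc, hx, Finset.mul_sum]
  exact Finset.sum_congr rfl fun j _ => by ring

/-- Jensen's inequality across periods, income by income. The equality case identifies the flow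
contracts of an optimal mechanism with their average. -/
theorem auxCost_time_average {w : ℕ → m.FlowContract} {x : m.FlowContract}
    (hx : ∀ y, m.u (x y) * m.annuity m.T = ∑ j ∈ Finset.range m.T, m.δ ^ j * m.u (w j y)) :
    m.auxCost x * m.annuity m.T ≤ ∑ j ∈ Finset.range m.T, m.δ ^ j * m.auxCost (w j) ∧
      (m.auxCost x * m.annuity m.T = ∑ j ∈ Finset.range m.T, m.δ ^ j * m.auxCost (w j) →
        ∀ j < m.T, ∀ y, w j y = x y) := by
  have e1 : ∑ j ∈ Finset.range m.T, m.δ ^ j * m.auxCost (w j) =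
      ∑ y, m.p RiskType.high y * ∑ j ∈ Finset.range m.T, m.δ ^ j * (w j y : ℝ) := by
    simp only [auxCost, Finset.mul_sum]
    rw [Finset.sum_comm]
    exact Finset.sum_congr rfl fun y _ => Finset.sum_congr rfl fun j _ => by ring
  have e2 : m.auxCost x * m.annuity m.T = ∑ y, m.p RiskType.high y * (x y * m.annuity m.T) := by
    simp only [auxCost, Finset.sum_mul, mul_assoc]
  have e3 : ∀ y, (x y : ℝ) * m.annuity m.T = ∑ j ∈ Finset.range m.T,
      m.δ ^ j * (x y + (m.u (w j y) - m.u (x y)) * m.mc (x y)) := by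
    intro y
    have h1 : ∀ j, m.δ ^ j * ((x y : ℝ) + (m.u (w j y) - m.u (x y)) * m.mc (x y)) =
        m.δ ^ j * x y + m.δ ^ j * m.u (w j y) * m.mc (x y) -
          m.δ ^ j * (m.u (x y) * m.mc (x y)) := fun j => by ring
    simp only [h1, Finset.sum_add_distrib, Finset.sum_sub_distrib, ← Finset.sum_mul, ← hx y]
    rw [← annuity]
    ring
  have hle : ∀ y, ∀ j ∈ Finset.range m.T,
      m.δ ^ j * ((x y : ℝ) + (m.u (w j y) - m.u (x y)) * m.mc (x y)) ≤ m.δ ^ j * (w j y : ℝ) :=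
    fun y j _ => mul_le_mul_of_nonneg_left
      (m.tangent_cost_le (x y).coe_nonneg (w j y).coe_nonneg) (pow_nonneg m.δ_pos.le _)
  have hle' : ∀ y ∈ Finset.univ, m.p RiskType.high y * (x y * m.annuity m.T) ≤
      m.p RiskType.high y * ∑ j ∈ Finset.range m.T, m.δ ^ j * (w j y : ℝ) := fun y _ => by
    rw [e3 y]
    exact mul_le_mul_of_nonneg_left (Finset.sum_le_sum (hle y)) (m.p_nonneg _ _)
  rw [e1, e2]
  refine ⟨Finset.sum_le_sum hle', fun he j hj y => ?_⟩
  have h1 := (Finset.sum_eq_sum_iff_of_le hle').1 he y (Finset.mem_univ y)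
  have h2 := mul_left_cancel₀ (m.p_high_pos y).ne' h1
  rw [e3 y] at h2
  have h3 := (Finset.sum_eq_sum_iff_of_le (hle y)).1 h2 j (Finset.mem_range.2 hj)
  have h4 := mul_left_cancel₀ (pow_pos m.δ_pos j).ne' h3
  by_contra hne
  exact (m.tangent_cost_lt (x y).coe_nonneg (w j y).coe_nonneg
    (fun h => hne (NNReal.coe_injective h))).ne h4

/-- For permanent types, pretending forever is the deviation whose payoff depends only on the flow
contracts of the high type; it bounds the time average that a low type could obtain. -/
theorem strategyUtility_always_high (habs : m.LowAbsorbing) {M : m.Mechanism}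
    (h : ∀ i, z i = M (List.replicate (i + 1) RiskType.high)) (n i : ℕ)
    (η : m.PrivateHistory) (hη : m.reports η = List.replicate i RiskType.high) :
    m.strategyUtility M (fun _ _ => RiskType.high) n η RiskType.low =
      ∑ j ∈ Finset.range n, m.δ ^ j * m.v (z (i + j)) RiskType.low := by
  induction n generalizing i η with
  | zero => rfl
  | succ n ih =>
    have h1 : ∀ y, m.strategyUtility M (fun _ _ => RiskType.high) n
        ((y, RiskType.high, RiskType.low) :: η) RiskType.low =
        ∑ j ∈ Finset.range n, m.δ ^ j * m.v (z (i + 1 + j)) RiskType.low :=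
      fun y => ih (i + 1) _ (congrArg _ hη)
    have h2 : RiskType.high :: List.replicate i RiskType.high =
      List.replicate (i + 1) RiskType.high := rfl
    rw [strategyUtility, Finset.sum_range_succ']
    simp only [habs.sum_trans_low, h1, ← Finset.sum_mul, m.p_sum, one_mul, hη, h2, ← h, add_zero,
      pow_zero]
    rw [add_comm, Finset.mul_sum]
    congr 1
    refine Finset.sum_congr rfl fun j _ => ?_
    rw [show i + 1 + j = i + (j + 1) by omega, pow_succ']
    ring

theorem highValue_stationary (hq : m.trans RiskType.high RiskType.low = 0) (x : m.FlowContract)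
    (n i : ℕ) : m.highValue (fun _ => x) c n i = m.v x RiskType.high * m.annuity n := by
  have hqh : m.trans RiskType.high RiskType.high = 1 := by linarith [m.trans_high_sum]
  induction n generalizing i with
  | zero => simp [highValue, annuity_zero]
  | succ n ih =>
    rw [highValue, ih, hq, hqh, annuity_succ]
    ring

theorem highCost_stationary (hq : m.trans RiskType.high RiskType.low = 0) (x : m.FlowContract)
    (n i : ℕ) : m.highCost (fun _ => x) c n i = m.auxCost x * m.annuity n := by
  have hqh : m.trans RiskType.high RiskType.high = 1 := by linarith [m.trans_high_sum]
  induction n generalizing i with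
  | zero => simp [highCost, annuity_zero]
  | succ n ih =>
    rw [highCost, ih, hq, hqh, annuity_succ]
    ring

/-- Upward incentives of `M` after the first period are unrestricted on path, so the reduction need
not be incentive compatible. The stationary contract with averaged utilities and constant level `c
0` is; optimality of `M` then makes all cost comparisons equalities, so that it has the outcome of
`M`. -/
theorem IsProfitMaximizing.survives_reentry_of_trans_eq_zero {W : RiskType → ℝ}
    {M : m.Mechanism} (hM : m.IsProfitMaximizing W M) (habs : m.LowAbsorbing)
    (hW : W RiskType.low = m.u m.cO * m.annuity m.T)
    (hWle : W RiskType.low ≤ W RiskType.high) (hq : m.trans RiskType.high RiskType.low = 0) :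
    (∀ (past : List RiskType) (θ : RiskType), past.length < m.T →
      0 < m.historyProb (θ :: past) → m.VO (past.length + 1) ≤ m.V M past θ) ∧
    (∃ M' : m.Mechanism, m.SameOutcome M M' ∧
      ∀ (r : m.ReportingStrategy) (e : m.ReentryPlan) (θ : RiskType),
        m.reentryUtility M' r e m.T [] θ ≤ m.V M' [] θ) := by
  obtain ⟨z, c, hred⟩ := exists_isReduction habs M
  have hA := m.annuity_pos m.T_pos
  have hqh : m.trans RiskType.high RiskType.high = 1 := by linarith [m.trans_high_sum]
  have hc0 := hred.level_zero hM.2.1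
  have hcO : (c 0 : ℝ) = m.cO := coe_eq_cO_of_u_mul (hc0.trans hW)
  have hH0 := hred.value_zero hM.2.1
  have hl := hred.cost_low_le habs 0 m.T (zero_add _)
  have hh := hred.highCost_le habs m.T 0 (zero_add _)
  rw [List.replicate_zero] at hl hh
  obtain ⟨x, hx⟩ := exists_time_average z
  have hval : m.highValue z c m.T 0 = m.v x RiskType.high * m.annuity m.T := by
    rw [highValue_eq_sum, v_time_average hx]
    simp only [hq, hqh, mul_one, mul_zero, zero_mul, add_zero, zero_add]
  have hcost : m.highCost z c m.T 0 = ∑ j ∈ Finset.range m.T, m.δ ^ j * m.auxCost (z j) := by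
    rw [highCost_eq_sum]
    simp only [hq, hqh, mul_one, mul_zero, zero_mul, add_zero, zero_add]
  obtain ⟨hav, haveq⟩ := auxCost_time_average hx
  rw [← hcost] at hav haveq
  have hlowx : m.v x RiskType.low ≤ m.u m.cO := by
    refine le_of_mul_le_mul_right ?_ hA
    have h1 := hM.1.strategyUtility_le (fun _ _ => RiskType.high) RiskType.low
    rw [strategyUtility_always_high habs hred.flow m.T 0 [] rfl, hM.2.1, hW] at h1
    rw [v_time_average hx]
    simpa only [zero_add] using h1
  have hhighx : m.u m.cO ≤ m.v x RiskType.high := by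
    refine le_of_mul_le_mul_right ?_ hA
    rw [← hval, hH0, ← hW]
    exact hWle
  have hup : m.UpwardIC (fun _ => x) (fun _ => c 0) := by
    intro i n _
    rw [hcO, annuity_succ]
    linarith
  have hdown : m.DownwardIC (fun _ => x) (fun _ => c 0) := by
    intro i n _
    rw [highValue_stationary hq, hcO]
    exact mul_le_mul_of_nonneg_right hhighx (m.annuity_nonneg n)
  have hle := hM.cost_le habs hup hdown hc0
    (by rw [highValue_stationary hq, ← hval, hH0])
  rw [highCost_stationary hq] at hle
  have hil := m.init_pos RiskType.low
  have hih := m.init_pos RiskType.high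
  have hl' := mul_le_mul_of_nonneg_left hl hil.le
  have hh' := mul_le_mul_of_nonneg_left (hav.trans hh) hih.le
  have hel : c 0 * m.annuity m.T = m.continuationCost M m.T [] RiskType.low :=
    mul_left_cancel₀ hil.ne' (by linarith)
  have heh : m.auxCost x * m.annuity m.T = m.continuationCost M m.T [] RiskType.high :=
    mul_left_cancel₀ hih.ne' (by linarith)
  have hzx := haveq (le_antisymm hav (by rw [heh]; exact hh))
  refine SameOutcome.survives_reentry habs (sameOutcome_insuringMechanism habs
    (fun i hi y => by rw [← hred.flow, hzx i hi]) fun i j hij hi y hy => ?_) hup hdown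
    fun i _ => by rw [hcO]
  have hi0 : i = 0 := hi.resolve_right (by rw [hq]; exact lt_irrefl _)
  rw [hi0] at hij ⊢
  exact hred.eq_of_cost_low_eq habs 0 m.T (zero_add _) hel j (by omega) y hy

end InsuranceModel

end

theorem mainTheorem11 (m : InsuranceModel) (habs : m.LowAbsorbing) (hsuper : m.CostSupermodular)
    (M : m.Mechanism) (hM : m.IsCompetitiveContract M) (hint : m.Interior M) :
    (∀ (past : List RiskType) (θ : RiskType), past.length < m.T →
      0 < m.historyProb (θ :: past) → m.VO (past.length + 1) ≤ m.V M past θ) ∧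
    (∃ M' : m.Mechanism, m.SameOutcome M M' ∧
      ∀ (r : m.ReportingStrategy) (e : m.ReentryPlan) (θ : RiskType),
        m.reentryUtility M' r e m.T [] θ ≤ m.V M' [] θ) := by
  obtain ⟨W, hW, hmax, h0⟩ := hM
  rw [InsuranceModel.VFI_low habs] at hW
  have hWle := hmax.low_le_high habs hW h0
  rcases (m.trans_nonneg RiskType.high RiskType.low).lt_or_eq with hq | hq
  · exact hmax.survives_reentry_of_trans_pos habs hsuper hint hW hWle hq
  · exact hmax.survives_reentry_of_trans_eq_zero habs hW hWle hq.symm
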